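/- **Setting.** Let $\Omega\subset\mathbb R^d$ ($d\ge1$) be a bounded convex domain, $T>0$, $0<\alpha<1$, $\sigma=\alpha/2$; $(\cdot,\cdot)$ and $\|\cdot\|$ denote the scalar product and norm of $L^2(\Omega)$. Assume: (H1) $u_0\in H^2(\Omega)\cap H^1_0(\Omega)$ and $f\in L^\infty(0,T;L^2(\Omega))$, where $f$ is represented so that $\|f(t)\|\le\|f\|_{L^\infty(0,T;L^2(\Omega))}$ for every $t\in[0,T]$. (H2) $M:\bar\Omega\times[0,T]\times(0,\infty)\to(0,\infty)$ is Lipschitz with constant $L_M$ (that is, $|M(x,t,s)-M(x',t',s')|\le L_M(|x-x'|+|t-t'|+|s-s'|)$), and is extended continuously to $s=0$; $M\ge m_0>0$, and $m_0-4L_MK^2>0$ with $K=\|\nabla u_0\|+\|f\|_{L^\infty(0,T;L^2(\Omega))}$. (H3) $b_2$ (with values in the symmetric positive definite $d\times d$ matrices), $b_1$ ($\mathbb R^d$-valued) and $b_0$ (real-valued) are smooth on $\bar\Omega\times[0,T]\times[0,T]$; put $B(t,s,u,v)=(b_2\nabla u,\nabla v)+(\nabla\cdot(b_1u),v)+(b_0u,v)$.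 **Finite elements.** Fix $\gamma>0$, $\kappa\ge0$. A triangulation $\mathbb T_h$ of $\Omega$ of size $h$ is a finite conforming complex of $d$-simplices contained in $\bar\Omega$, each of diameter at most $h$ and containing a ball of radius $\gamma h$, such that all points of $\Omega$ left uncovered are at distance at most $\kappa h$ from $\partial\Omega$. $X_h$ is the space of continuous functions that are affine on each simplex and vanish on $\partial\Omega$ and on the uncovered part of $\Omega$. **Scheme.** Let $k=T/N$, $t_n=nk$, $t_{n-\sigma}=(1-\sigma)t_n+\sigma t_{n-1}$, $g^{n-\sigma}=g(t_{n-\sigma})$. Put $\tilde a_0=(1-\sigma)^{1-\alpha}$ and, for $l\ge1$, $\tilde a_l=(l+1-\sigma)^{1-\alpha}-(l-\sigma)^{1-\alpha}$ and $$\tilde b_l=\tfrac1{2-\alpha}\big[(l+1-\sigma)^{2-\alpha}-(l-\sigma)^{2-\alpha}\big]-\tfrac12\big[(l+1-\sigma)^{1-\alpha}+(l-\sigma)^{1-\alpha}\big].$$ Put $\tilde c^{(1)}_0=\tilde a_0$ and, for $n\ge2$, $\tilde c^{(n)}_0=\tilde a_0+\tilde b_1$, $\tilde c^{(n)}_j=\tilde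 a_j+\tilde b_{j+1}-\tilde b_j$ ($1\le j\le n-2$), $\tilde c^{(n)}_{n-1}=\tilde a_{n-1}-\tilde b_{n-1}$, and $$\tilde{\mathbb D}^\alpha_{t_{n-\sigma}}u^n=\frac{k^{-\alpha}}{\Gamma(2-\alpha)}\sum_{j=1}^n\tilde c^{(n)}_{n-j}(u^j-u^{j-1}).$$ Put $\hat u^{n,\sigma}=(1-\sigma)u^n+\sigma u^{n-1}$ and $\bar u^{n-1,\sigma}=(2-\sigma)u^{n-1}-(1-\sigma)u^{n-2}$. Let $\tilde w_{nj}$ be the weight of $g(t_j)$ in the modified Simpson rule for $\int_0^{t_{n-\sigma}}g$: with $m_1=\lfloor k^{-1/2}\rfloor$, $k_1=m_1k$ and $j_n$ the largest even integer with $j_nk_1<t_n$, one uses Simpson's rule on $[0,j_nk_1]$ with nodes $jk_1$, the trapezoidal rule with step $k$ on $[j_nk_1,t_{n-1}]$, and $(1-\sigma)k\,g(t_{n-1})$ for the remaining interval. The scheme $(F_\alpha)$ asks for $u_h^0,\dots,u_h^N\in X_h$ such that for all $v_h\in X_h$: * $(M(x,0,\|\nabla u_0\|^2)\nabla(u_0-u_h^0),\nabla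 v_h)=0$; * for $n=1$: $(\tilde{\mathbb D}^\alpha_{t_{1-\sigma}}u_h^1,v_h)+(M(x,t_{1-\sigma},\|\nabla\hat u_h^{1,\sigma}\|^2)\nabla\hat u_h^{1,\sigma},\nabla v_h)=(1-\sigma)kB(t_{1-\sigma},t_0,u_h^0,v_h)+(f^{1-\sigma},v_h)$; * for $2\le n\le N$: $(\tilde{\mathbb D}^\alpha_{t_{n-\sigma}}u_h^n,v_h)+(M(x,t_{n-\sigma},\|\nabla\bar u_h^{n-1,\sigma}\|^2)\nabla\hat u_h^{n,\sigma},\nabla v_h)=\sum_{j=1}^{n-1}\tilde w_{nj}B(t_{n-\sigma},t_j,u_h^j,v_h)+(f^{n-\sigma},v_h)$. **Theorem.** Under (H1), (H2), (H3) there is $k_0>0$, depending only on the data and on $\gamma,\kappa$ (not on $h$ or $\mathbb T_h$), such that for every $h>0$, every such triangulation and every $N\ge1$ with $k=T/N\le1$: 1. for every $2\le n\le N$ and all prescribed $u_h^0,\dots,u_h^{n-1}\in X_h$, the equation of step $n$ is a linear system for $u_h^n$ with a symmetric positive definite matrix in every basis of $X_h$, and has exactly one solution; 2. $(F_\alpha)$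 has a solution; 3. if moreover $k<k_0$, the solution of $(F_\alpha)$ is unique. -/

import Mathlib

open MeasureTheory Set Filter Topology
open scoped ContDiff Matrix

noncomputable section

namespace KirchhoffFEM

/-- Euclidean space `ℝᵈ`. -/
abbrev E (d : ℕ) := EuclideanSpace ℝ (Fin d)

/-! ### Scalar products and Sobolev spaces -/

/-- `(u, v) = ∫_Ω u v dx`. -/
def l2 {d : ℕ} (Ω : Set (E d)) (u v : E d → ℝ) : ℝ := ∫ x in Ω, u x * v x

/-- `∫_Ω a F · G dx` for a scalar coefficient `a` and vector fields `F`, `G`. -/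
def l2w {d : ℕ} (Ω : Set (E d)) (a : E d → ℝ) (F G : E d → E d) : ℝ :=
  ∫ x in Ω, a x * inner ℝ (F x) (G x)

/-- `‖F‖² = ∫_Ω |F|² dx` for a vector field `F`. -/
def normSq {d : ℕ} (Ω : Set (E d)) (F : E d → E d) : ℝ := ∫ x in Ω, ‖F x‖ ^ 2

/-- Test functions: elements of `C_c^∞(Ω)`. -/
def IsTest {d : ℕ} (Ω : Set (E d)) (φ : E d → ℝ) : Prop :=
  ContDiff ℝ ∞ φ ∧ HasCompactSupport φ ∧ tsupport φ ⊆ Ω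

/-- `g` is the distributional gradient of `u` in `Ω`. -/
def HasWeakGradient {d : ℕ} (Ω : Set (E d)) (u : E d → ℝ) (g : E d → E d) : Prop :=
  ∀ φ : E d → ℝ, IsTest Ω φ → ∀ i : Fin d,
    ∫ x in Ω, u x * gradient φ x i = - ∫ x in Ω, g x i * φ x

/-- `u ∈ H²(Ω)`, with distributional gradient `g`. -/
def MemH2 {d : ℕ} (Ω : Set (E d)) (u : E d → ℝ) (g : E d → E d) : Prop :=
  MemLp u 2 (volume.restrict Ω) ∧ MemLp g 2 (volume.restrict Ω) ∧ HasWeakGradient Ω u g ∧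
    ∃ H : Fin d → E d → E d, ∀ i, MemLp (H i) 2 (volume.restrict Ω) ∧
      HasWeakGradient Ω (fun x => g x i) (H i)

/-- `u ∈ H¹₀(Ω)`, with gradient `g`: the pair `(u, g)` is the limit in `L²` of pairs
`(φₙ, ∇φₙ)` with `φₙ ∈ C_c^∞(Ω)`. -/
def MemH10 {d : ℕ} (Ω : Set (E d)) (u : E d → ℝ) (g : E d → E d) : Prop :=
  MemLp u 2 (volume.restrict Ω) ∧ MemLp g 2 (volume.restrict Ω) ∧
    ∃ φ : ℕ → E d → ℝ, (∀ n, IsTest Ω (φ n)) ∧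
      Tendsto (fun n => eLpNorm (fun x => u x - φ n x) 2 (volume.restrict Ω)) atTop (𝓝 0) ∧
      Tendsto (fun n => eLpNorm (fun x => g x - gradient (φ n) x) 2 (volume.restrict Ω))
        atTop (𝓝 0)

/-! ### The data of the problem and the hypotheses -/

/-- The data of the problem (without hypotheses). `Du₀` stands for the gradient of `u₀`, and
`f t` is the element `f(·,t)` of `L²(Ω)`. The coefficient `M x t s` is used for `s ≥ 0` only. -/
structure Data (d : ℕ) where
  Ω : Set (E d)
  T : ℝ
  α : ℝ
  u₀ : E d → ℝ
  Du₀ : E d → E d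
  f : ℝ → Lp ℝ 2 ((volume : Measure (E d)).restrict Ω)
  M : E d → ℝ → ℝ → ℝ
  b₂ : E d → ℝ → ℝ → Matrix (Fin d) (Fin d) ℝ
  b₁ : E d → ℝ → ℝ → E d
  b₀ : E d → ℝ → ℝ → ℝ

namespace Data

variable {d : ℕ} (D : Data d)

/-- `Ω` is a bounded convex domain, `T > 0` and `0 < α < 1`. -/
structure Standing : Prop where
  isOpen : IsOpen D.Ω
  convex : Convex ℝ D.Ω
  bounded : Bornology.IsBounded D.Ω
  T_pos : 0 < D.T
  α_pos : 0 < D.α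
  α_lt_one : D.α < 1

/-- `‖f‖_{L^∞(0,T;L²(Ω))}`. -/
def fNorm : ℝ := (eLpNorm D.f ⊤ (volume.restrict (Icc 0 D.T))).toReal

/-- `K = ‖∇u₀‖ + ‖f‖_{L^∞(0,T;L²(Ω))}`. -/
def K : ℝ := Real.sqrt (normSq D.Ω D.Du₀) + D.fNorm

/-- `u₀ ∈ H² ∩ H¹₀` and `f ∈ L^∞(0,T;L²(Ω))`. Since the scheme evaluates `f` at single times,
`f` is a representative that obeys its essential bound at every time. -/
structure H1 : Prop where
  memH2 : MemH2 D.Ω D.u₀ D.Du₀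
  memH10 : MemH10 D.Ω D.u₀ D.Du₀
  memLp_f : MemLp D.f ⊤ (volume.restrict (Icc 0 D.T))
  f_le : ∀ t ∈ Icc 0 D.T, ‖D.f t‖ ≤ D.fNorm

/-- `M` is Lipschitz with constant `L` and bounded below by `m₀ > 0`, and `m₀ - 4 L K² > 0`.
A Lipschitz function of `s ∈ (0,∞)` is identified with its continuous extension to `[0,∞)`. -/
structure H2 (m₀ L : ℝ) : Prop where
  lipschitz : ∀ x ∈ closure D.Ω, ∀ y ∈ closure D.Ω, ∀ t ∈ Icc 0 D.T, ∀ t' ∈ Icc 0 D.T,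
    ∀ s ∈ Ici (0 : ℝ), ∀ s' ∈ Ici (0 : ℝ),
      |D.M x t s - D.M y t' s'| ≤ L * (‖x - y‖ + |t - t'| + |s - s'|)
  m₀_pos : 0 < m₀
  lower : ∀ x ∈ closure D.Ω, ∀ t ∈ Icc 0 D.T, ∀ s ∈ Ici (0 : ℝ), m₀ ≤ D.M x t s
  small : 0 < m₀ - 4 * L * D.K ^ 2

/-- The set `Ω̄ × [0,T] × [0,T]`. -/
def cyl : Set (E d × ℝ × ℝ) := closure D.Ω ×ˢ Icc 0 D.T ×ˢ Icc 0 D.T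

/-- The coefficients of the memory operator are smooth and `b₂` is symmetric positive definite. -/
structure H3 : Prop where
  posDef : ∀ x ∈ closure D.Ω, ∀ t ∈ Icc 0 D.T, ∀ s ∈ Icc 0 D.T, (D.b₂ x t s).PosDef
  smooth₂ : ∀ i j, ContDiffOn ℝ ∞ (fun p : E d × ℝ × ℝ => D.b₂ p.1 p.2.1 p.2.2 i j) D.cyl
  smooth₁ : ∀ j, ContDiffOn ℝ ∞ (fun p : E d × ℝ × ℝ => D.b₁ p.1 p.2.1 p.2.2 j) D.cyl
  smooth₀ : ContDiffOn ℝ ∞ (fun p : E d × ℝ × ℝ => D.b₀ p.1 p.2.1 p.2.2) D.cyl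

end Data

/-- The classical divergence of a vector field. -/
def divergence {d : ℕ} (F : E d → E d) (x : E d) : ℝ :=
  ∑ i : Fin d, fderiv ℝ F x (EuclideanSpace.single i 1) i

/-- The form `B(t,s,u,v) = (b₂∇u,∇v) + (∇·(b₁u),v) + (b₀u,v)`; it is used for continuous
piecewise affine `u`, `v`, whose weak gradients are their classical gradients almost everywhere. -/
def Data.B {d : ℕ} (D : Data d) (t s : ℝ) (u v : E d → ℝ) : ℝ :=
  (∫ x in D.Ω, (D.b₂ x t s *ᵥ (gradient u x).ofLp) ⬝ᵥ (gradient v x).ofLp)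
    + (∫ x in D.Ω, divergence (fun y => u y • D.b₁ y t s) x * v x)
    + ∫ x in D.Ω, D.b₀ x t s * u x * v x

/-! ### Triangulations and the finite element space -/

/-- A (conforming) triangulation of `Ω` of mesh size `h`, with regularity constants `γ`, `κ`: a
finite complex of `d`-simplices in `Ω̄`, of diameter at most `h` and each containing a ball of
radius `γ h`, that leaves out of `Ω` at most points at distance `≤ κ h` from the boundary (none
for a polytope that is triangulated exactly; a curved boundary cannot be triangulated exactly). -/
structure IsTriangulation {d : ℕ} (Ω : Set (E d)) (γ κ h : ℝ)
    (𝒯 : Geometry.SimplicialComplex ℝ (E d)) : Prop where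
  finite : 𝒯.faces.Finite
  pure : ∀ s ∈ 𝒯.faces, ∃ t ∈ 𝒯.faces, s ⊆ t ∧ t.card = d + 1
  subset : 𝒯.space ⊆ closure Ω
  gap : ∀ x ∈ Ω, x ∉ 𝒯.space → Metric.infDist x (frontier Ω) ≤ κ * h
  diam_le : ∀ s ∈ 𝒯.faces, Metric.diam (convexHull ℝ (s : Set (E d))) ≤ h
  ball : ∀ s ∈ 𝒯.faces, s.card = d + 1 →
    ∃ x, Metric.closedBall x (γ * h) ⊆ convexHull ℝ (s : Set (E d))

/-- The space `X_h` of continuous functions that are affine on every simplex and vanish on `∂Ω`.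
The functions are extended by zero, outside `Ω` and to the part of `Ω` that is not covered. -/
def Xh {d : ℕ} (Ω : Set (E d)) (𝒯 : Geometry.SimplicialComplex ℝ (E d)) :
    Submodule ℝ (E d → ℝ) where
  carrier := {v | Continuous v ∧
    (∀ s ∈ 𝒯.faces, ∃ A : E d →ᵃ[ℝ] ℝ, EqOn v A (convexHull ℝ (s : Set (E d)))) ∧
    (∀ x, x ∉ Ω → v x = 0) ∧ ∀ x, x ∉ 𝒯.space → v x = 0}
  add_mem' := by
    rintro u v ⟨hu, hu1, hu2, hu3⟩ ⟨hv, hv1, hv2, hv3⟩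
    refine ⟨hu.add hv, fun s hs => ?_, fun x hx => ?_, fun x hx => ?_⟩
    · obtain ⟨A, hA⟩ := hu1 s hs
      obtain ⟨A', hA'⟩ := hv1 s hs
      exact ⟨A + A', fun x hx => by simp [hA hx, hA' hx]⟩
    · simp [hu2 x hx, hv2 x hx]
    · simp [hu3 x hx, hv3 x hx]
  zero_mem' := ⟨continuous_const, fun _ _ => ⟨0, fun _ _ => by simp⟩, by simp, by simp⟩
  smul_mem' := by
    rintro c v ⟨hv, hv1, hv2, hv3⟩
    refine ⟨hv.const_smul c, fun s hs => ?_, fun x hx => ?_, fun x hx => ?_⟩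
    · obtain ⟨A, hA⟩ := hv1 s hs
      exact ⟨c • A, fun x hx => by simp [hA hx]⟩
    · simp [hv2 x hx]
    · simp [hv3 x hx]

/-! ### The L2-1_σ weights, where `σ = α / 2` -/

/-- `ã_l`. -/
def aCoef (α : ℝ) (l : ℕ) : ℝ :=
  if l = 0 then (1 - α / 2) ^ (1 - α)
  else ((l : ℝ) + 1 - α / 2) ^ (1 - α) - ((l : ℝ) - α / 2) ^ (1 - α)

/-- `b̃_l`, for `l ≥ 1`. -/
def bCoef (α : ℝ) (l : ℕ) : ℝ :=
  1 / (2 - α) * (((l : ℝ) + 1 - α / 2) ^ (2 - α) - ((l : ℝ) - α / 2) ^ (2 - α))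
    - 1 / 2 * (((l : ℝ) + 1 - α / 2) ^ (1 - α) + ((l : ℝ) - α / 2) ^ (1 - α))

/-- `c̃_j^{(n)}`, for `0 ≤ j ≤ n - 1`. -/
def cCoef (α : ℝ) (n j : ℕ) : ℝ :=
  if n ≤ 1 then aCoef α 0
  else if j = 0 then aCoef α 0 + bCoef α 1
  else if j + 2 ≤ n then aCoef α j + bCoef α (j + 1) - bCoef α j
  else aCoef α j - bCoef α j

/-- The discrete Caputo derivative
`k^{-α} / Γ(2-α) * ∑_{j=1}^n c̃_{n-j}^{(n)} (u^j - u^{j-1})` at `t_{n-σ}`. -/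
def discreteCaputo {V : Type*} [AddCommGroup V] [Module ℝ V] (α k : ℝ) (n : ℕ) (U : ℕ → V) : V :=
  (k ^ (-α) / Real.Gamma (2 - α)) •
    ∑ j ∈ Finset.Icc 1 n, cCoef α n (n - j) • (U j - U (j - 1))

/-! ### The modified Simpson rule -/

/-- `m₁ = [k^{-1/2}]`. -/
def m₁ (k : ℝ) : ℕ := ⌊k ^ (-(1 / 2 : ℝ))⌋₊

/-- `j_n`, the largest even integer with `j_n k₁ < t_n`, where `k₁ = m₁ k`. -/
def jn (k : ℝ) (n : ℕ) : ℕ := Nat.findGreatest (fun j => Even j ∧ j * m₁ k < n) n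

/-- `J_n`, the index of the quadrature point `t_{n-1}`. -/
def Jn (k : ℝ) (n : ℕ) : ℕ := jn k n + (n - 1 - jn k n * m₁ k)

/-- The `j`-th quadrature point is `t_i` with `i = node k n j`. -/
def node (k : ℝ) (n j : ℕ) : ℕ :=
  if j ≤ jn k n then j * m₁ k else jn k n * m₁ k + (j - jn k n)

/-- The modified Simpson rule on `[0, t_{n-σ}]`, applied to the node values `g i = g(t_i)`:
Simpson's rule with step `k₁`, then the trapezoidal rule with step `k` up to `t_{n-1}`, then the
left rectangle rule. -/
def quad (α k : ℝ) (n : ℕ) (g : ℕ → ℝ) : ℝ :=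
  (m₁ k * k) / 3 * ∑ j ∈ Finset.Icc 1 (jn k n / 2),
      (g (node k n (2 * j)) + 4 * g (node k n (2 * j - 1)) + g (node k n (2 * j - 2)))
    + k / 2 * ∑ j ∈ Finset.Icc (jn k n + 1) (Jn k n), (g (node k n j) + g (node k n (j - 1)))
    + (1 - α / 2) * k * g (node k n (Jn k n))

/-- The quadrature weight `w̃_{nj}`, the coefficient of `g(t_j)` in the rule. -/
def weight (α k : ℝ) (n j : ℕ) : ℝ := quad α k n (Pi.single j 1)

/-! ### The scheme -/

section Scheme

variable {d : ℕ} (D : Data d) {𝒯 : Geometry.SimplicialComplex ℝ (E d)} (k : ℝ)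

/-- `t_{n-σ} = (1-σ) t_n + σ t_{n-1}`. -/
def tσ (α k : ℝ) (n : ℕ) : ℝ := (1 - α / 2) * (n * k) + α / 2 * (((n : ℝ) - 1) * k)

/-- `û^{n,σ} = (1-σ) u^n + σ u^{n-1}`. -/
def uHat {V : Type*} [AddCommGroup V] [Module ℝ V] (α : ℝ) (n : ℕ) (U : ℕ → V) : V :=
  (1 - α / 2) • U n + (α / 2) • U (n - 1)

/-- `ū^{n-1,σ} = (2-σ) u^{n-1} - (1-σ) u^{n-2}`. -/
def uBar {V : Type*} [AddCommGroup V] [Module ℝ V] (α : ℝ) (n : ℕ) (U : ℕ → V) : V :=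
  (2 - α / 2) • U (n - 1) - (1 - α / 2) • U (n - 2)

/-- `(M(x, t, ‖∇z‖²) ∇w, ∇v)`. -/
def diffusion (t : ℝ) (z w v : Xh D.Ω 𝒯) : ℝ :=
  l2w D.Ω (fun x => D.M x t (normSq D.Ω (gradient (z : E d → ℝ))))
    (gradient (w : E d → ℝ)) (gradient (v : E d → ℝ))

/-- The initial value `u_h^0 = W(0)`, the value at time `0` of the modified Ritz-Volterra
projection: `(M(x,0,‖∇u₀‖²) ∇(u₀ - u_h^0), ∇v) = 0` for all `v ∈ X_h`. -/
def IsInitial (w : Xh D.Ω 𝒯) : Prop :=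
  ∀ v : Xh D.Ω 𝒯,
    l2w D.Ω (fun x => D.M x 0 (normSq D.Ω D.Du₀))
      (fun x => D.Du₀ x - gradient (w : E d → ℝ) x) (gradient (v : E d → ℝ)) = 0

/-- Left-hand side minus right-hand side of the equation of the first time step. -/
def firstResidual (U : ℕ → Xh D.Ω 𝒯) (v : Xh D.Ω 𝒯) : ℝ :=
  l2 D.Ω (discreteCaputo D.α k 1 U : Xh D.Ω 𝒯) v
    + diffusion D (tσ D.α k 1) (uHat D.α 1 U) (uHat D.α 1 U) v
    - ((1 - D.α / 2) * k * D.B (tσ D.α k 1) 0 (U 0) v + l2 D.Ω (D.f (tσ D.α k 1)) v)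

/-- Left-hand side minus right-hand side of the equation of the time step `n ≥ 2`. -/
def stepResidual (n : ℕ) (U : ℕ → Xh D.Ω 𝒯) (v : Xh D.Ω 𝒯) : ℝ :=
  l2 D.Ω (discreteCaputo D.α k n U : Xh D.Ω 𝒯) v
    + diffusion D (tσ D.α k n) (uBar D.α n U) (uHat D.α n U) v
    - (∑ j ∈ Finset.Icc 1 (n - 1), weight D.α k n j * D.B (tσ D.α k n) (j * k) (U j) v
      + l2 D.Ω (D.f (tσ D.α k n)) v)

/-- `u_h^0, …, u_h^N` solve the linearized L2-1_σ Galerkin scheme. -/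
structure IsSolution (N : ℕ) (U : ℕ → Xh D.Ω 𝒯) : Prop where
  initial : IsInitial D (U 0)
  first : ∀ v, firstResidual D k U v = 0
  step : ∀ n, 2 ≤ n → n ≤ N → ∀ v, stepResidual D k n U v = 0

/-- The time step `n` is a linear system with a positive definite matrix: given the other `U j`,
for every basis `β` of `X_h` the residual of step `n` at `u^n = ∑ c_j β_j`, tested with the basis
functions, is `A c - r` with `A` symmetric positive definite. -/
def IsLinearPosDef (n : ℕ) (U : ℕ → Xh D.Ω 𝒯) : Prop :=
  ∀ (m : ℕ) (β : Module.Basis (Fin m) ℝ (Xh D.Ω 𝒯)),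
    ∃ (A : Matrix (Fin m) (Fin m) ℝ) (r : Fin m → ℝ), A.PosDef ∧
      ∀ (c : Fin m → ℝ) (i : Fin m),
        stepResidual D k n (Function.update U n (∑ j, c j • β j)) (β i) = (A *ᵥ c) i - r i

end Scheme

end KirchhoffFEM

end

noncomputable section

namespace KirchhoffFEM

/-! ### Coercive problems in finite dimensions -/

section Abstract

variable {V : Type*} [AddCommGroup V] [Module ℝ V]

/-! For `n ≥ 2` the argument of `M` is extrapolated from earlier values, so the unknown `u^n` enters
linearly. The bilinear form is a positive multiple of the `L²` product plus `(1-σ)` times the frozen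
diffusion form. It is symmetric and coercive, the first multiple being positive because `c̃_0^{(n)}
> 0` (`cCoef_zero_pos`). Lax–Milgram in finite dimensions then gives assertion 1. The initial value
is a linear elliptic projection of the same kind.

The only nonlinear step is `n = 1`. Written for `û = û^{1,σ}` it reads `c (û - u⁰, v) + (M(‖∇û‖²)∇û,
∇v) = l(v)`, with `c` a constant times `k^{-α}`. The nonlinearity sees `û` only through the number
`s = ‖∇û‖²`. Freezing `s` gives a linear problem with solution `x(s)`, and the intermediate value
theorem finds `s = ‖∇x(s)‖²`. This gives existence (`exists_firstEq`) without any smallness.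

For uniqueness, two solutions with gradients bounded by `R` differ by a `w` with `c‖w‖² + m₀‖∇w‖² ≤
2LR²‖∇w‖²` (`norm_eq_of_firstEq`). The right side must be absorbed for a threshold on `k` that is
independent of the mesh, and this is done differently on fine and on coarse meshes, separated by a
fixed size `h₁`.

On fine meshes `R` can be taken close to `K`, so that `2LR² < m₀` and ellipticity absorbs the term.
To see this, approximate `u₀` in `H¹₀` by a test function `φ`. Céa's lemma and nodal interpolation
make `∇u_h⁰` close to `∇φ` and to `∇u₀`. Integration by parts bounds `(M∇φ, ∇v)` by a multiple of
`‖v‖`, which the large `c` absorbs. Hence `∇(û - u_h⁰)` is small, whence `‖∇û‖ ≤ K + 2η`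
(`norm_le_of_firstEq_regular`).

On coarse meshes, `h ≥ h₁`, every simplex contains a ball of radius `γh₁`, so an inverse inequality
`‖∇v‖ ≤ I‖v‖` holds with a mesh-independent `I`. The term `c‖w‖²` then absorbs the right side once
`c` is large. Both cases are combined in `exists_firstEq_threshold`; since `c → ∞` as `k → 0`, this
yields `k₀`. -/

/-- The finite-dimensional Lax–Milgram lemma. -/
theorem existsUnique_of_coercive [FiniteDimensional ℝ V] (a : V →ₗ[ℝ] V →ₗ[ℝ] ℝ)
    (ha : ∀ v, v ≠ 0 → 0 < a v v) (l : V →ₗ[ℝ] ℝ) : ∃! u, ∀ v, a u v = l v := by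
  have hinj : Function.Injective a := by
    rw [injective_iff_map_eq_zero]
    intro u hu
    by_contra h
    have := ha u h
    simp [hu] at this
  have hsurj : Function.Surjective a :=
    (LinearMap.injective_iff_surjective_of_finrank_eq_finrank
      (V₂ := Module.Dual ℝ V) Subspace.dual_finrank_eq.symm).1 hinj
  obtain ⟨u, hu⟩ := hsurj l
  refine ⟨u, fun v => by rw [hu], fun u' hu' => hinj ?_⟩
  rw [hu]
  exact LinearMap.ext hu'

variable {H H' : Type*} [NormedAddCommGroup H] [InnerProductSpace ℝ H]
  [NormedAddCommGroup H'] [InnerProductSpace ℝ H']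

/-- A family of symmetric bilinear forms, coercive, of linear growth and Lipschitz in the
parameter. -/
structure FormFamily (H : Type*) [NormedAddCommGroup H] [InnerProductSpace ℝ H]
    (m₀ L Mb : ℝ) where
  form : ℝ → H →ₗ[ℝ] H →ₗ[ℝ] ℝ
  symm : ∀ s F F', form s F F' = form s F' F
  lower : ∀ s F, 0 ≤ s → m₀ * ‖F‖ ^ 2 ≤ form s F F
  upper : ∀ s F F', 0 ≤ s → |form s F F'| ≤ (Mb + L * s) * (‖F‖ * ‖F'‖)
  lip : ∀ s s' F F', 0 ≤ s → 0 ≤ s' →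
    |form s F F' - form s' F F'| ≤ L * |s - s'| * (‖F‖ * ‖F'‖)

variable {m₀ L Mb : ℝ} (A : FormFamily H m₀ L Mb) (J : V →ₗ[ℝ] H') (G : V →ₗ[ℝ] H)

/-- The elliptic form `c (Ju, Jv) + a_s(Gu, Gv)`. -/
def ellForm (c s : ℝ) : V →ₗ[ℝ] V →ₗ[ℝ] ℝ :=
  c • (innerₗ H').compl₁₂ J J + (A.form s).compl₁₂ G G

theorem ellForm_apply (c s : ℝ) (u v : V) :
    ellForm A J G c s u v = c * inner ℝ (J u) (J v) + A.form s (G u) (G v) := by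
  simp [ellForm]

theorem ellForm_pos (hm : 0 < m₀) (hG : Function.Injective G) {c s : ℝ} (hc : 0 ≤ c)
    (hs : 0 ≤ s) {v : V} (hv : v ≠ 0) : 0 < ellForm A J G c s v v := by
  rw [ellForm_apply, real_inner_self_eq_norm_sq]
  have h1 := A.lower s (G v) hs
  have h2 : 0 < ‖G v‖ := norm_pos_iff.2 fun h => hv (hG (by simpa using h))
  nlinarith [mul_pos hm (pow_pos h2 2), mul_nonneg hc (sq_nonneg ‖J v‖)]

/-- The nonlinear equation of the first time step, in terms of `u = û^{1,σ}`. -/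
def FirstEq (c : ℝ) (u₀ : V) (l : V →ₗ[ℝ] ℝ) (u : V) : Prop :=
  ∀ v, c * inner ℝ (J (u - u₀)) (J v) + A.form (‖G u‖ ^ 2) (G u) (G v) = l v

variable {A J G}

/-- Division by `y` is legitimate for `y > 0`; otherwise `b ≥ 0` settles the claim. This is how an
energy inequality becomes a norm bound. -/
theorem le_of_mul_sq_le {a b y : ℝ} (ha : 0 < a) (hb : 0 ≤ b) (h : a * y ^ 2 ≤ b * y) :
    y ≤ b / a := by
  rw [le_div_iff₀ ha]
  by_contra hlt
  push Not at hlt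
  have hy : 0 < y := by
    by_contra hy
    nlinarith
  nlinarith

/-- The form depends on `u` through the single number `‖G u‖²`, so a one-dimensional fixed point
argument is enough. The solution `x s` of the problem frozen at `s` satisfies an a priori bound
uniform in `s`, and `G (x s)` is Lipschitz in `s`. -/
theorem exists_firstEq [FiniteDimensional ℝ V] (hm : 0 < m₀) (hL : 0 ≤ L)
    (hG : Function.Injective G) {c : ℝ} (hc : 0 ≤ c) (u₀ : V) (l : V →ₗ[ℝ] ℝ) {D : ℝ} (hD : 0 ≤ D)
    (hl : ∀ v, |l v + c * inner ℝ (J u₀) (J v)| ≤ D * ‖G v‖) :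
    ∃ u, FirstEq A J G c u₀ l u := by
  have hex : ∀ s : ℝ, ∃ u, 0 ≤ s → ∀ v, ellForm A J G c s u v = l v + c * inner ℝ (J u₀) (J v) := by
    intro s
    by_cases hs : 0 ≤ s
    · obtain ⟨u, hu, -⟩ := existsUnique_of_coercive (ellForm A J G c s)
        (fun v hv => ellForm_pos A J G hm hG hc hs hv) (l + c • (innerₗ H' (J u₀)).comp J)
      exact ⟨u, fun _ v => by rw [hu]; simp⟩
    · exact ⟨0, fun h => absurd h hs⟩
  choose x hx using hex
  have hbound : ∀ s, 0 ≤ s → ‖G (x s)‖ ≤ D / m₀ := by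
    intro s hs
    have h1 := hx s hs (x s)
    have h2 := le_of_abs_le (hl (x s))
    rw [← h1, ellForm_apply, real_inner_self_eq_norm_sq] at h2
    have h3 := A.lower s (G (x s)) hs
    exact le_of_mul_sq_le hm hD (by nlinarith [mul_nonneg hc (sq_nonneg ‖J (x s)‖)])
  -- Subtract the problems frozen at `s` and `s'`, tested with the difference. What remains is the
  -- change of the form evaluated at `x s'`, whose gradient is at most `D / m₀`.
  have hlip : ∀ s, 0 ≤ s → ∀ s', 0 ≤ s' →
      ‖G (x s) - G (x s')‖ ≤ (L * (D / m₀) / m₀) * |s - s'| := by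
    intro s hs s' hs'
    set w := x s - x s' with hw
    have h1 := hx s hs w
    rw [← hx s' hs' w, ellForm_apply, ellForm_apply] at h1
    have h2 : c * ‖J w‖ ^ 2 + A.form s (G w) (G w)
        = -(A.form s (G (x s')) (G w) - A.form s' (G (x s')) (G w)) := by
      have e1 : inner ℝ (J w) (J w) = inner ℝ (J (x s)) (J w) - inner ℝ (J (x s')) (J w) := by
        rw [← inner_sub_left, ← map_sub]
      have e2 : A.form s (G w) (G w) = A.form s (G (x s)) (G w) - A.form s (G (x s')) (G w) := by
        rw [← LinearMap.sub_apply, ← map_sub, ← map_sub]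
      rw [← real_inner_self_eq_norm_sq, e1, e2]
      linarith
    have h3 := A.lip s s' (G (x s')) (G w) hs hs'
    have h4 := A.lower s (G w) hs
    have h5 := neg_le_of_abs_le h3
    have h6 : L * |s - s'| * (‖G (x s')‖ * ‖G w‖) ≤ L * |s - s'| * (D / m₀ * ‖G w‖) := by
      gcongr
      exact hbound s' hs'
    have h7 : ‖G w‖ ≤ (L * |s - s'| * (D / m₀)) / m₀ :=
      le_of_mul_sq_le hm (by positivity) (by nlinarith [mul_nonneg hc (sq_nonneg ‖J w‖)])
    rw [← map_sub, ← hw]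
    calc ‖G w‖ ≤ _ := h7
      _ = _ := by ring
  have hcont : ContinuousOn (fun s => G (x s)) (Ici 0) := by
    refine (LipschitzOnWith.of_dist_le_mul (K := ⟨L * (D / m₀) / m₀, by positivity⟩)
      fun s hs s' hs' => ?_).continuousOn
    rw [dist_eq_norm, Real.dist_eq]
    exact hlip s hs s' hs'
  have hS : (0 : ℝ) ≤ (D / m₀) ^ 2 := by positivity
  have hφ : ContinuousOn (fun s => s - ‖G (x s)‖ ^ 2) (Icc 0 ((D / m₀) ^ 2)) :=
    continuousOn_id.sub (((hcont.mono Icc_subset_Ici_self).norm).pow 2)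
  -- The function is `≤ 0` at `s = 0`, and `≥ 0` at the square of the a priori bound.
  obtain ⟨s, hs, hs0⟩ := intermediate_value_Icc hS hφ (show (0 : ℝ) ∈ _ from
    ⟨by simp, sub_nonneg.2 (by gcongr; exact hbound _ hS)⟩)
  refine ⟨x s, fun v => ?_⟩
  have h1 := hx s hs.1 v
  rw [ellForm_apply] at h1
  rw [← sub_eq_zero.1 hs0, map_sub, inner_sub_left]
  linarith

/-- The basic inequality for uniqueness. Subtracting the equations tested with `u - v` leaves the
defect of the coefficient, and `|‖G u‖² - ‖G v‖²| ≤ 2R‖G (u - v)‖` makes it quadratic in the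
difference. Either term on the left may be used to absorb it. -/
theorem norm_eq_of_firstEq (hL : 0 ≤ L) {c : ℝ} {u₀ : V} {l : V →ₗ[ℝ] ℝ} {u v : V}
    (hu : FirstEq A J G c u₀ l u) (hv : FirstEq A J G c u₀ l v) {R : ℝ}
    (huR : ‖G u‖ ≤ R) (hvR : ‖G v‖ ≤ R) :
    c * ‖J (u - v)‖ ^ 2 + m₀ * ‖G (u - v)‖ ^ 2 ≤ 2 * L * R ^ 2 * ‖G (u - v)‖ ^ 2 := by
  set w := u - v with hw
  set s := ‖G u‖ ^ 2
  set s' := ‖G v‖ ^ 2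
  have h0 : 0 ≤ s := sq_nonneg _
  have h0' : 0 ≤ s' := sq_nonneg _
  have h1 := hu w
  rw [← hv w] at h1
  have h2 : c * ‖J w‖ ^ 2 + A.form s (G w) (G w)
      = -(A.form s (G v) (G w) - A.form s' (G v) (G w)) := by
    have e1 : inner ℝ (J w) (J w) = inner ℝ (J (u - u₀)) (J w) - inner ℝ (J (v - u₀)) (J w) := by
      rw [← inner_sub_left, ← map_sub, sub_sub_sub_cancel_right]
    have e2 : A.form s (G w) (G w) = A.form s (G u) (G w) - A.form s (G v) (G w) := by
      rw [← LinearMap.sub_apply, ← map_sub, ← map_sub]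
    rw [← real_inner_self_eq_norm_sq, e1, e2]
    linarith
  have h3 := neg_le_of_abs_le (A.lip s s' (G v) (G w) h0 h0')
  have h4 := A.lower s (G w) h0
  have hR : 0 ≤ R := (norm_nonneg _).trans huR
  have h5 : |s - s'| ≤ 2 * R * ‖G w‖ := by
    have : s - s' = (‖G u‖ + ‖G v‖) * (‖G u‖ - ‖G v‖) := by ring
    rw [this, abs_mul, abs_of_nonneg (by positivity)]
    have h6 : |‖G u‖ - ‖G v‖| ≤ ‖G w‖ := by
      rw [hw, map_sub]; exact abs_norm_sub_norm_le _ _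
    have h7 : ‖G u‖ + ‖G v‖ ≤ 2 * R := by linarith
    gcongr
  have h6 : L * |s - s'| * (‖G v‖ * ‖G w‖) ≤ L * (2 * R * ‖G w‖) * (R * ‖G w‖) := by
    gcongr
  nlinarith

/-- Testing with `u - u₀` and polarizing. -/
theorem energy_firstEq (hm : 0 < m₀) {c : ℝ} (hc : 0 < c) {u₀ : V} {l : V →ₗ[ℝ] ℝ} {u : V}
    (hu : FirstEq A J G c u₀ l u) {β F : ℝ}
    (hl : ∀ v, |l v| ≤ β * ‖G v‖ + F * ‖J v‖) :
    m₀ * ‖G u‖ ^ 2 ≤ (Mb + L * ‖G u‖ ^ 2) * ‖G u₀‖ ^ 2 + F ^ 2 / (2 * c) + β ^ 2 / m₀ := by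
  set w := u - u₀ with hw
  set s := ‖G u‖ ^ 2
  have hs : 0 ≤ s := sq_nonneg _
  have h1 := hu w
  rw [← hw, real_inner_self_eq_norm_sq] at h1
  have h2 : 2 * A.form s (G u) (G w) = A.form s (G u) (G u) + A.form s (G w) (G w)
      - A.form s (G u₀) (G u₀) := by
    rw [hw]
    simp only [map_sub, LinearMap.sub_apply]
    rw [A.symm s (G u₀) (G u)]
    ring
  have h3 := A.lower s (G u) hs
  have h4 := A.lower s (G w) hs
  have h5 := le_of_abs_le (A.upper s (G u₀) (G u₀) hs)
  have h6 := le_of_abs_le (hl w)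
  -- The weights in the two Young inequalities are chosen so that the terms in `w` cancel exactly:
  -- one against `2c‖J w‖²` in the doubled identity, the other against the coercivity of the form at
  -- `G w`.
  have h7 : 2 * (F * ‖J w‖) ≤ F ^ 2 / (2 * c) + 2 * c * ‖J w‖ ^ 2 := by
    have : F ^ 2 / (2 * c) + 2 * c * ‖J w‖ ^ 2 - 2 * (F * ‖J w‖)
        = (F - 2 * c * ‖J w‖) ^ 2 / (2 * c) := by field_simp; ring
    have h8 : 0 ≤ (F - 2 * c * ‖J w‖) ^ 2 / (2 * c) := by positivity
    linarith
  have h8 : 2 * (β * ‖G w‖) ≤ β ^ 2 / m₀ + m₀ * ‖G w‖ ^ 2 := by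
    have : β ^ 2 / m₀ + m₀ * ‖G w‖ ^ 2 - 2 * (β * ‖G w‖) = (β - m₀ * ‖G w‖) ^ 2 / m₀ := by
      field_simp; ring
    have h8 : 0 ≤ (β - m₀ * ‖G w‖) ^ 2 / m₀ := by positivity
    linarith
  have h9 : (Mb + L * s) * (‖G u₀‖ * ‖G u₀‖) = (Mb + L * s) * ‖G u₀‖ ^ 2 := by ring
  linarith

/-- The increment `u - u₀` is small when `G u₀` is close to a regular `Φ`. -/
theorem increment_firstEq {c : ℝ} {u₀ : V} {l : V →ₗ[ℝ] ℝ} {u : V}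
    (hu : FirstEq A J G c u₀ l u) {β F : ℝ} (hl : ∀ v, |l v| ≤ β * ‖G v‖ + F * ‖J v‖)
    {Φ : H} {ε C Mt : ℝ} (hΦ : ‖G u₀ - Φ‖ ≤ ε)
    (hC : ∀ v, |A.form (‖G u‖ ^ 2) Φ (G v)| ≤ C * ‖J v‖) (hMt : Mb + L * ‖G u‖ ^ 2 ≤ Mt)
    (hMt0 : 0 ≤ Mt) :
    c * ‖J (u - u₀)‖ ^ 2 + m₀ * ‖G (u - u₀)‖ ^ 2
      ≤ (β + Mt * ε) * ‖G (u - u₀)‖ + (F + C) * ‖J (u - u₀)‖ := by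
  set w := u - u₀ with hw
  set s := ‖G u‖ ^ 2
  have hs : 0 ≤ s := sq_nonneg _
  have h1 := hu w
  rw [← hw, real_inner_self_eq_norm_sq] at h1
  have h2 : A.form s (G u) (G w)
      = A.form s (G w) (G w) + A.form s (G u₀ - Φ) (G w) + A.form s Φ (G w) := by
    nth_rw 2 [hw]
    simp only [map_sub, LinearMap.sub_apply]
    ring
  have h3 := A.lower s (G w) hs
  have h4 := neg_le_of_abs_le (A.upper s (G u₀ - Φ) (G w) hs)
  have h5 : (Mb + L * s) * (‖G u₀ - Φ‖ * ‖G w‖) ≤ Mt * (ε * ‖G w‖) := by gcongr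
  have h6 := neg_le_of_abs_le (hC w)
  have h7 := le_of_abs_le (hl w)
  linarith

/-- Testing with `u` when an inverse inequality is available. -/
theorem bound_firstEq_of_inverse (hm : 0 ≤ m₀) {c : ℝ} (hc : 1 ≤ c) {u₀ : V} {l : V →ₗ[ℝ] ℝ}
    {u : V} (hu : FirstEq A J G c u₀ l u) {β F I : ℝ} (hβ : 0 ≤ β) (hF : 0 ≤ F)
    (hI : 0 ≤ I) (hl : ∀ v, |l v| ≤ β * ‖G v‖ + F * ‖J v‖) (hinv : ∀ v, ‖G v‖ ≤ I * ‖J v‖) :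
    ‖G u‖ ≤ I * (‖J u₀‖ + (β * I + F)) := by
  have h1 := hu u
  rw [map_sub, inner_sub_left, real_inner_self_eq_norm_sq] at h1
  have h2 := real_inner_le_norm (J u₀) (J u)
  have h3 := A.lower (‖G u‖ ^ 2) (G u) (sq_nonneg _)
  have h4 := le_of_abs_le (hl u)
  have h5 : β * ‖G u‖ ≤ β * (I * ‖J u‖) := by gcongr; exact hinv u
  have h6 : 0 ≤ m₀ * ‖G u‖ ^ 2 := by positivity
  -- Because `c ≥ 1`, the load may be multiplied by `c`. Dividing by `c` afterwards gives a bound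
  -- independent of `c`, hence of the time step.
  have h7 : β * I + F ≤ c * (β * I + F) := le_mul_of_one_le_left (by positivity) hc
  have h8 : (β * I + F) * ‖J u‖ ≤ c * (β * I + F) * ‖J u‖ := by gcongr
  have h9 : c * ‖J u‖ ^ 2 ≤ (c * (‖J u₀‖ + (β * I + F))) * ‖J u‖ := by nlinarith
  have h10 := le_of_mul_sq_le (by linarith : 0 < c) (by positivity) h9
  rw [mul_div_cancel_left₀ _ (by linarith : c ≠ 0)] at h10
  exact (hinv u).trans (by gcongr)

end Abstract

/-! ### Piecewise affine functions -/

section Geometry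

variable {d : ℕ} {Ω : Set (E d)} {γ κ h : ℝ} {𝒯 : Geometry.SimplicialComplex ℝ (E d)}

theorem isClosed_hull (s : Finset (E d)) : IsClosed (convexHull ℝ (s : Set (E d))) :=
  s.finite_toSet.isClosed_convexHull ℝ

/-- The linear part of an affine function. -/
def affDeriv (A : E d →ᵃ[ℝ] ℝ) : E d →L[ℝ] ℝ := LinearMap.toContinuousLinearMap A.linear

theorem affDeriv_sub (A : E d →ᵃ[ℝ] ℝ) (x y : E d) : affDeriv A (x - y) = A x - A y := by
  have := A.linearMap_vsub x y
  simpa [affDeriv] using this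

theorem hasFDerivAt_affine (A : E d →ᵃ[ℝ] ℝ) (x : E d) : HasFDerivAt A (affDeriv A) x := by
  have h : (A : E d → ℝ) = fun y => affDeriv A (y - x) + A x := by
    funext y
    rw [affDeriv_sub]
    ring
  rw [h]
  simp only [map_sub]
  exact (((affDeriv A).hasFDerivAt (x := x)).sub_const _).add_const _

/-- Restrict `v` to the line through `x` and `y`. Immediately to the right of a parameter `t`,
either some simplex is met arbitrarily close to `t`, and then, being closed and convex, it contains
a whole segment starting at `t`; or, there being finitely many simplices, none is met and `v`
vanishes there. In both cases a right derivative exists and is at most `C‖y - x‖`, and the mean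
value inequality for right derivatives applies. -/
theorem abs_sub_le_of_piecewise {v : E d → ℝ} (hv : Continuous v) (hfin : 𝒯.faces.Finite) {C : ℝ}
    (hC : 0 ≤ C) (hA : ∀ s ∈ 𝒯.faces, ∃ A : E d →ᵃ[ℝ] ℝ,
      EqOn v A (convexHull ℝ (s : Set (E d))) ∧ ‖affDeriv A‖ ≤ C)
    (h0 : ∀ x, x ∉ 𝒯.space → v x = 0) (x y : E d) : |v y - v x| ≤ C * ‖y - x‖ := by
  set e := y - x with he
  set c : ℝ → E d := fun t => x + t • e with hc
  have hcc : Continuous c := by fun_prop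
  set f : ℝ → ℝ := fun t => v (c t) with hf
  have hfc : Continuous f := hv.comp hcc
  have key : ∀ t : ℝ, ∃ f' : ℝ, HasDerivWithinAt f f' (Ici t) t ∧ ‖f'‖ ≤ C * ‖e‖ := by
    intro t
    by_cases hcase : ∃ s ∈ 𝒯.faces, ∃ᶠ r in 𝓝[>] t, c r ∈ convexHull ℝ (s : Set (E d))
    · obtain ⟨s, hs, hfr⟩ := hcase
      obtain ⟨A, hAv, hAC⟩ := hA s hs
      set I : Set ℝ := c ⁻¹' convexHull ℝ (s : Set (E d)) with hI
      have hIcl : IsClosed I := (isClosed_hull s).preimage hcc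
      have hIcv : Convex ℝ I := by
        have : c = AffineMap.lineMap x y := by
          funext t
          simp [hc, he, AffineMap.lineMap_apply, add_comm]
        rw [hI, this]
        exact (convex_convexHull ℝ _).affine_preimage _
      have htI : t ∈ I := by
        rw [← hIcl.closure_eq]
        refine mem_closure_iff_frequently.2 (hfr.filter_mono nhdsWithin_le_nhds)
      obtain ⟨r, hrI, hr⟩ := (hfr.and_eventually self_mem_nhdsWithin).exists
      have hsub : Icc t r ⊆ I := hIcv.ordConnected.out htI hrI
      refine ⟨affDeriv A e, ?_, ?_⟩
      · have h1 : HasDerivAt (fun u => A (c u)) (affDeriv A e) t := by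
          have h2 : HasDerivAt c e t := by
            simpa [hc] using ((hasDerivAt_id t).smul_const e).const_add x
          exact (hasFDerivAt_affine A (c t)).comp_hasDerivAt t h2
        refine h1.hasDerivWithinAt.congr_of_eventuallyEq_of_mem ?_ self_mem_Ici
        filter_upwards [Icc_mem_nhdsGE (show t < r from hr)] with u hu
        exact hAv (hsub hu)
      · exact ((affDeriv A).le_opNorm e).trans (by gcongr)
    · push Not at hcase
      refine ⟨0, ?_, by simp; positivity⟩
      have h1 : ∀ᶠ r in 𝓝[>] t, f r = 0 := by
        have : ∀ᶠ r in 𝓝[>] t, ∀ s ∈ 𝒯.faces, c r ∉ convexHull ℝ (s : Set (E d)) :=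
          (hfin.eventually_all).2 fun s hs => hcase s hs
        filter_upwards [this] with r hr
        refine h0 _ fun hmem => ?_
        obtain ⟨s, hs, hrs⟩ := Geometry.SimplicialComplex.mem_space_iff.1 hmem
        exact hr s hs hrs
      have h2 : f t = 0 :=
        tendsto_nhds_unique ((hfc.tendsto t).mono_left (nhdsWithin_le_nhds (s := Ioi t)))
          (tendsto_const_nhds.congr' (h1.mono fun r hr => hr.symm))
      refine (hasDerivWithinAt_const t (Ici t) (0 : ℝ)).congr_of_eventuallyEq_of_mem ?_ self_mem_Ici
      rw [← Ioi_insert, nhdsWithin_insert]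
      exact eventually_sup.2 ⟨by simpa using h2, h1⟩
  choose f' hf' hf'C using key
  have := norm_image_sub_le_of_norm_deriv_right_le_segment (a := 0) (b := 1) hfc.continuousOn
    (fun t _ => hf' t) (fun t _ => hf'C t) 1 (by simp)
  simpa [hf, hc, he] using this

/-- An element of `X_h` is Lipschitz; the best constant is attained on some simplex. -/
theorem Xh.exists_lipschitz (h𝒯 : IsTriangulation Ω γ κ h 𝒯) (v : Xh Ω 𝒯) :
    ∃ C : NNReal, LipschitzWith C (v : E d → ℝ) ∧ (C = 0 ∨ ∃ s ∈ 𝒯.faces, s.card = d + 1 ∧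
      ∃ A : E d →ᵃ[ℝ] ℝ, EqOn (v : E d → ℝ) A (convexHull ℝ (s : Set (E d))) ∧
        ‖affDeriv A‖ = C) := by
  have hv := v.2.1
  have h0 := v.2.2.2.2
  choose! A hA using v.2.2.1
  set F := {s ∈ 𝒯.faces | s.card = d + 1} with hF
  have hFfin : F.Finite := h𝒯.finite.subset (sep_subset _ _)
  rcases F.eq_empty_or_nonempty with hemp | hne
  -- Without full-dimensional simplices the pure complex is empty, and `v = 0`.
  · refine ⟨0, LipschitzWith.of_dist_le_mul fun x y => ?_, Or.inl rfl⟩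
    have hz : ∀ x, (v : E d → ℝ) x = 0 := fun x => h0 x fun hx => by
      obtain ⟨s, hs, -⟩ := Geometry.SimplicialComplex.mem_space_iff.1 hx
      obtain ⟨t, ht, -, htc⟩ := h𝒯.pure s hs
      exact (hemp ▸ (⟨ht, htc⟩ : t ∈ F) : t ∈ (∅ : Set _))
    simp [hz]
  · obtain ⟨s, hs, hmax⟩ := exists_max_image F (fun s => ‖affDeriv (A s)‖) hFfin hne
    refine ⟨‖affDeriv (A s)‖₊, LipschitzWith.of_dist_le_mul fun x y => ?_,
      Or.inr ⟨s, hs.1, hs.2, A s, hA s hs.1, rfl⟩⟩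
    rw [dist_eq_norm, dist_eq_norm]
    refine abs_sub_le_of_piecewise (𝒯 := 𝒯) hv h𝒯.finite (norm_nonneg _) (fun s' hs' => ?_) h0 y x
    obtain ⟨t, ht, hst, htc⟩ := h𝒯.pure s' hs'
    exact ⟨A t, (hA t ht).mono (convexHull_mono (by exact_mod_cast hst)), hmax t ⟨ht, htc⟩⟩

theorem Xh.eq_zero_of_vertices (v : Xh Ω 𝒯) (hv : ∀ x ∈ 𝒯.vertices, (v : E d → ℝ) x = 0) :
    v = 0 := by
  obtain ⟨v, hvc, hA, h1, h0⟩ := v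
  ext x
  by_cases hx : x ∈ 𝒯.space
  · obtain ⟨s, hs, hxs⟩ := Geometry.SimplicialComplex.mem_space_iff.1 hx
    obtain ⟨A, hAs⟩ := hA s hs
    have : convexHull ℝ (s : Set (E d)) ⊆ A ⁻¹' {0} := by
      refine convexHull_min (fun y hy => ?_) ((convex_singleton 0).affine_preimage A)
      have hyv : y ∈ 𝒯.vertices := by
        rw [Geometry.SimplicialComplex.vertices_eq]
        exact mem_biUnion hs hy
      show A y = 0
      rw [← hAs (subset_convexHull ℝ _ hy)]
      exact hv y hyv
    show v x = 0
    rw [hAs hxs]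
    exact this hxs
  · exact h0 x hx

theorem Xh.finiteDimensional (h𝒯 : IsTriangulation Ω γ κ h 𝒯) :
    FiniteDimensional ℝ (Xh Ω 𝒯) := by
  have hfin : 𝒯.vertices.Finite := by
    rw [Geometry.SimplicialComplex.vertices_eq]
    exact h𝒯.finite.biUnion fun s _ => s.finite_toSet
  have := hfin.to_subtype
  let R : Xh Ω 𝒯 →ₗ[ℝ] (𝒯.vertices → ℝ) :=
    { toFun := fun v x => (v : E d → ℝ) x
      map_add' := fun _ _ => rfl
      map_smul' := fun _ _ => rfl }
  refine FiniteDimensional.of_injective R ((injective_iff_map_eq_zero R).2 fun v hv => ?_)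
  exact Xh.eq_zero_of_vertices v fun x hx => congrFun hv ⟨x, hx⟩

theorem Xh.continuous (v : Xh Ω 𝒯) : Continuous (v : E d → ℝ) := v.2.1

theorem Xh.eq_zero_of_notMem (v : Xh Ω 𝒯) {x : E d} (hx : x ∉ Ω) : (v : E d → ℝ) x = 0 :=
  v.2.2.2.1 x hx

theorem Xh.hasCompactSupport (hΩ : Bornology.IsBounded Ω) (v : Xh Ω 𝒯) :
    HasCompactSupport (v : E d → ℝ) :=
  HasCompactSupport.intro (hΩ.isCompact_closure) fun _ hx =>
    Xh.eq_zero_of_notMem v fun hx' => hx (subset_closure hx')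

/-! ### Gradients of Lipschitz functions -/

theorem inner_gradient (v : E d → ℝ) (x e : E d) : inner ℝ (gradient v x) e = fderiv ℝ v x e := by
  simp [gradient]

theorem norm_gradient (v : E d → ℝ) (x : E d) : ‖gradient v x‖ = ‖fderiv ℝ v x‖ := by
  simp [gradient]

theorem gradient_apply (v : E d → ℝ) (x : E d) (i : Fin d) :
    gradient v x i = fderiv ℝ v x (EuclideanSpace.single i 1) := by
  rw [← inner_gradient, real_inner_comm, EuclideanSpace.inner_single_left]
  simp

theorem measurable_gradient (v : E d → ℝ) : Measurable (gradient v) :=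
  (LinearIsometryEquiv.continuous _).measurable.comp (measurable_fderiv ℝ v)

theorem norm_gradient_le {v : E d → ℝ} {C : NNReal} (hv : LipschitzWith C v) (x : E d) :
    ‖gradient v x‖ ≤ C := by
  rw [norm_gradient]
  exact norm_fderiv_le_of_lipschitz ℝ hv

/-- Integration by parts against a Lipschitz function of compact support. -/
theorem abs_integral_gradient_mul_le {v ψ : E d → ℝ} {C Λ : NNReal} (hv : LipschitzWith C v)
    (hvs : ∀ x, x ∉ Ω → v x = 0) (hvc : HasCompactSupport v) (hψ : LipschitzWith Λ ψ)
    (hψc : HasCompactSupport ψ) (i : Fin d) :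
    |∫ x, gradient v x i * ψ x| ≤ Λ * ∫ x in Ω, |v x| := by
  have h1 : ∫ x, gradient v x i * ψ x = ∫ x, lineDeriv ℝ v x (EuclideanSpace.single i 1) * ψ x := by
    refine integral_congr_ae ?_
    filter_upwards [hv.ae_differentiableAt (μ := volume)] with x hx
    rw [gradient_apply, hx.lineDeriv_eq_fderiv]
  have hvi : Integrable v := hv.continuous.integrable_of_hasCompactSupport hvc
  rw [h1, hv.integral_lineDeriv_mul_eq hψ hψc, ← Real.norm_eq_abs]
  have h2 : ∫ x in Ω, |v x| = ∫ x, |v x| := by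
    refine setIntegral_eq_integral_of_forall_compl_eq_zero fun x hx => by simp [hvs x hx]
  rw [h2, ← integral_const_mul]
  refine norm_integral_le_of_norm_le (hvi.abs.const_mul _) (Eventually.of_forall fun x => ?_)
  rw [norm_mul, Real.norm_eq_abs (v x)]
  gcongr
  refine (norm_lineDeriv_le_of_lipschitz ℝ hψ).trans ?_
  simp

/-- The Poincaré inequality. -/
theorem integral_sq_le_gradient (hd : 1 ≤ d) (hΩ : MeasurableSet Ω) {ρ : ℝ}
    (hρ : ∀ x ∈ Ω, ‖x‖ ≤ ρ) {v : E d → ℝ} {C : NNReal} (hv : LipschitzWith C v)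
    (hvs : ∀ x, x ∉ Ω → v x = 0) (hvc : HasCompactSupport v) :
    ∫ x in Ω, v x ^ 2 ≤ (2 * ρ) ^ 2 * ∫ x in Ω, ‖gradient v x‖ ^ 2 := by
  let i : Fin d := ⟨0, hd⟩
  let e : E d := EuclideanSpace.single i 1
  have he : ‖e‖ = 1 := by simp [e]
  have hfin : volume Ω ≠ ⊤ := by
    refine ((measure_mono (fun x hx => ?_)).trans_lt
      (measure_closedBall_lt_top (x := (0 : E d)) (r := ρ))).ne
    simpa using hρ x hx
  have : IsFiniteMeasure (volume.restrict Ω) := ⟨by simpa using hfin.lt_top⟩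
  obtain ⟨B, hB⟩ := hvc.exists_bound_of_continuous hv.continuous
  have hB0 : 0 ≤ B := (norm_nonneg _).trans (hB 0)
  have hg : LipschitzWith ((2 * B).toNNReal * C) (fun x => v x ^ 2) := by
    refine LipschitzWith.of_dist_le_mul fun x y => ?_
    have h1 := hv.dist_le_mul x y
    rw [Real.dist_eq] at h1 ⊢
    have : v x ^ 2 - v y ^ 2 = (v x + v y) * (v x - v y) := by ring
    rw [this, abs_mul]
    have h2 : |v x + v y| ≤ 2 * B := (abs_add_le _ _).trans (by
      have := hB x; have := hB y; simp only [Real.norm_eq_abs] at *; linarith)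
    calc _ ≤ 2 * B * (C * dist x y) := by gcongr
      _ = _ := by rw [NNReal.coe_mul, Real.coe_toNNReal _ (by positivity)]; ring
  have hgc : HasCompactSupport (fun x => v x ^ 2) := hvc.comp_left (g := fun t => t ^ 2) (by simp)
  have hf : LipschitzWith 1 (fun x : E d => inner ℝ e x) := by
    refine LipschitzWith.of_dist_le_mul fun x y => ?_
    rw [Real.dist_eq, ← inner_sub_right, dist_eq_norm]
    simpa [he] using abs_real_inner_le_norm e (x - y)
  -- Integrate `v² = v² ∂ₑ⟨e, x⟩` by parts. Since `|⟨e, x⟩| ≤ ρ` on `Ω`, Young's inequality bounds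
  -- the result by half of `∫ v²` plus `2ρ² ∫ |∇v|²`, whence the constant `4ρ²`.
  have key := hf.integral_lineDeriv_mul_eq (μ := volume) hg hgc e
  have h1 : ∀ x, lineDeriv ℝ (fun x : E d => inner ℝ e x) x e = 1 := fun x => by
    have : HasFDerivAt (fun x : E d => inner ℝ e x) (innerSL ℝ e) x := (innerSL ℝ e).hasFDerivAt
    rw [this.differentiableAt.lineDeriv_eq_fderiv, this.fderiv]
    simp [he]
  simp only [h1, one_mul] at key
  have hsq : ∀ x, DifferentiableAt ℝ v x →
      lineDeriv ℝ (fun x => v x ^ 2) x (-e) = -(2 * v x * fderiv ℝ v x e) := fun x hx => by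
    rw [(hx.fun_pow 2).lineDeriv_eq_fderiv, fderiv_fun_pow 2 hx]
    simp
  have hz : ∀ x, x ∉ Ω → lineDeriv ℝ (fun x => v x ^ 2) x (-e) * inner ℝ e x
      = 0 ∨ ¬ DifferentiableAt ℝ v x := fun x hx => by
    by_cases hdx : DifferentiableAt ℝ v x
    · left
      simp [hsq x hdx, hvs x hx]
    · exact Or.inr hdx
  have h2 : ∫ x, lineDeriv ℝ (fun x => v x ^ 2) x (-e) * inner ℝ e x
      = ∫ x in Ω, lineDeriv ℝ (fun x => v x ^ 2) x (-e) * inner ℝ e x := by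
    refine (setIntegral_eq_integral_of_ae_compl_eq_zero ?_).symm
    filter_upwards [hv.ae_differentiableAt (μ := volume)] with x hx hxΩ
    exact (hz x hxΩ).resolve_right (not_not.2 hx)
  have h3 : ∫ x, v x ^ 2 = ∫ x in Ω, v x ^ 2 :=
    (setIntegral_eq_integral_of_forall_compl_eq_zero fun x hx => by simp [hvs x hx]).symm
  have hi1 : IntegrableOn (fun x => v x ^ 2) Ω :=
    ((hv.continuous.pow 2).integrable_of_hasCompactSupport hgc).integrableOn
  have hi2 : IntegrableOn (fun x => ‖gradient v x‖ ^ 2) Ω := by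
    refine Integrable.of_bound ((measurable_gradient v).norm.pow_const 2).aestronglyMeasurable
      (C ^ 2 : ℝ) (Eventually.of_forall fun x => ?_)
    rw [Real.norm_of_nonneg (by positivity)]
    have := norm_gradient_le hv x
    gcongr
  have h4 : ∫ x in Ω, lineDeriv ℝ (fun x => v x ^ 2) x (-e) * inner ℝ e x
      ≤ ∫ x in Ω, (v x ^ 2 / 2 + 2 * ρ ^ 2 * ‖gradient v x‖ ^ 2) := by
    refine (le_abs_self _).trans ?_
    rw [← Real.norm_eq_abs]
    refine norm_integral_le_of_norm_le ((hi1.div_const 2).add (hi2.const_mul (2 * ρ ^ 2))) ?_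
    filter_upwards [ae_restrict_of_ae (hv.ae_differentiableAt (μ := volume)),
      ae_restrict_mem hΩ] with x hx hxΩ
    rw [hsq x hx]
    have e1 : |fderiv ℝ v x e| ≤ ‖gradient v x‖ := by
      rw [norm_gradient]
      simpa [he] using (fderiv ℝ v x).le_opNorm e
    have e2 : |inner ℝ e x| ≤ ρ := by
      refine (abs_real_inner_le_norm e x).trans ?_
      rw [he, one_mul]
      exact hρ x hxΩ
    have e3 : |fderiv ℝ v x e| * |inner ℝ e x| ≤ ‖gradient v x‖ * ρ := by gcongr
    have e4 : |v x| * (|fderiv ℝ v x e| * |inner ℝ e x|) ≤ |v x| * (‖gradient v x‖ * ρ) := by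
      gcongr
    have e5 : ‖-(2 * v x * fderiv ℝ v x e) * inner ℝ e x‖
        = 2 * (|v x| * (|fderiv ℝ v x e| * |inner ℝ e x|)) := by
      simp only [Real.norm_eq_abs, abs_mul, abs_neg, abs_two]
      ring
    rw [e5, ← sq_abs (v x)]
    nlinarith [sq_nonneg (|v x| - 2 * ρ * ‖gradient v x‖)]
  rw [integral_add (hi1.div_const 2) (hi2.const_mul _), integral_div, integral_const_mul] at h4
  rw [h3, h2] at key
  nlinarith

end Geometry

/-! ### Inverse inequality and interpolation -/

section Interpolation

variable {d : ℕ} {Ω : Set (E d)} {γ κ h : ℝ} {𝒯 : Geometry.SimplicialComplex ℝ (E d)}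

/-- An affine function is large on some ball inside a given ball. -/
theorem exists_ball_sq_affine_ge (A : E d →ᵃ[ℝ] ℝ) (x₀ : E d) {r : ℝ} (hr : 0 < r) :
    ∃ z : E d, Metric.ball z (r / 4) ⊆ Metric.closedBall x₀ r ∧
      ∀ y ∈ Metric.ball z (r / 4), ‖affDeriv A‖ ^ 2 * (r / 4) ^ 2 ≤ A y ^ 2 := by
  rcases (norm_nonneg (affDeriv A)).eq_or_lt with hC | hCpos
  · refine ⟨x₀, Metric.ball_subset_closedBall.trans
      (Metric.closedBall_subset_closedBall (by linarith)), fun y _ => ?_⟩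
    rw [← hC]
    nlinarith [sq_nonneg (A y)]
  obtain ⟨g, hg⟩ := (InnerProductSpace.toDual ℝ (E d)).surjective (affDeriv A)
  have hgn : ‖g‖ = ‖affDeriv A‖ := by rw [← hg, LinearIsometryEquiv.norm_map]
  have hgA : affDeriv A g = ‖affDeriv A‖ ^ 2 := by
    rw [← hgn, ← real_inner_self_eq_norm_sq, ← hg, InnerProductSpace.toDual_apply_apply]
  generalize hCA : ‖affDeriv A‖ = C at *
  -- Going a distance `r/2` from `x₀` up or down the gradient, according to the sign of `A x₀`,
  -- gives a centre with `|A| ≥ C r/2`. On the ball of radius `r/4` around it `A` varies by at most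
  -- `C r/4`.
  obtain ⟨σ, hσ, hσA⟩ : ∃ σ : ℝ, |σ| = 1 ∧ |A x₀ + σ * (C * (r / 2))| ≥ C * (r / 2) := by
    have hp : 0 ≤ C * (r / 2) := by positivity
    rcases le_total 0 (A x₀) with h0 | h0
    · refine ⟨1, by simp, ?_⟩
      rw [abs_of_nonneg (by linarith)]
      linarith
    · refine ⟨-1, by simp, ?_⟩
      rw [abs_of_nonpos (by linarith)]
      linarith
  have hzd : ‖(σ * (r / 2) / C) • g‖ = r / 2 := by
    rw [norm_smul, Real.norm_eq_abs, abs_div, abs_mul, hσ, hgn,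
      abs_of_pos (by positivity : 0 < r / 2), abs_of_pos hCpos]
    field_simp
  have hzA : A (x₀ + (σ * (r / 2) / C) • g) = A x₀ + σ * (C * (r / 2)) := by
    have h3 := affDeriv_sub A (x₀ + (σ * (r / 2) / C) • g) x₀
    rw [add_sub_cancel_left, map_smul, hgA, smul_eq_mul] at h3
    rw [← sub_eq_iff_eq_add', ← h3]
    field_simp
  refine ⟨x₀ + (σ * (r / 2) / C) • g, fun y hy => ?_, fun y hy => ?_⟩
  · rw [mem_closedBall_iff_norm]
    have h1 := mem_ball_iff_norm.1 hy
    have : y - x₀ = (y - (x₀ + (σ * (r / 2) / C) • g)) + (σ * (r / 2) / C) • g := by abel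
    rw [this]
    exact (norm_add_le _ _).trans (by linarith)
  · have h3 : |A y - A (x₀ + (σ * (r / 2) / C) • g)| ≤ C * (r / 4) := by
      have h1 := mem_ball_iff_norm.1 hy
      rw [← affDeriv_sub, ← Real.norm_eq_abs]
      exact ((affDeriv A).le_opNorm _).trans (by rw [hCA]; gcongr)
    have h4 : C * (r / 4) ≤ |A y| := by
      have := abs_sub_abs_le_abs_sub (A (x₀ + (σ * (r / 2) / C) • g)) (A y)
      rw [abs_sub_comm, hzA] at this
      rw [hzA] at h3
      linarith
    rw [← mul_pow, ← sq_abs (A y)]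
    gcongr

theorem Xh.integrable_sq (hΩ : Bornology.IsBounded Ω) (v : Xh Ω 𝒯) :
    Integrable (fun x => (v : E d → ℝ) x ^ 2) := by
  have hc : HasCompactSupport (fun x => (v : E d → ℝ) x ^ 2) :=
    HasCompactSupport.intro hΩ.isCompact_closure fun x hx => by
      rw [Xh.eq_zero_of_notMem v fun hx' => hx (subset_closure hx'), zero_pow two_ne_zero]
  exact ((Xh.continuous v).pow 2).integrable_of_hasCompactSupport hc

/-- One simplex suffices: the one with the steepest gradient `C`. The left side is at most `C²|Ω|`,
while on a ball of radius `r/4` inside that simplex `v² ≥ C²(r/4)²`. The constant thus depends on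
`Ω` and on the lower bound `r` for the inradius only, not on the mesh. -/
theorem exists_inverse_inequality (hΩ : Bornology.IsBounded Ω) {r : ℝ} (hr : 0 < r) :
    ∃ I : ℝ, 0 ≤ I ∧ ∀ (γ κ h : ℝ) (𝒯 : Geometry.SimplicialComplex ℝ (E d)),
      IsTriangulation Ω γ κ h 𝒯 → r ≤ γ * h → ∀ v : Xh Ω 𝒯,
      ∫ x in Ω, ‖gradient (v : E d → ℝ) x‖ ^ 2 ≤ I * ∫ x in Ω, (v : E d → ℝ) x ^ 2 := by
  obtain ⟨b, hb⟩ : ∃ b, b = volume.real (Metric.ball (0 : E d) (r / 4)) := ⟨_, rfl⟩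
  have hb0 : 0 < b := by
    rw [hb, measureReal_def]
    exact ENNReal.toReal_pos (Metric.measure_ball_pos _ _ (by positivity)).ne'
      measure_ball_lt_top.ne
  have hfin : volume Ω ≠ ⊤ := hΩ.measure_lt_top.ne
  refine ⟨volume.real Ω / ((r / 4) ^ 2 * b), by positivity, fun γ κ h 𝒯 h𝒯 hrh v => ?_⟩
  obtain ⟨C, hC, hC'⟩ := Xh.exists_lipschitz h𝒯 v
  have h1 : ∫ x in Ω, ‖gradient (v : E d → ℝ) x‖ ^ 2 ≤ C ^ 2 * volume.real Ω := by
    refine (le_abs_self _).trans ?_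
    rw [← Real.norm_eq_abs]
    refine norm_setIntegral_le_of_norm_le_const hfin.lt_top fun x _ => ?_
    rw [Real.norm_of_nonneg (by positivity)]
    have := norm_gradient_le hC x
    gcongr
  refine h1.trans ?_
  suffices h2 : (C : ℝ) ^ 2 * ((r / 4) ^ 2 * b) ≤ ∫ x in Ω, (v : E d → ℝ) x ^ 2 by
    calc (C : ℝ) ^ 2 * volume.real Ω
        = volume.real Ω / ((r / 4) ^ 2 * b) * (C ^ 2 * ((r / 4) ^ 2 * b)) := by field_simp
      _ ≤ _ := by gcongr
  rcases hC' with rfl | ⟨s, hs, hcard, A, hA, hAC⟩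
  · rw [NNReal.coe_zero, zero_pow two_ne_zero, zero_mul]
    exact integral_nonneg fun x => sq_nonneg _
  obtain ⟨x₀, hx₀⟩ := h𝒯.ball s hs hcard
  obtain ⟨z, hz, hlow⟩ := exists_ball_sq_affine_ge A x₀ hr
  have hzs : Metric.ball z (r / 4) ⊆ convexHull ℝ (s : Set (E d)) :=
    hz.trans ((Metric.closedBall_subset_closedBall hrh).trans hx₀)
  have hvi := Xh.integrable_sq hΩ v
  have h5 : ∫ x in Ω, (v : E d → ℝ) x ^ 2 = ∫ x, (v : E d → ℝ) x ^ 2 :=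
    setIntegral_eq_integral_of_forall_compl_eq_zero fun x hx => by
      simp [Xh.eq_zero_of_notMem v hx]
  rw [h5]
  calc (C : ℝ) ^ 2 * ((r / 4) ^ 2 * b)
      = ∫ _ in Metric.ball z (r / 4), (C : ℝ) ^ 2 * (r / 4) ^ 2 := by
        rw [setIntegral_const, measureReal_def, Measure.addHaar_ball_center, ← measureReal_def,
          ← hb, smul_eq_mul]
        ring
    _ ≤ ∫ x in Metric.ball z (r / 4), (v : E d → ℝ) x ^ 2 := by
        refine setIntegral_mono_on (integrableOn_const measure_ball_lt_top.ne)
          hvi.integrableOn measurableSet_ball fun y hy => ?_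
        rw [hA (hzs hy), ← hAC]
        exact hlow y hy
    _ ≤ _ := setIntegral_le_integral hvi (Eventually.of_forall fun x => sq_nonneg _)

/-- Frontiers of convex sets are null sets, and there are finitely many simplices. -/
theorem ae_mem_interior_or (h𝒯 : IsTriangulation Ω γ κ h 𝒯) :
    ∀ᵐ x : E d, x ∉ 𝒯.space ∨ ∃ s ∈ 𝒯.faces, s.card = d + 1 ∧
      x ∈ interior (convexHull ℝ (s : Set (E d))) := by
  have : ∀ᵐ x : E d, ∀ s ∈ 𝒯.faces, x ∉ frontier (convexHull ℝ (s : Set (E d))) :=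
    (ae_ball_iff h𝒯.finite.countable).2 fun s _ =>
      measure_eq_zero_iff_ae_notMem.1 ((convex_convexHull ℝ _).addHaar_frontier volume)
  filter_upwards [this] with x hx
  by_cases hxs : x ∈ 𝒯.space
  · right
    obtain ⟨s, hs, hxs⟩ := Geometry.SimplicialComplex.mem_space_iff.1 hxs
    obtain ⟨t, ht, hst, htc⟩ := h𝒯.pure s hs
    refine ⟨t, ht, htc, ?_⟩
    have h1 := hx t ht
    rw [(isClosed_hull t).frontier_eq] at h1
    by_contra h2
    exact h1 ⟨convexHull_mono (by exact_mod_cast hst) hxs, h2⟩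
  · exact Or.inl hxs

theorem exists_affine_interpolant {s : Finset (E d)}
    (hs : AffineIndependent ℝ ((↑) : s → E d)) (hcard : s.card = d + 1) (φ : E d → ℝ) :
    ∃ A : E d →ᵃ[ℝ] ℝ, ∀ p ∈ s, A p = φ p := by
  have htot : affineSpan ℝ (range ((↑) : s → E d)) = ⊤ := by
    rw [hs.affineSpan_eq_top_iff_card_eq_finrank_add_one]
    simp [hcard]
  let b : AffineBasis s ℝ (E d) := ⟨(↑), hs, htot⟩
  refine ⟨∑ q : s, φ q • b.coord q, fun p hp => ?_⟩
  have h1 : ∀ q : s, b.coord q p = if q = ⟨p, hp⟩ then 1 else 0 := fun q => by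
    exact (b.coord_apply q ⟨p, hp⟩).trans (by congr)
  have h2 : (∑ q : s, φ q • b.coord q) p = ∑ q : s, (φ q • b.coord q) p :=
    map_sum (⟨⟨fun A : E d →ᵃ[ℝ] ℝ => A p, rfl⟩, fun _ _ => rfl⟩ : (E d →ᵃ[ℝ] ℝ) →+ ℝ) _ _
  rw [h2]
  simp [h1]

theorem abs_taylor_le {φ : E d → ℝ} (hφ : Differentiable ℝ φ) {Λ : NNReal}
    (hΛ : LipschitzWith Λ (fderiv ℝ φ)) (x y : E d) :
    |φ y - φ x - fderiv ℝ φ x (y - x)| ≤ Λ * ‖y - x‖ ^ 2 := by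
  have := (convex_closedBall x ‖y - x‖).norm_image_sub_le_of_norm_fderiv_le' (𝕜 := ℝ) (f := φ)
    (φ := fderiv ℝ φ x) (C := Λ * ‖y - x‖) (x := x) (y := y) (fun z _ => hφ z) (fun z hz => ?_)
    (by simp) (by simp [dist_eq_norm])
  · rw [Real.norm_eq_abs] at this
    linarith
  · refine (hΛ.norm_sub_le z x).trans ?_
    have := mem_closedBall_iff_norm.1 hz
    gcongr

/-- The gradient of an affine interpolant is close to the gradient of the function. -/
theorem norm_affDeriv_sub_le {φ : E d → ℝ} (hφ : Differentiable ℝ φ) {Λ : NNReal}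
    (hΛ : LipschitzWith Λ (fderiv ℝ φ)) {s : Finset (E d)} {A : E d →ᵃ[ℝ] ℝ}
    (hA : ∀ p ∈ s, A p = φ p) (hh : 0 < h) (hγ : 0 < γ)
    (hdiam : Metric.diam (convexHull ℝ (s : Set (E d))) ≤ h) {x₀ : E d}
    (hball : Metric.closedBall x₀ (γ * h) ⊆ convexHull ℝ (s : Set (E d))) {x : E d}
    (hx : x ∈ convexHull ℝ (s : Set (E d))) :
    ‖affDeriv A - fderiv ℝ φ x‖ ≤ 2 * Λ / γ * h := by
  set T := fderiv ℝ φ x with hT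
  set B : E d →ᵃ[ℝ] ℝ := A - (T : E d →ₗ[ℝ] ℝ).toAffineMap with hB
  have hBa : ∀ y, B y = A y - T y := fun y => by simp [hB]
  have hbd : Bornology.IsBounded (convexHull ℝ (s : Set (E d))) :=
    (isBounded_convexHull.2 s.finite_toSet.isBounded)
  -- At the vertices `B = A - T` differs from `φ x - T x` by a Taylor remainder, at most `Λh²`. As
  -- `B` is affine, convexity carries this to the whole simplex.
  have hsub : convexHull ℝ (s : Set (E d)) ⊆
      B ⁻¹' Metric.closedBall (φ x - T x) (Λ * h ^ 2) := by
    refine convexHull_min (fun p hp => ?_)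
      ((convex_closedBall _ _).affine_preimage B)
    have h1 := abs_taylor_le hφ hΛ x p
    have h2 : ‖p - x‖ ≤ h := by
      rw [← dist_eq_norm]
      exact (Metric.dist_le_diam_of_mem hbd (subset_convexHull ℝ _ hp) hx).trans hdiam
    rw [mem_preimage, mem_closedBall_iff_norm, Real.norm_eq_abs, hBa, hA p hp]
    rw [← hT, map_sub] at h1
    calc |φ p - T p - (φ x - T x)| = |φ p - φ x - (T p - T x)| := by ring_nf
      _ ≤ _ := h1
      _ ≤ _ := by gcongr
  refine ContinuousLinearMap.opNorm_le_bound _ (by positivity) fun w => ?_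
  rcases eq_or_ne w 0 with rfl | hw
  · simp
  have hwn : 0 < ‖w‖ := norm_pos_iff.2 hw
  -- Scaled to length `γh`, the direction `w` stays in the inscribed ball. There `B` oscillates by
  -- at most `2Λh²`, so its slope is at most `2Λh/γ`.
  set t := γ * h / ‖w‖ with ht
  have ht0 : 0 < t := by positivity
  have h1 : x₀ + t • w ∈ convexHull ℝ (s : Set (E d)) := by
    refine hball (mem_closedBall_iff_norm.2 ?_)
    rw [add_sub_cancel_left, norm_smul, Real.norm_of_nonneg ht0.le, ht]
    field_simp
    rfl
  have h2 : x₀ ∈ convexHull ℝ (s : Set (E d)) :=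
    hball (Metric.mem_closedBall_self (by positivity))
  have h3 := mem_closedBall_iff_norm.1 (hsub h1)
  have h4 := mem_closedBall_iff_norm.1 (hsub h2)
  rw [Real.norm_eq_abs] at h3 h4
  have h5 : B (x₀ + t • w) - B x₀ = t * (affDeriv A - T) w := by
    have := affDeriv_sub A (x₀ + t • w) x₀
    rw [add_sub_cancel_left, map_smul, smul_eq_mul] at this
    rw [hBa, hBa, map_add T, map_smul T, smul_eq_mul, sub_apply]
    linarith
  have h6 : |t| * |(affDeriv A - T) w| ≤ 2 * Λ * h ^ 2 := by
    rw [← abs_mul, ← h5]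
    rw [abs_le] at h3 h4 ⊢
    constructor <;> linarith [h3.1, h3.2, h4.1, h4.2]
  rw [abs_of_pos ht0] at h6
  rw [Real.norm_eq_abs]
  calc |(affDeriv A - T) w| = (t * |(affDeriv A - T) w|) / t := by field_simp
    _ ≤ 2 * Λ * h ^ 2 / t := by gcongr
    _ = _ := by rw [ht]; field_simp

end Interpolation

/-! ### Nodal interpolation of test functions near an uncovered boundary layer. -/

section Interpolation

variable {d : ℕ} {Ω : Set (E d)} {γ κ h : ℝ} {𝒯 : Geometry.SimplicialComplex ℝ (E d)}

/-- Uncovered points are close to the complement of `Ω`. -/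
theorem exists_notMem_dist_lt (hd : 1 ≤ d) (hΩ : Bornology.IsBounded Ω) (hΩo : IsOpen Ω)
    (hκ : 0 ≤ κ) (hh : 0 < h) (h𝒯 : IsTriangulation Ω γ κ h 𝒯) {x : E d} (hx : x ∉ 𝒯.space) :
    ∃ y, y ∉ Ω ∧ dist x y < (κ + 1) * h := by
  by_cases hxΩ : x ∈ Ω
  · have hne : (frontier Ω).Nonempty := by
      rw [nonempty_iff_ne_empty, Ne, frontier_eq_empty_iff]
      rintro (h0 | h0)
      · rw [h0] at hxΩ; exact hxΩ
      · rw [h0] at hΩ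
        have : Nontrivial (Fin d → ℝ) := by
          have : Nonempty (Fin d) := ⟨⟨0, hd⟩⟩
          infer_instance
        have : Nontrivial (E d) := (WithLp.equiv 2 (Fin d → ℝ)).nontrivial
        exact NormedSpace.unbounded_univ ℝ (E d) hΩ
    obtain ⟨y, hy, hxy⟩ := (Metric.infDist_lt_iff hne).1
      ((h𝒯.gap x hxΩ hx).trans_lt (show κ * h < (κ + 1) * h by linarith))
    refine ⟨y, fun hyΩ => ?_, hxy⟩
    rw [hΩo.frontier_eq] at hy
    exact hy.2 hyΩ
  · exact ⟨x, hxΩ, by rw [dist_self]; positivity⟩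

theorem affine_eq_of_eqOn {s : Set (E d)} {A A' : E d →ᵃ[ℝ] ℝ} (hs : EqOn A A' s) :
    EqOn A A' (convexHull ℝ s) := by
  have : convexHull ℝ s ⊆ (A - A') ⁻¹' {0} := by
    refine convexHull_min (fun p hp => ?_) ((convex_singleton 0).affine_preimage _)
    simp [hs hp]
  intro x hx
  simpa [sub_eq_zero] using this hx

/-- Nodal interpolation of a test function. -/
theorem exists_interpolant (hd : 1 ≤ d) (hΩ : Bornology.IsBounded Ω) (hΩo : IsOpen Ω)
    (hγ : 0 < γ) (hκ : 0 ≤ κ) {φ : E d → ℝ} (hφ : IsTest Ω φ) :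
    ∃ C h₀ : ℝ, 0 ≤ C ∧ 0 < h₀ ∧ ∀ (h : ℝ) (𝒯 : Geometry.SimplicialComplex ℝ (E d)),
      0 < h → h < h₀ → IsTriangulation Ω γ κ h 𝒯 →
      ∃ v : Xh Ω 𝒯, ∀ᵐ x : E d, ‖gradient φ x - gradient (v : E d → ℝ) x‖ ≤ C * h := by
  obtain ⟨hφs, hφc, hφΩ⟩ := hφ
  have hφd : Differentiable ℝ φ := hφs.differentiable (by simp)
  obtain ⟨Λ, hΛ⟩ : ∃ Λ : NNReal, LipschitzWith Λ (fderiv ℝ φ) :=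
    (hφs.fderiv_right (m := 1) (by norm_cast)).lipschitzWith_of_hasCompactSupport
      (hφc.fderiv ℝ) (by simp)
  obtain ⟨δ, hδ, hδΩ⟩ := hφc.isCompact.exists_thickening_subset_open hΩo hφΩ
  -- The interpolant must vanish on the uncovered part. Uncovered points lie within `(κ+1)h` of the
  -- complement of `Ω`; passing to the closure costs another `h`, and so does passing to the
  -- vertices of a simplex. Hence `(κ+3)h` has to stay below `δ`, the thickness of a neighbourhood
  -- of the support inside `Ω`.
  refine ⟨2 * Λ / γ, δ / (κ + 3), by positivity, by positivity, fun h 𝒯 hh hh0 h𝒯 => ?_⟩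
  rw [lt_div_iff₀ (by positivity)] at hh0
  have hφ0 : ∀ z y, y ∉ Ω → dist z y < (κ + 3) * h → φ z = 0 := fun z y hy hzy => by
    by_contra hz
    refine hy (hδΩ (Metric.mem_thickening_iff.2 ⟨z, subset_tsupport _ hz, ?_⟩))
    rw [dist_comm]
    linarith
  have hcl : ∀ x, x ∈ closure (𝒯.spaceᶜ) → ∀ z, dist z x ≤ h → φ z = 0 := by
    intro x hx z hz
    obtain ⟨x', hx', hxx'⟩ := Metric.mem_closure_iff.1 hx h hh
    obtain ⟨y, hy, hxy⟩ := exists_notMem_dist_lt hd hΩ hΩo hκ hh h𝒯 hx'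
    refine hφ0 z y hy ?_
    calc dist z y ≤ dist z x + dist x x' + dist x' y := dist_triangle4 _ _ _ _
      _ < h + h + (κ + 1) * h := by linarith
      _ = _ := by ring
  set F := {s ∈ 𝒯.faces | s.card = d + 1} with hF
  have hFfin : F.Finite := h𝒯.finite.subset (sep_subset _ _)
  have hcover : ∀ x ∈ 𝒯.space, ∃ s ∈ F, x ∈ convexHull ℝ (s : Set (E d)) := fun x hx => by
    obtain ⟨s, hs, hxs⟩ := Geometry.SimplicialComplex.mem_space_iff.1 hx
    obtain ⟨t, ht, hst, htc⟩ := h𝒯.pure s hs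
    exact ⟨t, ⟨ht, htc⟩, convexHull_mono (by exact_mod_cast hst) hxs⟩
  have hAex : ∀ s : Finset (E d), ∃ A : E d →ᵃ[ℝ] ℝ, s ∈ F → ∀ p ∈ s, A p = φ p := fun s => by
    by_cases hs : s ∈ F
    · obtain ⟨A, hA⟩ := exists_affine_interpolant (𝒯.indep hs.1) hs.2 φ
      exact ⟨A, fun _ => hA⟩
    · exact ⟨0, fun h => absurd h hs⟩
  choose A hA using hAex
  choose! σ hσF hσ using hcover
  classical
  set v : E d → ℝ := fun x => if x ∈ 𝒯.space then A (σ x) x else 0 with hv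
  -- The choice of the simplex `σ x` does not matter: by conformity two simplices meet in the hull
  -- of their common vertices, where both interpolants take the values of `φ`.
  have hvA : ∀ s ∈ F, EqOn v (A s) (convexHull ℝ (s : Set (E d))) := by
    intro s hs x hx
    have hxs : x ∈ 𝒯.space := Geometry.SimplicialComplex.convexHull_subset_space hs.1 hx
    have h1 := 𝒯.inter_subset_convexHull (hσF x hxs).1 hs.1 ⟨hσ x hxs, hx⟩
    rw [hv]
    simp only [hxs, if_true]
    refine affine_eq_of_eqOn (fun p hp => ?_) h1
    rw [hA _ (hσF x hxs) p hp.1, hA _ hs p hp.2]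
  have hv0 : ∀ x, x ∉ 𝒯.space → v x = 0 := fun x hx => by simp [hv, hx]
  have hvz : ∀ x, (∀ z, dist z x ≤ h → φ z = 0) → v x = 0 := by
    intro x hx
    by_cases hxs : x ∈ 𝒯.space
    · have hsF := hσF x hxs
      rw [hvA _ hsF (hσ x hxs)]
      have : EqOn (A (σ x)) (0 : E d →ᵃ[ℝ] ℝ) (convexHull ℝ (σ x : Set (E d))) := by
        refine affine_eq_of_eqOn fun p hp => ?_
        rw [hA _ hsF p hp]
        refine (hx p ?_).trans (by simp)
        exact (Metric.dist_le_diam_of_mem (isBounded_convexHull.2 (σ x).finite_toSet.isBounded)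
          (subset_convexHull ℝ _ hp) (hσ x hxs)).trans (h𝒯.diam_le _ hsF.1)
      simpa using this (hσ x hxs)
    · exact hv0 x hxs
  -- Pasting over a finite closed cover: the simplices, and the closure of the uncovered set, on
  -- which `v` vanishes.
  have hvc : Continuous v := by
    have := hFfin.to_subtype
    let S : Option F → Set (E d) := fun o =>
      o.elim (closure (𝒯.spaceᶜ)) fun s => convexHull ℝ ((s : Finset (E d)) : Set (E d))
    refine (locallyFinite_of_finite S).continuous ?_ ?_ ?_
    · refine eq_univ_of_forall fun x => mem_iUnion.2 ?_
      by_cases hxs : x ∈ 𝒯.space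
      · exact ⟨some ⟨σ x, hσF x hxs⟩, hσ x hxs⟩
      · exact ⟨none, subset_closure hxs⟩
    · rintro (_ | s)
      · exact isClosed_closure
      · exact isClosed_hull _
    · rintro (_ | s)
      · exact (continuousOn_const (c := (0 : ℝ))).congr fun x hx => hvz x (hcl x hx)
      · exact ((A s).continuous_of_finiteDimensional.continuousOn).congr (hvA s s.2)
  refine ⟨⟨v, hvc, fun s hs => ?_, fun x hx => ?_, hv0⟩, ?_⟩
  · obtain ⟨t, ht, hst, htc⟩ := h𝒯.pure s hs
    exact ⟨A t, (hvA t ⟨ht, htc⟩).mono (convexHull_mono (by exact_mod_cast hst))⟩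
  · exact hvz x fun z hz => hφ0 z x hx (hz.trans_lt (by nlinarith))
  · filter_upwards [ae_mem_interior_or h𝒯] with x hx
    rcases hx with hx | ⟨s, hs, hcard, hx⟩
    · have hopen : IsOpen (𝒯.spaceᶜ) := by
        rw [isOpen_compl_iff]
        exact h𝒯.finite.isClosed_biUnion fun s _ => isClosed_hull s
      have h1 : v =ᶠ[𝓝 x] fun _ => 0 := by
        filter_upwards [hopen.mem_nhds hx] with z hz using hv0 z hz
      have h2 : φ =ᶠ[𝓝 x] fun _ => 0 := by
        filter_upwards [Metric.closedBall_mem_nhds x hh] with z hz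
        exact hcl x (subset_closure hx) z hz
      have h3 : gradient v x = 0 := by rw [h1.gradient_eq]; simp
      have h4 : gradient φ x = 0 := by rw [h2.gradient_eq]; simp
      show ‖gradient φ x - gradient v x‖ ≤ _
      rw [h3, h4]
      simp
      positivity
    · obtain ⟨x₀, hx₀⟩ := h𝒯.ball s hs hcard
      have h1 := norm_affDeriv_sub_le hφd hΛ (hA s ⟨hs, hcard⟩) hh hγ (h𝒯.diam_le s hs) hx₀
        (interior_subset hx)
      have h2 : fderiv ℝ v x = affDeriv (A s) := by
        refine ((hasFDerivAt_affine (A s) x).congr_of_eventuallyEq ?_).fderiv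
        filter_upwards [isOpen_interior.mem_nhds hx] with z hz
        exact hvA s ⟨hs, hcard⟩ (interior_subset hz)
      show ‖gradient φ x - gradient v x‖ ≤ _
      rw [gradient, gradient, ← map_sub, LinearIsometryEquiv.norm_map, h2, norm_sub_rev]
      exact h1

end Interpolation

/-! ### The `L²` setting -/

section L2

variable {d : ℕ} {Ω : Set (E d)} {γ κ h : ℝ} {𝒯 : Geometry.SimplicialComplex ℝ (E d)}

theorem isFiniteMeasure_restrict (hb : Bornology.IsBounded Ω) :
    IsFiniteMeasure (volume.restrict Ω) :=
  ⟨by simpa using hb.measure_lt_top⟩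

/-- Square integrable vector fields. -/
abbrev L2V (Ω : Set (E d)) := Lp (E d) 2 (volume.restrict Ω)

/-- Square integrable functions. -/
abbrev L2S (Ω : Set (E d)) := Lp ℝ 2 (volume.restrict Ω)

theorem norm_sq_L2V (F : L2V Ω) : ‖F‖ ^ 2 = normSq Ω F := by
  rw [← real_inner_self_eq_norm_sq, L2.inner_def]
  simp only [real_inner_self_eq_norm_sq, normSq]

theorem normSq_eq_norm_toLp {F : E d → E d} (hF : MemLp F 2 (volume.restrict Ω)) :
    normSq Ω F = ‖hF.toLp F‖ ^ 2 := by
  rw [norm_sq_L2V]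
  refine integral_congr_ae ?_
  filter_upwards [hF.coeFn_toLp] with x hx
  rw [hx]

theorem l2_eq_inner_toLp {u v : E d → ℝ} (hu : MemLp u 2 (volume.restrict Ω))
    (hv : MemLp v 2 (volume.restrict Ω)) : l2 Ω u v = inner ℝ (hu.toLp u) (hv.toLp v) := by
  rw [L2.inner_def]
  refine integral_congr_ae ?_
  filter_upwards [hu.coeFn_toLp, hv.coeFn_toLp] with x hx hx'
  simp [hx, hx', mul_comm]

theorem integral_inner_eq_inner_toLp {F G : E d → E d} (hF : MemLp F 2 (volume.restrict Ω))
    (hG : MemLp G 2 (volume.restrict Ω)) :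
    ∫ x in Ω, inner ℝ (F x) (G x) = inner ℝ (hF.toLp F) (hG.toLp G) := by
  rw [L2.inner_def]
  refine integral_congr_ae ?_
  filter_upwards [hF.coeFn_toLp, hG.coeFn_toLp] with x hx hx'
  rw [hx, hx']

theorem l2w_eq_l2w_toLp (a : E d → ℝ) {F G : E d → E d} (hF : MemLp F 2 (volume.restrict Ω))
    (hG : MemLp G 2 (volume.restrict Ω)) : l2w Ω a F G = l2w Ω a (hF.toLp F) (hG.toLp G) := by
  refine integral_congr_ae ?_
  filter_upwards [hF.coeFn_toLp, hG.coeFn_toLp] with x hx hx'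
  rw [hx, hx']

theorem integrable_norm_mul_norm (F G : L2V Ω) :
    Integrable (fun x => ‖F x‖ * ‖G x‖) (volume.restrict Ω) :=
  (Lp.memLp F).norm.integrable_mul (Lp.memLp G).norm

theorem integral_norm_mul_norm_le (F G : L2V Ω) :
    ∫ x in Ω, ‖F x‖ * ‖G x‖ ≤ ‖F‖ * ‖G‖ := by
  have h1 : ∀ F : L2V Ω, ‖(Lp.memLp F).norm.toLp (fun x => ‖F x‖)‖ = ‖F‖ := fun F => by
    rw [Lp.norm_toLp, eLpNorm_norm, Lp.norm_def]
  rw [← h1 F, ← h1 G]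
  refine le_trans (le_of_eq ?_) (real_inner_le_norm _ _)
  exact l2_eq_inner_toLp (Lp.memLp F).norm (Lp.memLp G).norm

theorem abs_l2w_le {a : E d → ℝ} {C : ℝ} (hΩ : IsOpen Ω) (ha : ∀ x ∈ Ω, |a x| ≤ C)
    (hC : 0 ≤ C) (F G : L2V Ω) : |l2w Ω a F G| ≤ C * (‖F‖ * ‖G‖) := by
  refine le_trans ?_ (mul_le_mul_of_nonneg_left (integral_norm_mul_norm_le F G) hC)
  rw [← integral_const_mul, l2w, ← Real.norm_eq_abs]
  refine norm_integral_le_of_norm_le ((integrable_norm_mul_norm F G).const_mul C) ?_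
  filter_upwards [ae_restrict_mem hΩ.measurableSet] with x hx
  rw [norm_mul, Real.norm_eq_abs, Real.norm_eq_abs]
  have := abs_real_inner_le_norm (F x) (G x)
  have := ha x hx
  gcongr

theorem exists_bound_of_continuousOn (hb : Bornology.IsBounded Ω) {a : E d → ℝ}
    (ha : ContinuousOn a (closure Ω)) : ∃ C, ∀ x ∈ Ω, |a x| ≤ C := by
  obtain ⟨C, hC⟩ := hb.isCompact_closure.exists_bound_of_continuousOn ha
  exact ⟨C, fun x hx => hC x (subset_closure hx)⟩

theorem integrable_l2w (hΩ : IsOpen Ω) (hb : Bornology.IsBounded Ω) {a : E d → ℝ}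
    (ha : ContinuousOn a (closure Ω)) (F G : L2V Ω) :
    Integrable (fun x => a x * inner ℝ (F x) (G x)) (volume.restrict Ω) := by
  obtain ⟨C, hC⟩ := exists_bound_of_continuousOn hb ha
  refine (L2.integrable_inner F G).bdd_mul (c := C)
    ((ha.mono subset_closure).aestronglyMeasurable hΩ.measurableSet) ?_
  filter_upwards [ae_restrict_mem hΩ.measurableSet] with x hx using hC x hx

theorem l2w_symm (a : E d → ℝ) (F G : E d → E d) : l2w Ω a F G = l2w Ω a G F := by
  simp only [l2w, real_inner_comm]

/-- The form `(a F, G)` for a continuous coefficient `a`. -/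
def l2wForm (hΩ : IsOpen Ω) (hb : Bornology.IsBounded Ω) (a : E d → ℝ)
    (ha : ContinuousOn a (closure Ω)) : L2V Ω →ₗ[ℝ] L2V Ω →ₗ[ℝ] ℝ :=
  have hadd : ∀ F F' G : L2V Ω, l2w Ω a (F + F' : L2V Ω) G = l2w Ω a F G + l2w Ω a F' G :=
    fun F F' G => by
      rw [l2w, l2w, l2w, ← integral_add (integrable_l2w hΩ hb ha F G)
        (integrable_l2w hΩ hb ha F' G)]
      refine integral_congr_ae ?_
      filter_upwards [Lp.coeFn_add F F'] with x hx
      rw [hx, Pi.add_apply, inner_add_left, mul_add]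
  have hsmul : ∀ (c : ℝ) (F G : L2V Ω), l2w Ω a (c • F : L2V Ω) G = c * l2w Ω a F G :=
    fun c F G => by
      rw [l2w, l2w, ← integral_const_mul]
      refine integral_congr_ae ?_
      filter_upwards [Lp.coeFn_smul c F] with x hx
      rw [hx, Pi.smul_apply, real_inner_smul_left]
      ring
  LinearMap.mk₂ ℝ (fun F G => l2w Ω a F G) hadd hsmul
    (fun F G G' => by simp only [l2w_symm a F]; exact hadd G G' F)
    (fun c F G => by simp only [l2w_symm a F]; exact hsmul c G F)

theorem l2wForm_apply (hΩ : IsOpen Ω) (hb : Bornology.IsBounded Ω) (a : E d → ℝ)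
    (ha : ContinuousOn a (closure Ω)) (F G : L2V Ω) :
    l2wForm hΩ hb a ha F G = l2w Ω a F G := rfl

theorem le_l2w (hΩ : IsOpen Ω) (hb : Bornology.IsBounded Ω) {a : E d → ℝ}
    (ha : ContinuousOn a (closure Ω)) {m : ℝ} (hm : ∀ x ∈ Ω, m ≤ a x) (F : L2V Ω) :
    m * ‖F‖ ^ 2 ≤ l2w Ω a F F := by
  rw [norm_sq_L2V, normSq, ← integral_const_mul]
  have h1 : Integrable (fun x => ‖F x‖ ^ 2) (volume.restrict Ω) :=
    (Lp.memLp F).norm.integrable_sq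
  refine integral_mono_ae (h1.const_mul m) (integrable_l2w hΩ hb ha F F) ?_
  filter_upwards [ae_restrict_mem hΩ.measurableSet] with x hx
  have := hm x hx
  rw [real_inner_self_eq_norm_sq]
  gcongr

theorem l2w_sub_coeff (hΩ : IsOpen Ω) (hb : Bornology.IsBounded Ω) {a a' : E d → ℝ}
    (ha : ContinuousOn a (closure Ω)) (ha' : ContinuousOn a' (closure Ω)) (F G : L2V Ω) :
    l2w Ω a F G - l2w Ω a' F G = l2w Ω (fun x => a x - a' x) F G := by
  rw [l2w, l2w, l2w, ← integral_sub (integrable_l2w hΩ hb ha F G) (integrable_l2w hΩ hb ha' F G)]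
  simp only [sub_mul]

/-! ### Embedding of the finite element space -/

theorem Xh.memLp (hb : Bornology.IsBounded Ω) (v : Xh Ω 𝒯) :
    MemLp (v : E d → ℝ) 2 (volume.restrict Ω) :=
  ((Xh.continuous v).memLp_of_hasCompactSupport (Xh.hasCompactSupport hb v)).restrict Ω

theorem memLp_gradient (hb : Bornology.IsBounded Ω) {v : E d → ℝ} {C : NNReal}
    (hv : LipschitzWith C v) : MemLp (gradient v) 2 (volume.restrict Ω) := by
  have := isFiniteMeasure_restrict hb
  exact MemLp.of_bound (measurable_gradient v).aestronglyMeasurable C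
    (Eventually.of_forall (norm_gradient_le hv))

theorem Xh.memLp_gradient (hb : Bornology.IsBounded Ω) (h𝒯 : IsTriangulation Ω γ κ h 𝒯)
    (v : Xh Ω 𝒯) : MemLp (gradient (v : E d → ℝ)) 2 (volume.restrict Ω) := by
  obtain ⟨C, hC, -⟩ := Xh.exists_lipschitz h𝒯 v
  exact KirchhoffFEM.memLp_gradient hb hC

theorem Xh.ae_differentiableAt (h𝒯 : IsTriangulation Ω γ κ h 𝒯) (v : Xh Ω 𝒯) :
    ∀ᵐ x ∂(volume.restrict Ω), DifferentiableAt ℝ (v : E d → ℝ) x := by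
  obtain ⟨C, hC, -⟩ := Xh.exists_lipschitz h𝒯 v
  exact ae_restrict_of_ae hC.ae_differentiableAt

/-- The embedding of `X_h` into `L²`. -/
def valLp (hb : Bornology.IsBounded Ω) : Xh Ω 𝒯 →ₗ[ℝ] L2S Ω where
  toFun v := (Xh.memLp hb v).toLp _
  map_add' u v := (MemLp.toLp_add (Xh.memLp hb u) (Xh.memLp hb v))
  map_smul' c v := (MemLp.toLp_const_smul c (Xh.memLp hb v))

/-- The gradient as a map of `X_h` into `L²`. -/
def gradLp (hb : Bornology.IsBounded Ω) (h𝒯 : IsTriangulation Ω γ κ h 𝒯) :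
    Xh Ω 𝒯 →ₗ[ℝ] L2V Ω where
  toFun v := (Xh.memLp_gradient hb h𝒯 v).toLp _
  map_add' u v := by
    rw [← MemLp.toLp_add, MemLp.toLp_eq_toLp_iff]
    filter_upwards [Xh.ae_differentiableAt h𝒯 u, Xh.ae_differentiableAt h𝒯 v] with x hu hv
    show gradient ((u : E d → ℝ) + (v : E d → ℝ)) x = _
    simp only [gradient, Pi.add_apply]
    rw [fderiv_add hu hv, map_add]
  map_smul' c v := by
    rw [RingHom.id_apply, ← MemLp.toLp_const_smul, MemLp.toLp_eq_toLp_iff]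
    filter_upwards [Xh.ae_differentiableAt h𝒯 v] with x hv
    show gradient (c • (v : E d → ℝ)) x = _
    simp only [gradient, Pi.smul_apply]
    rw [fderiv_const_smul hv, map_smul]

theorem inner_valLp (hb : Bornology.IsBounded Ω) (u v : Xh Ω 𝒯) :
    inner ℝ (valLp hb u) (valLp hb v) = l2 Ω u v :=
  (l2_eq_inner_toLp (Xh.memLp hb u) (Xh.memLp hb v)).symm

theorem norm_gradLp_sq (hb : Bornology.IsBounded Ω) (h𝒯 : IsTriangulation Ω γ κ h 𝒯)
    (v : Xh Ω 𝒯) : ‖gradLp hb h𝒯 v‖ ^ 2 = normSq Ω (gradient (v : E d → ℝ)) :=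
  (normSq_eq_norm_toLp (Xh.memLp_gradient hb h𝒯 v)).symm

theorem norm_valLp_sq (hb : Bornology.IsBounded Ω) (v : Xh Ω 𝒯) :
    ‖valLp hb v‖ ^ 2 = ∫ x in Ω, (v : E d → ℝ) x ^ 2 := by
  rw [← real_inner_self_eq_norm_sq, inner_valLp]
  simp only [l2, sq]

theorem valLp_injective (hΩ : IsOpen Ω) (hb : Bornology.IsBounded Ω) :
    Function.Injective (valLp (𝒯 := 𝒯) hb) := by
  rw [injective_iff_map_eq_zero]
  intro v hv
  have h1 : (v : E d → ℝ) =ᵐ[volume.restrict Ω] 0 :=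
    (MemLp.toLp_eq_toLp_iff (Xh.memLp hb v) MemLp.zero).1 (hv.trans (MemLp.toLp_zero _).symm)
  have h2 : (v : E d → ℝ) =ᵐ[volume] 0 := by
    filter_upwards [(ae_restrict_iff' hΩ.measurableSet).1 h1] with x hx
    by_cases hxΩ : x ∈ Ω
    · exact hx hxΩ
    · exact Xh.eq_zero_of_notMem v hxΩ
  exact Subtype.ext (((Xh.continuous v).ae_eq_iff_eq volume continuous_zero).1 h2)

theorem norm_valLp_le (hd : 1 ≤ d) (hΩ : IsOpen Ω) (hb : Bornology.IsBounded Ω) {ρ : ℝ}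
    (hρ0 : 0 ≤ ρ) (hρ : ∀ x ∈ Ω, ‖x‖ ≤ ρ) (h𝒯 : IsTriangulation Ω γ κ h 𝒯) (v : Xh Ω 𝒯) :
    ‖valLp hb v‖ ≤ 2 * ρ * ‖gradLp hb h𝒯 v‖ := by
  obtain ⟨C, hC, -⟩ := Xh.exists_lipschitz h𝒯 v
  refine le_of_sq_le_sq ?_ (by positivity)
  rw [mul_pow, norm_gradLp_sq, norm_valLp_sq]
  exact integral_sq_le_gradient hd hΩ.measurableSet hρ hC
    (fun x hx => Xh.eq_zero_of_notMem v hx) (Xh.hasCompactSupport hb v)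

theorem gradLp_injective (hd : 1 ≤ d) (hΩ : IsOpen Ω) (hb : Bornology.IsBounded Ω)
    (h𝒯 : IsTriangulation Ω γ κ h 𝒯) : Function.Injective (gradLp hb h𝒯) := by
  rw [injective_iff_map_eq_zero]
  intro v hv
  obtain ⟨ρ, hρ0, hρ⟩ := hb.exists_pos_norm_le
  have h1 := norm_valLp_le hd hΩ hb hρ0.le hρ h𝒯 v
  rw [hv, norm_zero, mul_zero, norm_le_zero_iff] at h1
  exact valLp_injective hΩ hb (by rw [h1, map_zero])

theorem exists_norm_gradLp_le (hb : Bornology.IsBounded Ω) {r : ℝ} (hr : 0 < r) :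
    ∃ I : ℝ, 0 ≤ I ∧ ∀ (γ κ h : ℝ) (𝒯 : Geometry.SimplicialComplex ℝ (E d))
      (h𝒯 : IsTriangulation Ω γ κ h 𝒯), r ≤ γ * h → ∀ v : Xh Ω 𝒯,
      ‖gradLp hb h𝒯 v‖ ≤ I * ‖valLp hb v‖ := by
  obtain ⟨I, hI, hinv⟩ := exists_inverse_inequality hb hr
  refine ⟨√I, by positivity, fun γ κ h 𝒯 h𝒯 hrh v => le_of_sq_le_sq ?_ (by positivity)⟩
  rw [mul_pow, Real.sq_sqrt hI, norm_gradLp_sq, norm_valLp_sq]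
  exact hinv γ κ h 𝒯 h𝒯 hrh v

/-- Integration by parts for `(a ∇φ, ∇v)` with a regular `a ∇φ`. -/
theorem abs_l2w_gradient_le (hb : Bornology.IsBounded Ω) {φ : E d → ℝ}
    (hφ : IsTest Ω φ) (Mt L : NNReal) :
    ∃ C : ℝ, 0 ≤ C ∧ ∀ a : E d → ℝ, (∀ x ∈ Ω, |a x| ≤ Mt) → LipschitzOnWith L a Ω →
      ∀ (γ κ h : ℝ) (𝒯 : Geometry.SimplicialComplex ℝ (E d)) (_ : IsTriangulation Ω γ κ h 𝒯)
        (v : Xh Ω 𝒯), |l2w Ω a (gradient φ) (gradient (v : E d → ℝ))| ≤ C * ‖valLp hb v‖ := by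
  have := isFiniteMeasure_restrict hb
  obtain ⟨hφs, hφc, hφΩ⟩ := hφ
  have hφ1 : ContDiff ℝ 1 (fderiv ℝ φ) := hφs.fderiv_right (m := 1) (by norm_cast)
  obtain ⟨Λ, hΛ⟩ : ∃ Λ : NNReal, LipschitzWith Λ (fderiv ℝ φ) :=
    hφ1.lipschitzWith_of_hasCompactSupport (hφc.fderiv ℝ) (by simp)
  obtain ⟨Λ', hΛ'⟩ : ∃ Λ : NNReal, LipschitzWith Λ φ :=
    hφs.lipschitzWith_of_hasCompactSupport hφc (by simp)
  have hone : MemLp (fun _ : E d => (1 : ℝ)) 2 (volume.restrict Ω) := memLp_const 1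
  -- The constant involves `a` only through its bound `Mt` and its Lipschitz constant `L`. One
  -- constant therefore serves all coefficients `M(·,t,s)` with `s` in a bounded range.
  refine ⟨d * ((Mt * Λ + Λ' * L) * ‖hone.toLp _‖), by positivity,
    fun a ha haL γ κ h 𝒯 h𝒯 v => ?_⟩
  obtain ⟨Cv, hCv, -⟩ := Xh.exists_lipschitz h𝒯 v
  set b : Fin d → E d → ℝ := fun i x => gradient φ x i with hbdef
  have hb0 : ∀ i x, x ∉ Ω → b i x = 0 := fun i x hx => by
    have : fderiv ℝ φ x = 0 := by
      by_contra h0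
      exact hx (hφΩ (tsupport_fderiv_subset ℝ (subset_tsupport _ h0)))
    simp only [hbdef, gradient_apply, this]
    simp
  have hbn : ∀ i x, |b i x| ≤ Λ' := fun i x => by
    refine le_trans ?_ (norm_gradient_le hΛ' x)
    rw [← Real.norm_eq_abs]
    exact PiLp.norm_apply_le _ i
  have hbL : ∀ i x y, |b i x - b i y| ≤ Λ * ‖x - y‖ := fun i x y => by
    refine le_trans ?_ (hΛ.norm_sub_le x y)
    simp only [hbdef, gradient_apply]
    rw [← sub_apply, ← Real.norm_eq_abs]
    refine (ContinuousLinearMap.le_opNorm _ _).trans ?_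
    simp
  -- The coefficient `a` is controlled on `Ω` only. If one of the two points lies outside, `b i`
  -- vanishes there, and the Lipschitz bound of `b i` alone suffices; no extension of `a` is needed.
  have hψL : ∀ i, LipschitzWith (Mt * Λ + Λ' * L) (fun x => a x * b i x) := fun i => by
    refine LipschitzWith.of_dist_le_mul fun x y => ?_
    rw [Real.dist_eq, dist_eq_norm, NNReal.coe_add, NNReal.coe_mul, NNReal.coe_mul]
    by_cases hy : y ∈ Ω
    · by_cases hx : x ∈ Ω
      · have h1 := haL.dist_le_mul x hx y hy
        rw [Real.dist_eq, dist_eq_norm] at h1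
        have h2 : a x * b i x - a y * b i y = a x * (b i x - b i y) + b i y * (a x - a y) := by
          ring
        rw [h2, add_mul, mul_assoc, mul_assoc]
        refine (abs_add_le _ _).trans ?_
        rw [abs_mul, abs_mul]
        have h3 := ha x hx
        have h4 := hbL i x y
        have h5 := hbn i y
        gcongr
      · have h2 := hbL i x y
        have h3 := ha y hy
        rw [hb0 i x hx] at h2 ⊢
        rw [mul_zero, zero_sub, abs_neg, abs_mul, add_mul, mul_assoc]
        rw [zero_sub, abs_neg] at h2
        refine le_add_of_le_of_nonneg ?_ (by positivity)
        gcongr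
    · rw [hb0 i y hy]
      by_cases hx : x ∈ Ω
      · have h2 := hbL i x y
        have h3 := ha x hx
        rw [hb0 i y hy, sub_zero] at h2
        rw [mul_zero, sub_zero, abs_mul, add_mul, mul_assoc]
        refine le_add_of_le_of_nonneg ?_ (by positivity)
        gcongr
      · rw [hb0 i x hx]
        simp only [mul_zero, sub_zero, abs_zero]
        positivity
  have hψc : ∀ i, HasCompactSupport (fun x => a x * b i x) := fun i =>
    HasCompactSupport.intro hb.isCompact_closure fun x hx => by
      rw [hb0 i x fun hx' => hx (subset_closure hx'), mul_zero]
  have hint : ∀ i, Integrable (fun x => gradient (v : E d → ℝ) x i * (a x * b i x)) := fun i => by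
    refine ((hψL i).continuous.integrable_of_hasCompactSupport (hψc i)).bdd_mul (c := Cv) ?_
      (Eventually.of_forall fun x => ?_)
    · have := measurable_gradient (v : E d → ℝ)
      have h2 : Measurable fun F : E d => F i := by fun_prop
      exact (h2.comp this).aestronglyMeasurable
    · exact (PiLp.norm_apply_le _ i).trans (norm_gradient_le hCv x)
  have h1 : l2w Ω a (gradient φ) (gradient (v : E d → ℝ))
      = ∑ i, ∫ x, gradient (v : E d → ℝ) x i * (a x * b i x) := by
    have hsum : ∀ x, a x * inner ℝ (gradient φ x) (gradient (v : E d → ℝ) x)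
        = ∑ i, gradient (v : E d → ℝ) x i * (a x * b i x) := fun x => by
      simp only [PiLp.inner_apply, Finset.mul_sum, hbdef]
      refine Finset.sum_congr rfl fun i _ => ?_
      simp only [RCLike.inner_apply, conj_trivial]
      ring
    rw [← integral_finsetSum _ fun i _ => hint i, l2w]
    simp only [hsum]
    refine setIntegral_eq_integral_of_forall_compl_eq_zero fun x hx => ?_
    exact Finset.sum_eq_zero fun i _ => by rw [hb0 i x hx, mul_zero, mul_zero]
  have h2 : ∫ x in Ω, |(v : E d → ℝ) x| ≤ ‖hone.toLp _‖ * ‖valLp hb v‖ := by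
    have hv := Xh.memLp hb v
    have h3 : ‖hv.norm.toLp _‖ = ‖valLp hb v‖ := by
      show _ = ‖hv.toLp _‖
      rw [Lp.norm_toLp, Lp.norm_toLp, eLpNorm_norm]
    rw [← h3]
    refine le_trans (le_of_eq ?_) (real_inner_le_norm _ _)
    rw [← l2_eq_inner_toLp]
    simp [l2]
  rw [h1]
  refine (Finset.abs_sum_le_sum_abs _ _).trans ?_
  have h3 : ∀ i ∈ Finset.univ, |∫ x, gradient (v : E d → ℝ) x i * (a x * b i x)|
      ≤ (Mt * Λ + Λ' * L) * (‖hone.toLp _‖ * ‖valLp hb v‖) := fun i _ => by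
    refine (abs_integral_gradient_mul_le hCv (fun x hx => Xh.eq_zero_of_notMem v hx)
      (Xh.hasCompactSupport hb v) (hψL i) (hψc i) i).trans ?_
    rw [NNReal.coe_add, NNReal.coe_mul, NNReal.coe_mul]
    gcongr
  refine (Finset.sum_le_card_nsmul _ _ _ h3).trans (le_of_eq ?_)
  simp
  ring

end L2

/-! ### Boundedness of the memory form. -/

section Memory

variable {d : ℕ} {γ κ h : ℝ}

theorem norm_toLp_le_of_ae_le {Ω : Set (E d)} {F F' : Type*} [NormedAddCommGroup F]
    [NormedAddCommGroup F'] {f : E d → F} {g : E d → F'} {C : ℝ}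
    (hf : MemLp f 2 (volume.restrict Ω)) (hg : MemLp g 2 (volume.restrict Ω))
    (hfg : ∀ᵐ x ∂(volume.restrict Ω), ‖f x‖ ≤ C * ‖g x‖) : ‖hf.toLp f‖ ≤ C * ‖hg.toLp g‖ := by
  refine Lp.norm_le_mul_norm_of_ae_le_mul ?_
  filter_upwards [hf.coeFn_toLp, hg.coeFn_toLp, hfg] with x h1 h2 h3
  rwa [h1, h2]

theorem isCompact_cyl {D : Data d} (hb : Bornology.IsBounded D.Ω) : IsCompact D.cyl :=
  hb.isCompact_closure.prod (isCompact_Icc.prod isCompact_Icc)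

theorem convex_cyl {D : Data d} (hc : Convex ℝ D.Ω) : Convex ℝ D.cyl :=
  hc.closure.prod ((convex_Icc _ _).prod (convex_Icc _ _))

theorem mapsTo_cyl {D : Data d} {t s : ℝ} (ht : t ∈ Icc 0 D.T) (hs : s ∈ Icc 0 D.T) :
    MapsTo (fun x : E d => (x, t, s)) (closure D.Ω) D.cyl :=
  fun _ hx => ⟨hx, ht, hs⟩

theorem continuousOn_toEuclideanCLM {X : Type*} [TopologicalSpace X] {b : X → Matrix (Fin d) (Fin d) ℝ}
    {S : Set X} (hb : ∀ i j, ContinuousOn (fun x => b x i j) S) :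
    ContinuousOn (fun x => Matrix.toEuclideanCLM (𝕜 := ℝ) (b x)) S := by
  let Φ : Matrix (Fin d) (Fin d) ℝ →ₗ[ℝ] (E d →L[ℝ] E d) :=
    (Matrix.toEuclideanCLM (n := Fin d) (𝕜 := ℝ)).toAlgEquiv.toLinearMap
  have h1 : Continuous Φ := Φ.continuous_of_finiteDimensional
  exact h1.comp_continuousOn (continuousOn_pi.2 fun i => continuousOn_pi.2 fun j => hb i j)

theorem continuous_prodMk_time (t s : ℝ) : Continuous (fun x : E d => (x, t, s)) := by fun_prop

theorem exists_bound_section {D : Data d} (hb : Bornology.IsBounded D.Ω) {F : Type*}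
    [NormedAddCommGroup F] (f : E d → ℝ → ℝ → F)
    (hf : ContinuousOn (fun p : E d × ℝ × ℝ => f p.1 p.2.1 p.2.2) D.cyl) :
    ∃ β : ℝ, 0 ≤ β ∧ ∀ t ∈ Icc 0 D.T, ∀ s ∈ Icc 0 D.T,
      ContinuousOn (fun x => f x t s) (closure D.Ω) ∧ ∀ x ∈ D.Ω, ‖f x t s‖ ≤ β := by
  obtain ⟨β, hβ⟩ := (isCompact_cyl hb).exists_bound_of_continuousOn hf
  refine ⟨max β 0, le_max_right _ _, fun t ht s hs => ⟨?_, fun x hx => ?_⟩⟩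
  · exact hf.comp (continuous_prodMk_time t s).continuousOn (mapsTo_cyl ht hs)
  · exact (hβ _ (mapsTo_cyl ht hs (subset_closure hx))).trans (le_max_left _ _)

theorem aestronglyMeasurable_clm_apply {μ : Measure (E d)} {A : E d → E d →L[ℝ] E d}
    {F : E d → E d} (hA : AEStronglyMeasurable A μ) (hF : AEStronglyMeasurable F μ) :
    AEStronglyMeasurable (fun x => A x (F x)) μ :=
  (isBoundedBilinearMap_apply.continuous).comp_aestronglyMeasurable (hA.prodMk hF)

/-- A smooth function on the compact convex cylinder is Lipschitz there. Its Lipschitz constant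
bounds the spatial derivative at interior points, uniformly in both times and up to the boundary. -/
theorem exists_bound_b₁ {D : Data d} (hD : D.Standing) (h3 : D.H3) :
    ∃ β : ℝ, 0 ≤ β ∧ ∀ t ∈ Icc 0 D.T, ∀ s ∈ Icc 0 D.T,
      ContinuousOn (fun x => D.b₁ x t s) (closure D.Ω) ∧
      ∀ x ∈ D.Ω, ‖D.b₁ x t s‖ ≤ β ∧ DifferentiableAt ℝ (fun y => D.b₁ y t s) x ∧
        ‖fderiv ℝ (fun y => D.b₁ y t s) x‖ ≤ β := by
  have hK := isCompact_cyl hD.bounded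
  have s1 : ContDiffOn ℝ 1 (fun p : E d × ℝ × ℝ => D.b₁ p.1 p.2.1 p.2.2) D.cyl :=
    contDiffOn_euclidean.2 fun j => (h3.smooth₁ j).of_le (by exact_mod_cast le_top)
  obtain ⟨Λ, hΛ⟩ := (s1.locallyLipschitzOn
    (convex_cyl hD.convex)).exists_lipschitzOnWith_of_compact hK
  obtain ⟨β, hβ⟩ := hK.exists_bound_of_continuousOn s1.continuousOn
  refine ⟨max β Λ, le_max_of_le_right Λ.2, fun t ht s hs => ?_⟩
  have hmap := mapsTo_cyl ht hs
  refine ⟨s1.continuousOn.comp (continuous_prodMk_time t s).continuousOn hmap, fun x hx => ?_⟩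
  refine ⟨(hβ _ (hmap (subset_closure hx))).trans (le_max_left _ _), ?_, ?_⟩
  · have hcont : ContDiff ℝ 1 (fun x : E d => (x, t, s)) :=
      contDiff_id.prodMk contDiff_const
    have h4 : ContDiffOn ℝ 1 (fun y => D.b₁ y t s) (closure D.Ω) :=
      s1.comp hcont.contDiffOn hmap
    exact ((h4.mono subset_closure).contDiffAt (hD.isOpen.mem_nhds hx)).differentiableAt (by simp)
  · refine (norm_fderiv_le_of_lipschitzOn ℝ (hD.isOpen.mem_nhds hx) (C := Λ) ?_).trans
      (le_max_right _ _)
    refine LipschitzOnWith.of_dist_le_mul fun y hy z hz => ?_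
    refine (hΛ.dist_le_mul _ (hmap (subset_closure hy)) _ (hmap (subset_closure hz))).trans ?_
    simp [Prod.dist_eq]

theorem divergence_smul {u : E d → ℝ} {F : E d → E d} {x : E d} (hu : DifferentiableAt ℝ u x)
    (hF : DifferentiableAt ℝ F x) :
    divergence (fun y => u y • F y) x = u x * divergence F x + inner ℝ (gradient u x) (F x) := by
  simp only [divergence, PiLp.inner_apply, Finset.mul_sum, ← Finset.sum_add_distrib]
  refine Finset.sum_congr rfl fun i _ => ?_
  rw [fderiv_fun_smul hu hF, gradient_apply]
  simp
  ring

theorem abs_divergence_le (F : E d → E d) (x : E d) :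
    |divergence F x| ≤ d * ‖fderiv ℝ F x‖ := by
  refine (Finset.abs_sum_le_sum_abs _ _).trans ?_
  refine (Finset.sum_le_card_nsmul _ _ ‖fderiv ℝ F x‖ fun i _ => ?_).trans (by simp)
  rw [← Real.norm_eq_abs]
  refine (PiLp.norm_apply_le _ i).trans ((ContinuousLinearMap.le_opNorm _ _).trans ?_)
  simp

theorem measurable_divergence (F : E d → E d) : Measurable (divergence F) := by
  refine Finset.measurable_sum _ fun i _ => ?_
  have h1 : Measurable fun x => fderiv ℝ F x (EuclideanSpace.single i 1) :=
    (measurable_fderiv ℝ F).apply_continuousLinearMap _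
  have h2 : Measurable fun G : E d => G i := by fun_prop
  exact h2.comp h1

section Functionals

variable {Ω : Set (E d)} {𝒯 : Geometry.SimplicialComplex ℝ (E d)}

/-- Only a pointwise domination of `P` by `g` is required, so that `b₂∇u` can be measured by `∇u`.
The functional is the `L²` pairing with `P`. -/
theorem exists_functional_grad (hb : Bornology.IsBounded Ω) (h𝒯 : IsTriangulation Ω γ κ h 𝒯)
    {F' : Type*} [NormedAddCommGroup F'] {P : E d → E d} {g : E d → F'} {C : ℝ}
    (hP : AEStronglyMeasurable P (volume.restrict Ω)) (hg : MemLp g 2 (volume.restrict Ω))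
    (hPg : ∀ᵐ x ∂(volume.restrict Ω), ‖P x‖ ≤ C * ‖g x‖) :
    ∃ l : Xh Ω 𝒯 →ₗ[ℝ] ℝ,
      (∀ v, l v = ∫ x in Ω, inner ℝ (P x) (gradient (v : E d → ℝ) x)) ∧
        ∀ v, |l v| ≤ C * ‖hg.toLp g‖ * ‖gradLp hb h𝒯 v‖ := by
  have hPm : MemLp P 2 (volume.restrict Ω) := MemLp.of_le_mul hg hP hPg
  refine ⟨(innerₗ (L2V Ω) (hPm.toLp P)).comp (gradLp hb h𝒯), fun v => ?_, fun v => ?_⟩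
  · exact (integral_inner_eq_inner_toLp hPm (Xh.memLp_gradient hb h𝒯 v)).symm
  · refine (abs_real_inner_le_norm (hPm.toLp P) (gradLp hb h𝒯 v)).trans ?_
    gcongr
    exact norm_toLp_le_of_ae_le hPm hg hPg

theorem exists_functional_val (hb : Bornology.IsBounded Ω)
    {F' : Type*} [NormedAddCommGroup F'] {q : E d → ℝ} {g : E d → F'} {C : ℝ}
    (hq : AEStronglyMeasurable q (volume.restrict Ω)) (hg : MemLp g 2 (volume.restrict Ω))
    (hqg : ∀ᵐ x ∂(volume.restrict Ω), ‖q x‖ ≤ C * ‖g x‖) :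
    ∃ l : Xh Ω 𝒯 →ₗ[ℝ] ℝ, (∀ v, l v = l2 Ω q v) ∧
        ∀ v, |l v| ≤ C * ‖hg.toLp g‖ * ‖valLp hb v‖ := by
  have hqm : MemLp q 2 (volume.restrict Ω) := MemLp.of_le_mul hg hq hqg
  refine ⟨(innerₗ (L2S Ω) (hqm.toLp q)).comp (valLp hb), fun v => ?_, fun v => ?_⟩
  · exact (l2_eq_inner_toLp hqm (Xh.memLp hb v)).symm
  · refine (abs_real_inner_le_norm (hqm.toLp q) (valLp hb v)).trans ?_
    gcongr
    exact norm_toLp_le_of_ae_le hqm hg hqg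

theorem integrable_mul_val (hb : Bornology.IsBounded Ω) {F' : Type*} [NormedAddCommGroup F']
    {q : E d → ℝ} {g : E d → F'} {C : ℝ}
    (hq : AEStronglyMeasurable q (volume.restrict Ω)) (hg : MemLp g 2 (volume.restrict Ω))
    (hqg : ∀ᵐ x ∂(volume.restrict Ω), ‖q x‖ ≤ C * ‖g x‖) (v : Xh Ω 𝒯) :
    Integrable (fun x => q x * (v : E d → ℝ) x) (volume.restrict Ω) :=
  (MemLp.of_le_mul hg hq hqg).integrable_mul (Xh.memLp hb v)

end Functionals

theorem dotProduct_mulVec_eq_inner (b : Matrix (Fin d) (Fin d) ℝ) (F G : E d) :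
    (b *ᵥ F.ofLp) ⬝ᵥ G.ofLp = inner ℝ (Matrix.toEuclideanCLM (𝕜 := ℝ) b F) G := by
  rw [EuclideanSpace.inner_eq_star_dotProduct, Matrix.ofLp_toEuclideanCLM, dotProduct_comm]
  rfl

/-- The memory form is linear and bounded in the test function. -/
theorem exists_B_linear {D : Data d} (hD : D.Standing) (h3 : D.H3) :
    ∃ C : ℝ, 0 ≤ C ∧ ∀ t ∈ Icc 0 D.T, ∀ s ∈ Icc 0 D.T,
      ∀ (γ κ h : ℝ) (𝒯 : Geometry.SimplicialComplex ℝ (E d)) (h𝒯 : IsTriangulation D.Ω γ κ h 𝒯)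
        (u : Xh D.Ω 𝒯), ∃ l : Xh D.Ω 𝒯 →ₗ[ℝ] ℝ, (∀ v : Xh D.Ω 𝒯, l v = D.B t s u v) ∧
        ∀ v, |l v| ≤ C * (‖gradLp hD.bounded h𝒯 u‖ + ‖valLp hD.bounded u‖)
          * (‖gradLp hD.bounded h𝒯 v‖ + ‖valLp hD.bounded v‖) := by
  have hb := hD.bounded
  obtain ⟨β₂, hβ₂0, hβ₂⟩ := exists_bound_section hb
    (fun x t s => Matrix.toEuclideanCLM (𝕜 := ℝ) (D.b₂ x t s))
    (continuousOn_toEuclideanCLM fun i j => (h3.smooth₂ i j).continuousOn)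
  obtain ⟨β₁, hβ₁0, hβ₁⟩ := exists_bound_b₁ hD h3
  obtain ⟨β₀, hβ₀0, hβ₀⟩ := exists_bound_section hb D.b₀ h3.smooth₀.continuousOn
  have hΩm := hD.isOpen.measurableSet
  refine ⟨β₂ + β₁ + d * β₁ + β₀, by positivity, fun t ht s hs γ κ h 𝒯 h𝒯 u => ?_⟩
  obtain ⟨c2, hx2⟩ := hβ₂ t ht s hs
  obtain ⟨c1, hx1⟩ := hβ₁ t ht s hs
  obtain ⟨c0, hx0⟩ := hβ₀ t ht s hs
  have hu := Xh.memLp hb u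
  have hgu := Xh.memLp_gradient hb h𝒯 u
  have hP : ∀ᵐ x ∂(volume.restrict D.Ω),
      ‖Matrix.toEuclideanCLM (𝕜 := ℝ) (D.b₂ x t s) (gradient (u : E d → ℝ) x)‖
        ≤ β₂ * ‖gradient (u : E d → ℝ) x‖ := by
    filter_upwards [ae_restrict_mem hΩm] with x hx
    exact (ContinuousLinearMap.le_opNorm _ _).trans (by gcongr; exact hx2 x hx)
  have hPm : AEStronglyMeasurable (fun x => Matrix.toEuclideanCLM (𝕜 := ℝ) (D.b₂ x t s)
      (gradient (u : E d → ℝ) x)) (volume.restrict D.Ω) :=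
    aestronglyMeasurable_clm_apply ((c2.mono subset_closure).aestronglyMeasurable hΩm) hgu.1
  have hq1 : ∀ᵐ x ∂(volume.restrict D.Ω),
      ‖(u : E d → ℝ) x * divergence (fun y => D.b₁ y t s) x‖
        ≤ (d * β₁) * ‖(u : E d → ℝ) x‖ := by
    filter_upwards [ae_restrict_mem hΩm] with x hx
    rw [norm_mul, mul_comm]
    gcongr
    exact (abs_divergence_le _ x).trans (by gcongr; exact (hx1 x hx).2.2)
  have hq1m : AEStronglyMeasurable
      (fun x => (u : E d → ℝ) x * divergence (fun y => D.b₁ y t s) x) (volume.restrict D.Ω) :=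
    hu.1.mul (measurable_divergence _).aestronglyMeasurable
  have hq2 : ∀ᵐ x ∂(volume.restrict D.Ω),
      ‖inner ℝ (gradient (u : E d → ℝ) x) (D.b₁ x t s)‖ ≤ β₁ * ‖gradient (u : E d → ℝ) x‖ := by
    filter_upwards [ae_restrict_mem hΩm] with x hx
    rw [mul_comm]
    exact (norm_inner_le_norm _ _).trans (by gcongr; exact (hx1 x hx).1)
  have hq2m : AEStronglyMeasurable
      (fun x => inner ℝ (gradient (u : E d → ℝ) x) (D.b₁ x t s)) (volume.restrict D.Ω) :=
    hgu.1.inner ((c1.mono subset_closure).aestronglyMeasurable hΩm)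
  have hq3 : ∀ᵐ x ∂(volume.restrict D.Ω),
      ‖D.b₀ x t s * (u : E d → ℝ) x‖ ≤ β₀ * ‖(u : E d → ℝ) x‖ := by
    filter_upwards [ae_restrict_mem hΩm] with x hx
    rw [norm_mul]
    gcongr
    exact hx0 x hx
  have hq3m : AEStronglyMeasurable (fun x => D.b₀ x t s * (u : E d → ℝ) x)
      (volume.restrict D.Ω) :=
    ((c0.mono subset_closure).aestronglyMeasurable hΩm).mul hu.1
  obtain ⟨l0, e0, n0⟩ := exists_functional_grad hb h𝒯 hPm hgu hP
  obtain ⟨l1, e1, n1⟩ := exists_functional_val (𝒯 := 𝒯) hb hq1m hu hq1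
  obtain ⟨l2', e2, n2⟩ := exists_functional_val (𝒯 := 𝒯) hb hq2m hgu hq2
  obtain ⟨l3, e3, n3⟩ := exists_functional_val (𝒯 := 𝒯) hb hq3m hu hq3
  refine ⟨l0 + (l1 + l2') + l3, fun v => ?_, fun v => ?_⟩
  · have k0 : ∫ x in D.Ω, (D.b₂ x t s *ᵥ (gradient (u : E d → ℝ) x).ofLp)
        ⬝ᵥ (gradient (v : E d → ℝ) x).ofLp = l0 v := by
      rw [e0]
      simp only [dotProduct_mulVec_eq_inner]
    have k1 : ∫ x in D.Ω, divergence (fun y => (u : E d → ℝ) y • D.b₁ y t s) x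
        * (v : E d → ℝ) x = l1 v + l2' v := by
      rw [e1, e2, l2, l2, ← integral_add (integrable_mul_val hb hq1m hu hq1 v)
        (integrable_mul_val hb hq2m hgu hq2 v)]
      refine integral_congr_ae ?_
      filter_upwards [ae_restrict_mem hΩm, Xh.ae_differentiableAt h𝒯 u] with x hx hux
      rw [divergence_smul hux (hx1 x hx).2.1, add_mul]
    rw [Data.B, k0, k1]
    simp only [LinearMap.add_apply]
    rw [e3]
    rfl
  · replace n0 := n0 v
    replace n1 := n1 v
    replace n2 := n2 v
    replace n3 := n3 v
    change _ ≤ _ * ‖gradLp hb h𝒯 u‖ * _ at n0 n2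
    change _ ≤ _ * ‖valLp hb u‖ * _ at n1 n3
    simp only [LinearMap.add_apply]
    have hgu0 := norm_nonneg (gradLp hb h𝒯 u)
    have hju0 := norm_nonneg (valLp hb u)
    have hgv0 := norm_nonneg (gradLp hb h𝒯 v)
    have hjv0 := norm_nonneg (valLp hb v)
    generalize ‖gradLp hb h𝒯 u‖ = gu at *
    generalize ‖valLp hb u‖ = ju at *
    generalize ‖gradLp hb h𝒯 v‖ = gv at *
    generalize ‖valLp hb v‖ = jv at *
    calc |l0 v + (l1 v + l2' v) + l3 v| ≤ |l0 v| + (|l1 v| + |l2' v|) + |l3 v| :=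
          (abs_add_le _ _).trans (add_le_add_left ((abs_add_le _ _).trans
            (add_le_add_right (abs_add_le _ _) _)) _)
      _ ≤ β₂ * gu * gv + (d * β₁ * ju * jv + β₁ * gu * jv) + β₀ * ju * jv := by gcongr
      _ ≤ β₂ * (gu + ju) * (gv + jv) + (d * β₁ * (gu + ju) * (gv + jv)
          + β₁ * (gu + ju) * (gv + jv)) + β₀ * (gu + ju) * (gv + jv) := by
        gcongr <;> linarith
      _ = _ := by ring

end Memory

/-! ### A priori bounds for the initial projection and the first step; two uniqueness criteria. -/

section AbstractBounds

variable {V H H' : Type*} [AddCommGroup V] [Module ℝ V] [NormedAddCommGroup H]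
  [InnerProductSpace ℝ H] [NormedAddCommGroup H'] [InnerProductSpace ℝ H']
  {m₀ L Mb : ℝ} {A : FormFamily H m₀ L Mb} {J : V →ₗ[ℝ] H'} {G : V →ₗ[ℝ] H}

/-- Céa's lemma. -/
theorem norm_sub_le_of_orthogonal (hm : 0 < m₀) {s Ms : ℝ} (hs : 0 ≤ s) (hMs : Mb + L * s ≤ Ms)
    (hMs0 : 0 ≤ Ms) {g : H} {u : V} (hu : ∀ v, A.form s (g - G u) (G v) = 0) (v : V) :
    ‖g - G u‖ ≤ Ms * ‖g - G v‖ / m₀ := by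
  refine le_of_mul_sq_le hm (by positivity) ?_
  have h1 := A.lower s (g - G u) hs
  have h2 : A.form s (g - G u) (g - G u) = A.form s (g - G u) (g - G v) := by
    have h3 := hu (v - u)
    have h4 : g - G u = (g - G v) + G (v - u) := by rw [map_sub]; abel
    nth_rw 2 [h4]
    rw [map_add, h3, add_zero]
  have h3 := le_of_abs_le (A.upper s (g - G u) (g - G v) hs)
  have h4 : (Mb + L * s) * (‖g - G u‖ * ‖g - G v‖) ≤ Ms * (‖g - G u‖ * ‖g - G v‖) := by gcongr
  linarith

/-- Test the orthogonality with `u` itself. This crude stability bound holds on every mesh, also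
where nothing is known about approximation. -/
theorem norm_le_of_orthogonal (hm : 0 < m₀) {s Ms : ℝ} (hs : 0 ≤ s) (hMs : Mb + L * s ≤ Ms)
    (hMs0 : 0 ≤ Ms) {g : H} {u : V} (hu : ∀ v, A.form s (g - G u) (G v) = 0) :
    ‖G u‖ ≤ Ms * ‖g‖ / m₀ := by
  refine le_of_mul_sq_le hm (by positivity) ?_
  have h1 := A.lower s (G u) hs
  have h2 := hu u
  rw [map_sub, LinearMap.sub_apply, sub_eq_zero] at h2
  have h3 := le_of_abs_le (A.upper s g (G u) hs)
  have h4 : (Mb + L * s) * (‖g‖ * ‖G u‖) ≤ Ms * (‖g‖ * ‖G u‖) := by gcongr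
  linarith

/-- A bootstrap. The energy estimate gives a rough bound `S` for `‖G u‖²`, independent of `c`, which
fixes the size `Mt` of the coefficient. With `Mt` known, the estimate of the increment `u - u₀` is
closed by taking `c` large. -/
theorem norm_le_of_firstEq_regular (hm : 0 < m₀) (hL : 0 ≤ L) (hMb : 0 ≤ Mb)
    {c K η S Mt β β₁ F C ε : ℝ} {u₀ u : V} {l : V →ₗ[ℝ] ℝ} {Φ : H} (hK : 0 ≤ K) (hη : 0 < η)
    (hη1 : η ≤ 1) (hLη : 2 * L * (K + 2 * η) ^ 2 < m₀) (hu₀ : ‖G u₀‖ ≤ K + η) (hc : 1 ≤ c)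
    (hu : FirstEq A J G c u₀ l u) (hβ : 0 ≤ β) (hββ : β ≤ β₁)
    (hl : ∀ v, |l v| ≤ β * ‖G v‖ + F * ‖J v‖)
    (hS : 2 / m₀ * (Mb * (K + 1) ^ 2 + F ^ 2 / 2 + β₁ ^ 2 / m₀) ≤ S) (hMt : Mb + L * S ≤ Mt)
    (hC : ∀ s, 0 ≤ s → s ≤ S → ∀ v, |A.form s Φ (G v)| ≤ C * ‖J v‖)
    (hΦ : ‖G u₀ - Φ‖ ≤ ε) (hsmall : β + Mt * ε ≤ m₀ * η / 2)
    (hcC : (F + C) ^ 2 ≤ c * (m₀ * η ^ 2)) : ‖G u‖ ≤ K + 2 * η := by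
  have hc0 : 0 < c := by linarith
  have hs : 0 ≤ ‖G u‖ ^ 2 := sq_nonneg _
  have hsS : ‖G u‖ ^ 2 ≤ S := by
    refine le_trans ?_ hS
    have h1 := energy_firstEq hm hc0 hu hl
    have h2 : ‖G u₀‖ ^ 2 ≤ (K + η) ^ 2 := by gcongr
    have h3 : (K + η) ^ 2 ≤ (K + 1) ^ 2 := by gcongr
    -- The coefficient grows linearly in `‖G u‖²`; by this inequality the growth takes up at most
    -- half of the ellipticity. The factor `2 / m₀` in `S` comes from here.
    have h4 : L * (K + η) ^ 2 ≤ m₀ / 2 := by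
      have : (K + η) ^ 2 ≤ (K + 2 * η) ^ 2 := by gcongr; linarith
      nlinarith
    have h5 : F ^ 2 / (2 * c) ≤ F ^ 2 / 2 := by gcongr; linarith
    have h6 : β ^ 2 / m₀ ≤ β₁ ^ 2 / m₀ := by gcongr
    have h7 : (Mb + L * ‖G u‖ ^ 2) * ‖G u₀‖ ^ 2
        ≤ Mb * (K + 1) ^ 2 + m₀ / 2 * ‖G u‖ ^ 2 := by
      calc (Mb + L * ‖G u‖ ^ 2) * ‖G u₀‖ ^ 2 ≤ (Mb + L * ‖G u‖ ^ 2) * (K + η) ^ 2 := by gcongr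
        _ = Mb * (K + η) ^ 2 + L * (K + η) ^ 2 * ‖G u‖ ^ 2 := by ring
        _ ≤ _ := by gcongr
    rw [div_mul_eq_mul_div, le_div_iff₀ hm]
    linarith
  have hS0 : 0 ≤ S := hs.trans hsS
  have hMt' : Mb + L * ‖G u‖ ^ 2 ≤ Mt := le_trans (by gcongr) hMt
  have h1 := increment_firstEq hu hl hΦ (hC _ hs hsS) hMt' (le_trans (by positivity) hMt')
  -- Completing the square leaves `(F + C)² / (4c)`, which is small because `c` is large.
  have h2 : (F + C) * ‖J (u - u₀)‖ ≤ c * ‖J (u - u₀)‖ ^ 2 + m₀ * η ^ 2 / 4 := by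
    have h3 : 0 ≤ (2 * c * ‖J (u - u₀)‖ - (F + C)) ^ 2 := sq_nonneg _
    by_contra! h4
    have h5 := mul_lt_mul_of_pos_left h4 hc0
    nlinarith
  have h3 : (β + Mt * ε) * ‖G (u - u₀)‖ ≤ m₀ * η / 2 * ‖G (u - u₀)‖ := by gcongr
  -- The number `y = ‖G (u - u₀)‖` satisfies `y² ≤ ηy/2 + η²/4`, which fails for `y > η`.
  have h4 : ‖G (u - u₀)‖ ≤ η := by
    by_contra! h4
    have h5 : m₀ * ‖G (u - u₀)‖ ^ 2 ≤ m₀ * η / 2 * ‖G (u - u₀)‖ + m₀ * η ^ 2 / 4 := by linarith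
    have h6 := mul_pos hm hη
    nlinarith [mul_pos h6 (sub_pos.2 h4), mul_pos hm (mul_pos (sub_pos.2 h4) (sub_pos.2 h4))]
  have h5 : G u = G u₀ + G (u - u₀) := by rw [map_sub]; abel
  rw [h5]
  exact (norm_add_le _ _).trans (by linarith)

/-- The criterion for fine meshes: ellipticity absorbs the defect. -/
theorem firstEq_unique_of_small (hL : 0 ≤ L) (hG : Function.Injective G) {c R : ℝ} (hc : 0 ≤ c)
    {u₀ u v : V} {l : V →ₗ[ℝ] ℝ} (hu : FirstEq A J G c u₀ l u) (hv : FirstEq A J G c u₀ l v)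
    (huR : ‖G u‖ ≤ R) (hvR : ‖G v‖ ≤ R) (hR : 2 * L * R ^ 2 < m₀) : u = v := by
  have h1 := norm_eq_of_firstEq hL hu hv huR hvR
  have h2 : 0 ≤ c * ‖J (u - v)‖ ^ 2 := by positivity
  have h3 : ‖G (u - v)‖ = 0 := by
    by_contra h3
    have h4 : 0 < ‖G (u - v)‖ ^ 2 := by positivity
    nlinarith
  rw [norm_eq_zero] at h3
  exact sub_eq_zero.1 (hG (by rw [h3, map_zero]))

/-- The criterion for coarse meshes: the inverse inequality turns the defect into a multiple of `‖J
(u - v)‖²`, absorbed by `c`, however large `R` may be. -/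
theorem firstEq_unique_of_inverse (hm : 0 ≤ m₀) (hL : 0 ≤ L) (hJ : Function.Injective J)
    {c R I : ℝ} {u₀ u v : V} {l : V →ₗ[ℝ] ℝ} (hu : FirstEq A J G c u₀ l u)
    (hv : FirstEq A J G c u₀ l v) (huR : ‖G u‖ ≤ R) (hvR : ‖G v‖ ≤ R)
    (hinv : ∀ v, ‖G v‖ ≤ I * ‖J v‖) (hc : 2 * L * R ^ 2 * I ^ 2 < c) : u = v := by
  have h1 := norm_eq_of_firstEq hL hu hv huR hvR
  have h2 : 0 ≤ m₀ * ‖G (u - v)‖ ^ 2 := by positivity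
  have h3 : ‖J (u - v)‖ = 0 := by
    by_contra h3
    have h4 : 0 < ‖J (u - v)‖ ^ 2 := by positivity
    have h5 : ‖G (u - v)‖ ^ 2 ≤ I ^ 2 * ‖J (u - v)‖ ^ 2 := by
      rw [← mul_pow]
      gcongr
      exact hinv _
    have h6 : 2 * L * R ^ 2 * ‖G (u - v)‖ ^ 2 ≤ 2 * L * R ^ 2 * (I ^ 2 * ‖J (u - v)‖ ^ 2) := by
      gcongr
    nlinarith
  rw [norm_eq_zero] at h3
  exact sub_eq_zero.1 (hJ (by rw [h3, map_zero]))

end AbstractBounds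

/-! ### The diffusion coefficient -/

section Coefficient

variable {d : ℕ} {D : Data d} {m₀ L : ℝ}

theorem lipschitz_const_nonneg (hD : D.Standing) (h2 : D.H2 m₀ L) (hne : D.Ω.Nonempty) :
    0 ≤ L := by
  obtain ⟨x, hx⟩ := hne
  have hx' := subset_closure hx
  have h0 : (0 : ℝ) ∈ Icc 0 D.T := ⟨le_rfl, hD.T_pos.le⟩
  have := h2.lipschitz x hx' x hx' 0 h0 0 h0 0 (by simp) 1 (by simp)
  simp only [sub_self, norm_zero, abs_zero, zero_sub, abs_neg, abs_one, zero_add, mul_one] at this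
  exact (abs_nonneg _).trans this

theorem exists_M_bound (hD : D.Standing) (h2 : D.H2 m₀ L) (hne : D.Ω.Nonempty) :
    ∃ Mb : ℝ, 0 ≤ Mb ∧ ∀ x ∈ D.Ω, ∀ t ∈ Icc 0 D.T, ∀ s, 0 ≤ s → |D.M x t s| ≤ Mb + L * s := by
  have hL := lipschitz_const_nonneg hD h2 hne
  obtain ⟨y, hy⟩ := hne
  have h0 : (0 : ℝ) ∈ Icc 0 D.T := ⟨le_rfl, hD.T_pos.le⟩
  obtain ⟨ρ, hρ0, hρ⟩ := hD.bounded.exists_pos_norm_le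
  have hT := hD.T_pos
  refine ⟨|D.M y 0 0| + L * (2 * ρ + D.T), by positivity, fun x hx t ht s hs => ?_⟩
  have h3 := h2.lipschitz x (subset_closure hx) y (subset_closure hy) t ht 0 h0 s hs 0 (by simp)
  rw [sub_zero, sub_zero, abs_of_nonneg ht.1, abs_of_nonneg hs] at h3
  have h4 : ‖x - y‖ ≤ 2 * ρ := (norm_sub_le _ _).trans (by linarith [hρ x hx, hρ y hy])
  have h5 : L * (‖x - y‖ + t + s) ≤ L * (2 * ρ + D.T + s) := by gcongr; exact ht.2
  have h6 := abs_sub_abs_le_abs_sub (D.M x t s) (D.M y 0 0)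
  linarith

theorem abs_M_sub_le (h2 : D.H2 m₀ L) {t s : ℝ} (ht : t ∈ Icc 0 D.T) (hs : 0 ≤ s) {x y : E d}
    (hx : x ∈ closure D.Ω) (hy : y ∈ closure D.Ω) : |D.M x t s - D.M y t s| ≤ L * ‖x - y‖ := by
  simpa using h2.lipschitz x hx y hy t ht t ht s hs s hs

theorem continuousOn_M (h2 : D.H2 m₀ L) (hL : 0 ≤ L) {t s : ℝ} (ht : t ∈ Icc 0 D.T)
    (hs : 0 ≤ s) : ContinuousOn (fun x => D.M x t s) (closure D.Ω) :=
  (LipschitzOnWith.of_dist_le_mul (K := ⟨L, hL⟩) fun x hx y hy => by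
    rw [Real.dist_eq, dist_eq_norm]
    exact abs_M_sub_le h2 ht hs hx hy).continuousOn

/-- The forms `(M(·,t,s) F, G)`, `s ≥ 0`. -/
def dataForm (hD : D.Standing) (h2 : D.H2 m₀ L) (hL : 0 ≤ L) {Mb : ℝ}
    (hMb : ∀ x ∈ D.Ω, ∀ t ∈ Icc 0 D.T, ∀ s, 0 ≤ s → |D.M x t s| ≤ Mb + L * s)
    (hMb0 : 0 ≤ Mb) {t : ℝ} (ht : t ∈ Icc 0 D.T) : FormFamily (L2V D.Ω) m₀ L Mb where
  -- Nothing is assumed on `M` for negative `s`; the truncation gives a form for every real `s`.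
  form s := l2wForm hD.isOpen hD.bounded (fun x => D.M x t (max s 0))
    (continuousOn_M h2 hL ht (le_max_right s 0))
  symm s F F' := l2w_symm _ _ _
  lower s F hs := le_l2w hD.isOpen hD.bounded (continuousOn_M h2 hL ht (le_max_right s 0))
    (fun x hx => h2.lower x (subset_closure hx) t ht _ (le_max_right s 0)) F
  upper s F F' hs := by
    refine abs_l2w_le hD.isOpen (fun x hx => ?_) (by positivity) F F'
    rw [max_eq_left hs]
    exact hMb x hx t ht s hs
  lip s s' F F' hs hs' := by
    rw [l2wForm_apply, l2wForm_apply, l2w_sub_coeff hD.isOpen hD.bounded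
      (continuousOn_M h2 hL ht (le_max_right s 0)) (continuousOn_M h2 hL ht (le_max_right s' 0))]
    refine abs_l2w_le hD.isOpen (fun x hx => ?_) (by positivity) F F'
    rw [max_eq_left hs, max_eq_left hs']
    have hx' := subset_closure hx
    simpa using h2.lipschitz x hx' x hx' t ht t ht s hs s' hs'

variable (hD : D.Standing) (h2 : D.H2 m₀ L) (hL : 0 ≤ L) {Mb : ℝ}
  (hMb : ∀ x ∈ D.Ω, ∀ t ∈ Icc 0 D.T, ∀ s, 0 ≤ s → |D.M x t s| ≤ Mb + L * s) (hMb0 : 0 ≤ Mb)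

theorem dataForm_apply {t : ℝ} (ht : t ∈ Icc 0 D.T) {s : ℝ} (hs : 0 ≤ s) (F G : L2V D.Ω) :
    (dataForm hD h2 hL hMb hMb0 ht).form s F G = l2w D.Ω (fun x => D.M x t s) F G := by
  show l2w D.Ω (fun x => D.M x t (max s 0)) F G = _
  rw [max_eq_left hs]

theorem diffusion_eq {γ κ h : ℝ} {𝒯 : Geometry.SimplicialComplex ℝ (E d)}
    (h𝒯 : IsTriangulation D.Ω γ κ h 𝒯) {t : ℝ} (ht : t ∈ Icc 0 D.T) (z w v : Xh D.Ω 𝒯) :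
    diffusion D t z w v = (dataForm hD h2 hL hMb hMb0 ht).form
      (‖gradLp hD.bounded h𝒯 z‖ ^ 2) (gradLp hD.bounded h𝒯 w) (gradLp hD.bounded h𝒯 v) := by
  rw [dataForm_apply hD h2 hL hMb hMb0 ht (sq_nonneg _), norm_gradLp_sq, diffusion]
  exact l2w_eq_l2w_toLp _ (Xh.memLp_gradient hD.bounded h𝒯 w)
    (Xh.memLp_gradient hD.bounded h𝒯 v)

theorem isInitial_iff {γ κ h : ℝ} {𝒯 : Geometry.SimplicialComplex ℝ (E d)}
    (h𝒯 : IsTriangulation D.Ω γ κ h 𝒯) (hg : MemLp D.Du₀ 2 (volume.restrict D.Ω))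
    (h0 : (0 : ℝ) ∈ Icc 0 D.T) (w : Xh D.Ω 𝒯) :
    IsInitial D w ↔ ∀ v : Xh D.Ω 𝒯, (dataForm hD h2 hL hMb hMb0 h0).form (‖hg.toLp D.Du₀‖ ^ 2)
      (hg.toLp D.Du₀ - gradLp hD.bounded h𝒯 w) (gradLp hD.bounded h𝒯 v) = 0 := by
  refine forall_congr' fun v => ?_
  rw [dataForm_apply hD h2 hL hMb hMb0 h0 (sq_nonneg _), ← normSq_eq_norm_toLp hg]
  have hw := Xh.memLp_gradient hD.bounded h𝒯 w
  have h1 := l2w_eq_l2w_toLp (fun x => D.M x 0 (normSq D.Ω D.Du₀)) (hg.sub hw)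
    (Xh.memLp_gradient hD.bounded h𝒯 v)
  rw [MemLp.toLp_sub hg hw] at h1
  exact Eq.congr_left h1

end Coefficient

/-! ### Mesh-independent uniqueness in the first step. -/

section Uniqueness

variable {d : ℕ}

theorem IsTest.memLp_gradient {Ω : Set (E d)} (hb : Bornology.IsBounded Ω) {φ : E d → ℝ}
    (hφ : IsTest Ω φ) : MemLp (gradient φ) 2 (volume.restrict Ω) := by
  obtain ⟨C, hC⟩ : ∃ C : NNReal, LipschitzWith C φ :=
    hφ.1.lipschitzWith_of_hasCompactSupport hφ.2.1 (by simp)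
  exact KirchhoffFEM.memLp_gradient hb hC

theorem MemH10.exists_isTest {Ω : Set (E d)} (hb : Bornology.IsBounded Ω) {u : E d → ℝ}
    {g : E d → E d} (hu : MemH10 Ω u g) {ε : ℝ} (hε : 0 < ε) :
    ∃ (φ : E d → ℝ) (hφ : IsTest Ω φ),
      ‖hu.2.1.toLp g - (hφ.memLp_gradient hb).toLp (gradient φ)‖ ≤ ε := by
  obtain ⟨-, hg, φ, hφ, -, hlim⟩ := hu
  obtain ⟨n, hn⟩ := (hlim.eventually (gt_mem_nhds (ENNReal.ofReal_pos.2 hε))).exists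
  refine ⟨φ n, hφ n, ?_⟩
  rw [← MemLp.toLp_sub, Lp.norm_toLp]
  exact ENNReal.toReal_le_of_le_ofReal hε.le hn.le

theorem exists_norm_toLp_gradient_sub_le {Ω : Set (E d)} (hd : 1 ≤ d) (hΩ : IsOpen Ω)
    (hb : Bornology.IsBounded Ω) {γ κ : ℝ} (hγ : 0 < γ) (hκ : 0 ≤ κ) {φ : E d → ℝ}
    (hφ : IsTest Ω φ) {ε : ℝ} (hε : 0 < ε) :
    ∃ h₁ : ℝ, 0 < h₁ ∧ ∀ (h : ℝ) (𝒯 : Geometry.SimplicialComplex ℝ (E d)), 0 < h → h < h₁ →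
      ∀ h𝒯 : IsTriangulation Ω γ κ h 𝒯, ∃ v : Xh Ω 𝒯,
        ‖(hφ.memLp_gradient hb).toLp (gradient φ) - gradLp hb h𝒯 v‖ ≤ ε := by
  have := isFiniteMeasure_restrict hb
  obtain ⟨C, h₀, hC, hh₀, hI⟩ := exists_interpolant hd hb hΩ hγ hκ hφ
  have hone : MemLp (fun _ : E d => (1 : ℝ)) 2 (volume.restrict Ω) := memLp_const 1
  obtain ⟨q, hq⟩ : ∃ q, q = ‖hone.toLp _‖ := ⟨_, rfl⟩
  have hq0 : 0 ≤ q := hq ▸ norm_nonneg _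
  refine ⟨min h₀ (ε / (C * q + 1)), by positivity, fun h 𝒯 hh hlt h𝒯 => ?_⟩
  obtain ⟨v, hv⟩ := hI h 𝒯 hh (hlt.trans_le (min_le_left _ _)) h𝒯
  refine ⟨v, ?_⟩
  have hvm := Xh.memLp_gradient hb h𝒯 v
  have hφm := hφ.memLp_gradient hb
  have h1 := norm_toLp_le_of_ae_le (C := C * h) (hφm.sub hvm) hone (by
    filter_upwards [ae_restrict_of_ae hv] with x hx
    simpa using hx)
  rw [MemLp.toLp_sub hφm hvm, ← hq] at h1
  have h2 := hlt.trans_le (min_le_right _ _)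
  rw [lt_div_iff₀ (by positivity)] at h2
  calc _ ≤ C * h * q := h1
    _ ≤ ε := by nlinarith

variable {D : Data d} {m₀ L Mb : ℝ}

set_option maxHeartbeats 800000 in
/-- Uniqueness in the first time step when `c ≈ k^{-α}` is large, uniformly in the mesh. -/
theorem exists_firstEq_threshold (hd : 1 ≤ d) (hD : D.Standing) (h1 : D.H1) (h2 : D.H2 m₀ L)
    (hL : 0 ≤ L) (hMb : ∀ x ∈ D.Ω, ∀ t ∈ Icc 0 D.T, ∀ s, 0 ≤ s → |D.M x t s| ≤ Mb + L * s)
    (hMb0 : 0 ≤ Mb) {γ κ : ℝ} (hγ : 0 < γ) (hκ : 0 ≤ κ) {B : ℝ} (hB : 0 ≤ B) :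
    ∃ c₀ k₁ : ℝ, 0 < k₁ ∧ 1 ≤ c₀ ∧
      ∀ (h : ℝ) (𝒯 : Geometry.SimplicialComplex ℝ (E d)), 0 < h →
      ∀ (h𝒯 : IsTriangulation D.Ω γ κ h 𝒯) (t : ℝ) (ht : t ∈ Icc 0 D.T) (k c : ℝ), 0 ≤ k →
        k ≤ 1 → k < k₁ → c₀ ≤ c → ∀ u₀ : Xh D.Ω 𝒯, IsInitial D u₀ →
      ∀ l : Xh D.Ω 𝒯 →ₗ[ℝ] ℝ, (∀ v, |l v| ≤ k * (B * ‖gradLp hD.bounded h𝒯 u₀‖)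
          * ‖gradLp hD.bounded h𝒯 v‖ + D.fNorm * ‖valLp hD.bounded v‖) →
      ∀ u u' : Xh D.Ω 𝒯, FirstEq (dataForm hD h2 hL hMb hMb0 ht) (valLp hD.bounded)
          (gradLp hD.bounded h𝒯) c u₀ l u →
        FirstEq (dataForm hD h2 hL hMb hMb0 ht) (valLp hD.bounded)
          (gradLp hD.bounded h𝒯) c u₀ l u' → u = u' := by
  have hb := hD.bounded
  have hm := h2.m₀_pos
  have h0T : (0 : ℝ) ∈ Icc 0 D.T := ⟨le_rfl, hD.T_pos.le⟩
  have hg := h1.memH10.2.1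
  have hF0 : 0 ≤ D.fNorm := ENNReal.toReal_nonneg
  have hgK : ‖hg.toLp D.Du₀‖ ≤ D.K := by
    have : √(normSq D.Ω D.Du₀) = ‖hg.toLp D.Du₀‖ := by
      rw [normSq_eq_norm_toLp hg, Real.sqrt_sq (norm_nonneg _)]
    rw [Data.K, this]
    linarith
  have hsmall := h2.small
  obtain ⟨K, hK⟩ : ∃ K, K = D.K := ⟨_, rfl⟩
  obtain ⟨F, hF⟩ : ∃ F, F = D.fNorm := ⟨_, rfl⟩
  rw [← hK] at hgK hsmall
  rw [← hF] at hF0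
  have hK0 : 0 ≤ K := (norm_nonneg _).trans hgK
  -- By (H2), `2LK² < m₀` strictly, so `K` may be enlarged a little: one `η` for the discrete
  -- initial value, another for the increment.
  obtain ⟨η, hη, hη1, hLη⟩ : ∃ η : ℝ, 0 < η ∧ η ≤ 1 ∧ 2 * L * (K + 2 * η) ^ 2 < m₀ := by
    have hcont : Continuous fun η : ℝ => 2 * L * (K + 2 * η) ^ 2 := by fun_prop
    have h3 : (fun η : ℝ => 2 * L * (K + 2 * η) ^ 2) 0 < m₀ := by
      simp only [mul_zero, add_zero]
      nlinarith [mul_nonneg hL (sq_nonneg K)]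
    have h4 := (hcont.tendsto 0).eventually (gt_mem_nhds h3)
    obtain ⟨δ, hδ, h5⟩ := Metric.eventually_nhds_iff.1 h4
    refine ⟨min 1 (δ / 2), by positivity, min_le_left _ _, h5 ?_⟩
    rw [dist_zero_right, Real.norm_of_nonneg (by positivity)]
    exact (min_le_right _ _).trans_lt (by linarith)
  obtain ⟨A0, hA0⟩ : ∃ A0, A0 = Mb + L * K ^ 2 := ⟨_, rfl⟩
  have hA00 : 0 ≤ A0 := by rw [hA0]; positivity
  have hA0s : Mb + L * ‖hg.toLp D.Du₀‖ ^ 2 ≤ A0 := by rw [hA0]; gcongr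
  obtain ⟨K1, hK1⟩ : ∃ K1, K1 = A0 * K / m₀ := ⟨_, rfl⟩
  have hK10 : 0 ≤ K1 := by rw [hK1]; positivity
  obtain ⟨S, hS⟩ : ∃ S, S = 2 / m₀ * (Mb * (K + 1) ^ 2 + F ^ 2 / 2 + (B * K1) ^ 2 / m₀) :=
    ⟨_, rfl⟩
  have hS0 : 0 ≤ S := by rw [hS]; positivity
  obtain ⟨Mt, hMt⟩ : ∃ Mt, Mt = Mb + L * S := ⟨_, rfl⟩
  have hMt0 : 0 ≤ Mt := by rw [hMt]; positivity
  -- Céa's factor `A0 / m₀` times the distance `2ε` from `∇u₀` to the finite element gradients: `ε`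
  -- for the test function and `ε` for its interpolant.
  obtain ⟨q, hq⟩ : ∃ q, q = 2 * A0 / m₀ := ⟨_, rfl⟩
  have hq0 : 0 ≤ q := by rw [hq]; positivity
  obtain ⟨ε, hε, hεη, hεM⟩ : ∃ ε : ℝ, 0 < ε ∧ q * ε ≤ η ∧ Mt * (q * ε + ε) ≤ m₀ * η / 4 := by
    refine ⟨min (η / (q + 1)) (m₀ * η / (4 * (Mt + 1) * (q + 1))), by positivity, ?_, ?_⟩
    · calc _ ≤ q * (η / (q + 1)) := by gcongr; exact min_le_left _ _
        _ ≤ (q + 1) * (η / (q + 1)) := by gcongr; linarith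
        _ = η := by field_simp
    · set ε := min (η / (q + 1)) (m₀ * η / (4 * (Mt + 1) * (q + 1))) with hεd
      have hε0 : 0 ≤ ε := by positivity
      calc Mt * (q * ε + ε) ≤ (Mt + 1) * (q * ε + ε) := by gcongr; linarith
        _ = (Mt + 1) * (q + 1) * ε := by ring
        _ ≤ (Mt + 1) * (q + 1) * (m₀ * η / (4 * (Mt + 1) * (q + 1))) := by
          gcongr; exact min_le_right _ _
        _ = m₀ * η / 4 := by field_simp
  -- The order of choices matters: `ε` fixes `φ`, which fixes both the mesh threshold `h₁` and the
  -- integration by parts constant `C`; then `h₁` fixes the inverse constant `I` and the bound `R`.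
  -- None of them depends on the mesh.
  obtain ⟨φ, hφ, hφε⟩ := h1.memH10.exists_isTest hb hε
  obtain ⟨h₁, hh₁, hint⟩ := exists_norm_toLp_gradient_sub_le hd hD.isOpen hb hγ hκ hφ hε
  obtain ⟨C, hC0, hC⟩ := abs_l2w_gradient_le hb hφ ⟨Mt, hMt0⟩ ⟨L, hL⟩
  obtain ⟨I, hI0, hinv⟩ := exists_norm_gradLp_le (Ω := D.Ω) hb (mul_pos hγ hh₁)
  obtain ⟨ρ, hρ0, hρ⟩ := hb.exists_pos_norm_le
  obtain ⟨R, hR⟩ : ∃ R, R = I * (2 * ρ * K1 + (B * K1 * I + F)) := ⟨_, rfl⟩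
  have hR0 : 0 ≤ R := by rw [hR]; positivity
  -- The first summand of `c₀` serves fine meshes, the second coarse ones, and the third gives `c ≥
  -- 1`. The bound on `k` keeps the memory term below `m₀η/4`, half of the allowed perturbation.
  refine ⟨(F + C) ^ 2 / (m₀ * η ^ 2) + 2 * L * R ^ 2 * I ^ 2 + 1, m₀ * η / (4 * (B * K1 + 1)),
    by positivity, ?_, fun h 𝒯 hh h𝒯 t ht k c hk0 hk1 hk hc u₀ hu₀ l hl u u' hu hu' => ?_⟩
  · have : 0 ≤ (F + C) ^ 2 / (m₀ * η ^ 2) + 2 * L * R ^ 2 * I ^ 2 := by positivity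
    linarith
  have hc1 : (F + C) ^ 2 / (m₀ * η ^ 2) ≤ c := by
    have : 0 ≤ 2 * L * R ^ 2 * I ^ 2 := by positivity
    linarith
  have hc2 : 2 * L * R ^ 2 * I ^ 2 < c := by
    have : 0 ≤ (F + C) ^ 2 / (m₀ * η ^ 2) := by positivity
    linarith
  have hc3 : 1 ≤ c := by
    have h3 : 0 ≤ (F + C) ^ 2 / (m₀ * η ^ 2) := by positivity
    have h4 : 0 ≤ 2 * L * R ^ 2 * I ^ 2 := by positivity
    linarith
  rw [← hF] at hl
  have horth := (isInitial_iff hD h2 hL hMb hMb0 h𝒯 hg h0T u₀).1 hu₀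
  have hu₀K : ‖gradLp hb h𝒯 u₀‖ ≤ K1 := by
    refine (norm_le_of_orthogonal hm (sq_nonneg _) hA0s hA00 horth).trans ?_
    rw [hK1]
    gcongr
  have hl' : ∀ v, |l v| ≤ k * (B * K1) * ‖gradLp hb h𝒯 v‖ + F * ‖valLp hb v‖ := fun v =>
    (hl v).trans (by gcongr)
  have hβ1 : k * (B * K1) ≤ B * K1 := mul_le_of_le_one_left (by positivity) hk1
  have hG := gradLp_injective hd hD.isOpen hb h𝒯
  rcases lt_or_ge h h₁ with hlt | hge
  · obtain ⟨v, hv⟩ := hint h 𝒯 hh hlt h𝒯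
    have e1 : ‖hg.toLp D.Du₀ - gradLp hb h𝒯 v‖ ≤ 2 * ε := by
      refine (norm_sub_le_norm_sub_add_norm_sub _ _ _).trans ((add_le_add hφε hv).trans ?_)
      linarith
    have e2 : ‖hg.toLp D.Du₀ - gradLp hb h𝒯 u₀‖ ≤ q * ε := by
      refine (norm_sub_le_of_orthogonal hm (sq_nonneg _) hA0s hA00 horth v).trans ?_
      calc _ ≤ A0 * (2 * ε) / m₀ := by gcongr
        _ = q * ε := by rw [hq]; ring
    have e3 : ‖gradLp hb h𝒯 u₀‖ ≤ K + η := by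
      have := norm_sub_norm_le (gradLp hb h𝒯 u₀) (hg.toLp D.Du₀)
      rw [norm_sub_rev] at this
      linarith
    have e4 : ‖gradLp hb h𝒯 u₀ - (hφ.memLp_gradient hb).toLp (gradient φ)‖ ≤ q * ε + ε := by
      refine (norm_sub_le_norm_sub_add_norm_sub _ (hg.toLp D.Du₀) _).trans (add_le_add ?_ hφε)
      rw [norm_sub_rev]
      exact e2
    have e5 : ∀ s, 0 ≤ s → s ≤ S → ∀ v : Xh D.Ω 𝒯,
        |(dataForm hD h2 hL hMb hMb0 ht).form s ((hφ.memLp_gradient hb).toLp (gradient φ))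
          (gradLp hb h𝒯 v)| ≤ C * ‖valLp hb v‖ := fun s hs hsS v => by
      rw [dataForm_apply hD h2 hL hMb hMb0 ht hs]
      have := hC (fun x => D.M x t s) (fun x hx => ?_) ?_ γ κ h 𝒯 h𝒯 v
      · rwa [l2w_eq_l2w_toLp _ (hφ.memLp_gradient hb) (Xh.memLp_gradient hb h𝒯 v)] at this
      · refine (hMb x hx t ht s hs).trans ?_
        show _ ≤ Mt
        rw [hMt]
        gcongr
      · refine LipschitzOnWith.of_dist_le_mul fun x hx y hy => ?_
        rw [Real.dist_eq, dist_eq_norm]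
        exact abs_M_sub_le h2 ht hs (subset_closure hx) (subset_closure hy)
    have e6 : k * (B * K1) + Mt * (q * ε + ε) ≤ m₀ * η / 2 := by
      rw [lt_div_iff₀ (by positivity)] at hk
      have : k * (4 * (B * K1 + 1)) = 4 * (k * (B * K1)) + 4 * k := by ring
      linarith
    have e7 : (F + C) ^ 2 ≤ c * (m₀ * η ^ 2) := (div_le_iff₀ (by positivity)).1 hc1
    have hbound : ∀ w, FirstEq (dataForm hD h2 hL hMb hMb0 ht) (valLp hb)
        (gradLp hb h𝒯) c u₀ l w → ‖gradLp hb h𝒯 w‖ ≤ K + 2 * η := fun w hw =>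
      norm_le_of_firstEq_regular hm hL hMb0 hK0 hη hη1 hLη e3 hc3 hw (by positivity) hβ1 hl'
        hS.ge hMt.ge e5 e4 e6 e7
    exact firstEq_unique_of_small hL hG (by linarith) hu hu' (hbound u hu) (hbound u' hu') hLη
  · have hinv' : ∀ v : Xh D.Ω 𝒯, ‖gradLp hb h𝒯 v‖ ≤ I * ‖valLp hb v‖ :=
      hinv γ κ h 𝒯 h𝒯 (by gcongr)
    have hbound : ∀ w, FirstEq (dataForm hD h2 hL hMb hMb0 ht) (valLp hb)
        (gradLp hb h𝒯) c u₀ l w → ‖gradLp hb h𝒯 w‖ ≤ R := fun w hw => by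
      refine (bound_firstEq_of_inverse hm.le hc3 hw (by positivity) hF0 hI0 hl' hinv').trans ?_
      have := norm_valLp_le hd hD.isOpen hb hρ0.le hρ h𝒯 u₀
      rw [hR]
      gcongr
      exact this.trans (by gcongr)
    exact firstEq_unique_of_inverse hm.le hL (valLp_injective hD.isOpen hb) hu hu'
      (hbound u hu) (hbound u' hu') hinv' hc2

end Uniqueness

/-! ### The scheme -/

section Scheme

/-- For `n ≥ 2` put `x = 1 - σ`, `p = x^{1-α}` and `q = (x+1)^{1-α} ≥ p`. As `1/(2-α) ≥ 1/2`, the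
sum `ã₀ + b̃₁` is at least `(p + x(q - p))/2 > 0`. -/
theorem cCoef_zero_pos {α : ℝ} (h0 : 0 < α) (h1 : α < 1) (n : ℕ) : 0 < cCoef α n 0 := by
  have hx : 0 < 1 - α / 2 := by linarith
  have ha : 0 < aCoef α 0 := by
    rw [aCoef, if_pos rfl]
    positivity
  rw [cCoef]
  by_cases hn : n ≤ 1
  · rwa [if_pos hn]
  · rw [if_neg hn, if_pos rfl]
    have e1 : ((1 : ℕ) : ℝ) + 1 - α / 2 = 1 - α / 2 + 1 := by push_cast; ring
    have e2 : ((1 : ℕ) : ℝ) - α / 2 = 1 - α / 2 := by push_cast; ring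
    rw [aCoef, if_pos rfl, bCoef, e1, e2]
    generalize 1 - α / 2 = x at hx
    have e3 : (2 : ℝ) - α = (1 - α) + 1 := by ring
    rw [e3, Real.rpow_add_one hx.ne', Real.rpow_add_one (by linarith : x + 1 ≠ 0)]
    have h2 : x ^ (1 - α) ≤ (x + 1) ^ (1 - α) :=
      Real.rpow_le_rpow hx.le (by linarith) (by linarith)
    have h3 : 0 < x ^ (1 - α) := by positivity
    generalize x ^ (1 - α) = p at *
    generalize (x + 1) ^ (1 - α) = q at *
    have h4 : 1 / 2 * (q * (x + 1) - p * x) ≤ 1 / (1 - α + 1) * (q * (x + 1) - p * x) := by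
      have : 0 ≤ q * (x + 1) - p * x := by nlinarith
      gcongr
      linarith
    nlinarith

variable {d : ℕ} {D : Data d}

theorem caputo_factor_pos (hD : D.Standing) {k : ℝ} (hk : 0 < k) :
    0 < k ^ (-D.α) / Real.Gamma (2 - D.α) := by
  have := Real.Gamma_pos_of_pos (s := 2 - D.α) (by linarith [hD.α_lt_one])
  positivity

theorem mul_mem_Icc (hD : D.Standing) {N j : ℕ} {k : ℝ} (hk : k = D.T / N) (hj : j ≤ N) :
    (j * k) ∈ Icc 0 D.T := by
  have hT := hD.T_pos
  have hj' : (j : ℝ) ≤ N := by exact_mod_cast hj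
  rcases N.eq_zero_or_pos with rfl | hN
  · simp [hk, hT.le]
  have hN' : (0 : ℝ) < N := by exact_mod_cast hN
  rw [hk]
  refine ⟨by positivity, ?_⟩
  rw [mul_div_assoc', div_le_iff₀ hN', mul_comm]
  gcongr

theorem tσ_mem_Icc (hD : D.Standing) {N n : ℕ} {k : ℝ} (hk : k = D.T / N) (hn : 1 ≤ n)
    (hnN : n ≤ N) : tσ D.α k n ∈ Icc 0 D.T := by
  have h1 := mul_mem_Icc hD hk hnN
  have h2 := mul_mem_Icc hD hk ((Nat.sub_le n 1).trans hnN)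
  rw [Nat.cast_sub hn, Nat.cast_one] at h2
  have h3 := hD.α_lt_one
  have h4 := hD.α_pos
  exact (convex_Icc (0 : ℝ) D.T) h1 h2 (show (0 : ℝ) ≤ 1 - D.α / 2 by linarith)
    (show (0 : ℝ) ≤ D.α / 2 by linarith) (by ring)

section Update

variable {V : Type*} [AddCommGroup V] [Module ℝ V]

/-- Separates the unknown from the history; the history part is the same operator with the newest
value set to zero. -/
theorem discreteCaputo_update (α k : ℝ) {n : ℕ} (hn : 1 ≤ n) (U : ℕ → V) (w : V) :
    discreteCaputo α k n (Function.update U n w)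
      = (k ^ (-α) / Real.Gamma (2 - α) * cCoef α n 0) • w
        + discreteCaputo α k n (Function.update U n 0) := by
  have h1 : ∀ j ∈ Finset.Icc 1 n,
      cCoef α n (n - j) • (Function.update U n w j - Function.update U n w (j - 1))
        = (if j = n then cCoef α n 0 • w else 0)
          + cCoef α n (n - j) • (Function.update U n 0 j - Function.update U n 0 (j - 1)) := by
    intro j hj
    rw [Finset.mem_Icc] at hj
    have h2 : j - 1 ≠ n := by omega
    rw [Function.update_of_ne h2, Function.update_of_ne h2]
    rcases eq_or_ne j n with rfl | hjn
    · simp [sub_eq_add_neg]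
    · rw [Function.update_of_ne hjn, Function.update_of_ne hjn, if_neg hjn, zero_add]
  rw [discreteCaputo, Finset.sum_congr rfl h1, Finset.sum_add_distrib, smul_add,
    Finset.sum_ite_eq', if_pos (Finset.mem_Icc.2 ⟨hn, le_rfl⟩), smul_smul, discreteCaputo]

theorem uHat_update (α : ℝ) {n : ℕ} (hn : 1 ≤ n) (U : ℕ → V) (w : V) :
    uHat α n (Function.update U n w) = (1 - α / 2) • w + (α / 2) • U (n - 1) := by
  rw [uHat, Function.update_self, Function.update_of_ne (by omega)]

/-- The extrapolation does not see the unknown, which is why the steps `n ≥ 2` are linear. -/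
theorem uBar_update (α : ℝ) {n : ℕ} (hn : 2 ≤ n) (U : ℕ → V) (w : V) :
    uBar α n (Function.update U n w) = uBar α n U := by
  rw [uBar, Function.update_of_ne (by omega), Function.update_of_ne (by omega), uBar]

end Update

variable {𝒯 : Geometry.SimplicialComplex ℝ (E d)} {k : ℝ}

theorem stepResidual_congr {n : ℕ} {U U' : ℕ → Xh D.Ω 𝒯} (h : ∀ j ≤ n, U j = U' j)
    (v : Xh D.Ω 𝒯) : stepResidual D k n U v = stepResidual D k n U' v := by
  have h1 : discreteCaputo D.α k n U = discreteCaputo D.α k n U' := by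
    rw [discreteCaputo, discreteCaputo]
    congr 1
    refine Finset.sum_congr rfl fun j hj => ?_
    rw [Finset.mem_Icc] at hj
    rw [h j hj.2, h (j - 1) (by omega)]
  have h2 : uHat D.α n U = uHat D.α n U' := by
    rw [uHat, uHat, h n le_rfl, h (n - 1) (by omega)]
  have h3 : uBar D.α n U = uBar D.α n U' := by
    rw [uBar, uBar, h (n - 1) (by omega), h (n - 2) (by omega)]
  have h4 : ∑ j ∈ Finset.Icc 1 (n - 1), weight D.α k n j * D.B (tσ D.α k n) (j * k) (U j) v
      = ∑ j ∈ Finset.Icc 1 (n - 1), weight D.α k n j * D.B (tσ D.α k n) (j * k) (U' j) v := by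
    refine Finset.sum_congr rfl fun j hj => ?_
    rw [Finset.mem_Icc] at hj
    rw [h j (by omega)]
  rw [stepResidual, stepResidual, h1, h2, h3, h4]

theorem firstResidual_congr {U U' : ℕ → Xh D.Ω 𝒯} (h : ∀ j ≤ 1, U j = U' j)
    (v : Xh D.Ω 𝒯) : firstResidual D k U v = firstResidual D k U' v := by
  have h1 : discreteCaputo D.α k 1 U = discreteCaputo D.α k 1 U' := by
    rw [discreteCaputo, discreteCaputo]
    congr 1
    refine Finset.sum_congr rfl fun j hj => ?_
    rw [Finset.mem_Icc] at hj
    rw [h j hj.2, h (j - 1) (by omega)]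
  have h2 : uHat D.α 1 U = uHat D.α 1 U' := by
    rw [uHat, uHat, h 1 le_rfl, h (1 - 1) (by omega)]
  rw [firstResidual, firstResidual, h1, h2, h 0 (by omega)]

theorem exists_source_functional (hb : Bornology.IsBounded D.Ω)
    (f : L2S D.Ω) : ∃ l : Xh D.Ω 𝒯 →ₗ[ℝ] ℝ, (∀ v : Xh D.Ω 𝒯, l v = l2 D.Ω f v) ∧
      ∀ v, |l v| ≤ ‖f‖ * ‖valLp hb v‖ := by
  refine ⟨(innerₗ (L2S D.Ω) f).comp (valLp hb), fun v => ?_,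
    fun v => abs_real_inner_le_norm f (valLp hb v)⟩
  have h1 := l2_eq_inner_toLp (Lp.memLp f) (Xh.memLp hb v)
  rw [Lp.toLp_coeFn] at h1
  exact h1.symm

variable {γ κ h m₀ L Mb : ℝ} {N : ℕ}

theorem bilin_smul_add {H : Type*} [AddCommGroup H] [Module ℝ H] (b : H →ₗ[ℝ] H →ₗ[ℝ] ℝ)
    (c : ℝ) (x y z : H) : b (c • x + y) z = c * b x z + b y z := by
  simp

theorem smul_ellForm_apply {V H H' : Type*} [AddCommGroup V] [Module ℝ V] [NormedAddCommGroup H]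
    [InnerProductSpace ℝ H] [NormedAddCommGroup H'] [InnerProductSpace ℝ H'] {m₀ L Mb : ℝ}
    (A : FormFamily H m₀ L Mb) (J : V →ₗ[ℝ] H') (G : V →ₗ[ℝ] H) {a : ℝ} (ha : a ≠ 0) (c s : ℝ)
    (w v : V) : (a • ellForm A J G (c / a) s) w v
      = c * inner ℝ (J w) (J v) + a * A.form s (G w) (G v) := by
  rw [LinearMap.smul_apply, LinearMap.smul_apply, ellForm_apply, smul_eq_mul, mul_add,
    ← mul_assoc, mul_div_cancel₀ _ ha]

theorem exists_sub_comp {V H H' : Type*} [AddCommGroup V] [Module ℝ V] [NormedAddCommGroup H]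
    [InnerProductSpace ℝ H] [NormedAddCommGroup H'] [InnerProductSpace ℝ H']
    (J : V →ₗ[ℝ] H') (G : V →ₗ[ℝ] H) (l₁ l₂ : V →ₗ[ℝ] ℝ) (x : H') (b : H →ₗ[ℝ] ℝ) :
    ∃ l : V →ₗ[ℝ] ℝ, ∀ v, l v = l₁ v + l₂ v - inner ℝ x (J v) - b (G v) :=
  ⟨l₁ + l₂ - (innerₗ H' x).comp J - b.comp G, fun _ => rfl⟩

set_option maxHeartbeats 1000000 in
/-- The time step `n ≥ 2` is a symmetric coercive linear problem. -/
theorem exists_step_form (hd : 1 ≤ d) (hD : D.Standing) (h2 : D.H2 m₀ L) (h3 : D.H3)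
    (hne : D.Ω.Nonempty) (h𝒯 : IsTriangulation D.Ω γ κ h 𝒯) (hN : 1 ≤ N) (hk : k = D.T / N)
    {n : ℕ} (hn : 2 ≤ n) (hnN : n ≤ N) (U : ℕ → Xh D.Ω 𝒯) :
    ∃ (a : Xh D.Ω 𝒯 →ₗ[ℝ] Xh D.Ω 𝒯 →ₗ[ℝ] ℝ) (l : Xh D.Ω 𝒯 →ₗ[ℝ] ℝ),
      (∀ u v, a u v = a v u) ∧ (∀ v, v ≠ 0 → 0 < a v v) ∧
        ∀ w v, stepResidual D k n (Function.update U n w) v = a w v - l v := by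
  have hb := hD.bounded
  have hL := lipschitz_const_nonneg hD h2 hne
  obtain ⟨Mb, hMb0, hMb⟩ := exists_M_bound hD h2 hne
  have hk0 : 0 < k := by
    have := hD.T_pos
    have : (0 : ℝ) < N := by exact_mod_cast hN
    rw [hk]; positivity
  have ht := tσ_mem_Icc hD hk (by omega : 1 ≤ n) hnN
  obtain ⟨C, -, hB⟩ := exists_B_linear hD h3
  have hBl : ∀ j : ℕ, ∃ l : Xh D.Ω 𝒯 →ₗ[ℝ] ℝ, j ∈ Finset.Icc 1 (n - 1) → ∀ v : Xh D.Ω 𝒯,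
      l v = D.B (tσ D.α k n) (j * k) (U j) v := fun j => by
    by_cases hj : j ∈ Finset.Icc 1 (n - 1)
    · have hj' := Finset.mem_Icc.1 hj
      obtain ⟨l, hl, -⟩ := hB _ ht _ (mul_mem_Icc hD hk (by omega : j ≤ N)) γ κ h 𝒯 h𝒯 (U j)
      exact ⟨l, fun _ => hl⟩
    · exact ⟨0, fun h => absurd h hj⟩
  choose lB hlB using hBl
  obtain ⟨lf, hlf, -⟩ := exists_source_functional (𝒯 := 𝒯) hb
    (D.f (tσ D.α k n))
  obtain ⟨J, hJ⟩ : ∃ J : Xh D.Ω 𝒯 →ₗ[ℝ] L2S D.Ω, ∀ u v : Xh D.Ω 𝒯,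
      l2 D.Ω u v = inner ℝ (J u) (J v) := ⟨valLp hb, fun u v => (inner_valLp hb u v).symm⟩
  obtain ⟨A, G, hGi, hAG⟩ : ∃ (A : FormFamily (L2V D.Ω) m₀ L Mb) (G : Xh D.Ω 𝒯 →ₗ[ℝ] L2V D.Ω),
      Function.Injective G ∧ ∀ z w v, diffusion D (tσ D.α k n) z w v
        = A.form (‖G z‖ ^ 2) (G w) (G v) :=
    ⟨dataForm hD h2 hL hMb hMb0 ht, gradLp hb h𝒯, gradLp_injective hd hD.isOpen hb h𝒯,
      diffusion_eq hD h2 hL hMb hMb0 h𝒯 ht⟩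
  obtain ⟨s, hs⟩ : ∃ s, s = ‖G (uBar D.α n U)‖ ^ 2 := ⟨_, rfl⟩
  have hs0 : 0 ≤ s := hs ▸ sq_nonneg _
  obtain ⟨c, hc⟩ : ∃ c, c = k ^ (-D.α) / Real.Gamma (2 - D.α) * cCoef D.α n 0 := ⟨_, rfl⟩
  have hc0 : 0 < c := hc ▸ mul_pos (caputo_factor_pos hD hk0)
    (cCoef_zero_pos hD.α_pos hD.α_lt_one n)
  have hσ : 0 < 1 - D.α / 2 := by linarith [hD.α_lt_one]
  obtain ⟨l, hl⟩ := exists_sub_comp J G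
    (∑ j ∈ Finset.Icc 1 (n - 1), weight D.α k n j • lB j) lf
    (J (discreteCaputo D.α k n (Function.update U n 0)))
    (A.form s ((D.α / 2) • G (U (n - 1))))
  -- The factor `1 - σ` is the share of `u^n` in `û^{n,σ}`. It multiplies the diffusion only, hence
  -- the division inside.
  refine ⟨(1 - D.α / 2) • ellForm A J G (c / (1 - D.α / 2)) s, l, fun u v => ?_, fun v hv => ?_,
    fun w v => ?_⟩
  · rw [smul_ellForm_apply A J G hσ.ne', smul_ellForm_apply A J G hσ.ne', A.symm,
      real_inner_comm]
  · exact mul_pos hσ (ellForm_pos A J G h2.m₀_pos hGi (by positivity) hs0 hv)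
  · have e1 : l2 D.Ω (discreteCaputo D.α k n (Function.update U n w) : Xh D.Ω 𝒯) v
        = c * inner ℝ (J w) (J v)
          + inner ℝ (J (discreteCaputo D.α k n (Function.update U n 0))) (J v) := by
      rw [hJ, discreteCaputo_update _ _ (by omega), map_add, map_smul,
        inner_add_left, real_inner_smul_left, hc]
    have e2 : diffusion D (tσ D.α k n) (uBar D.α n (Function.update U n w))
        (uHat D.α n (Function.update U n w)) v
        = (1 - D.α / 2) * A.form s (G w) (G v) + A.form s ((D.α / 2) • G (U (n - 1))) (G v) := by
      rw [hAG, uBar_update _ hn, ← hs, uHat_update _ (by omega), G.map_add, G.map_smul,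
        G.map_smul]
      exact bilin_smul_add _ _ _ _ _
    have e3 : ∑ j ∈ Finset.Icc 1 (n - 1), weight D.α k n j *
        D.B (tσ D.α k n) (j * k) (Function.update U n w j) v
        = (∑ j ∈ Finset.Icc 1 (n - 1), weight D.α k n j • lB j) v := by
      rw [LinearMap.sum_apply]
      refine Finset.sum_congr rfl fun j hj => ?_
      have hj' := Finset.mem_Icc.1 hj
      rw [Function.update_of_ne (by omega), LinearMap.smul_apply, hlB j hj, smul_eq_mul]
    rw [stepResidual, e1, e2, e3, ← hlf, smul_ellForm_apply A J G hσ.ne', hl]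
    ring

theorem isLinearPosDef_of_form {n : ℕ} {U : ℕ → Xh D.Ω 𝒯}
    {a : Xh D.Ω 𝒯 →ₗ[ℝ] Xh D.Ω 𝒯 →ₗ[ℝ] ℝ} {l : Xh D.Ω 𝒯 →ₗ[ℝ] ℝ}
    (hsymm : ∀ u v, a u v = a v u) (hpos : ∀ v, v ≠ 0 → 0 < a v v)
    (hres : ∀ w v, stepResidual D k n (Function.update U n w) v = a w v - l v) :
    IsLinearPosDef D k n U := by
  intro m β
  refine ⟨Matrix.of fun i j => a (β j) (β i), fun i => l (β i),
    Matrix.PosDef.of_dotProduct_mulVec_pos ?_ fun c hc => ?_, fun c i => ?_⟩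
  · ext i j
    simp [hsymm (β i) (β j)]
  · have hw : ∑ j, c j • β j ≠ 0 := fun h0 =>
      hc (funext fun i => Fintype.linearIndependent_iff.1 β.linearIndependent c h0 i)
    have := hpos _ hw
    simp only [map_sum, map_smul, LinearMap.sum_apply, LinearMap.smul_apply, smul_eq_mul] at this
    refine this.trans_eq ?_
    simp only [dotProduct, Matrix.mulVec, Matrix.of_apply, star_trivial, Pi.star_apply]
    refine Finset.sum_congr rfl fun i _ => ?_
    congr 1
    refine Finset.sum_congr rfl fun j _ => ?_
    ring
  · rw [hres]
    simp only [map_sum, map_smul, LinearMap.sum_apply, LinearMap.smul_apply, smul_eq_mul,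
      Matrix.mulVec, dotProduct, Matrix.of_apply]
    congr 1
    exact Finset.sum_congr rfl fun j _ => mul_comm _ _

/-- The coefficient of `û - u⁰` in the first time step. -/
def firstCoeff (α k : ℝ) : ℝ :=
  k ^ (-α) / Real.Gamma (2 - α) * cCoef α 1 0 / (1 - α / 2)

/-- Since `û - u⁰ = (1-σ)(u¹ - u⁰)`, the discrete derivative is a multiple of `û - u⁰`, and the
equation closes in `û` alone. -/
theorem firstResidual_eq_zero_iff (hD : D.Standing) {A : FormFamily (L2V D.Ω) m₀ L Mb}
    {G : Xh D.Ω 𝒯 →ₗ[ℝ] L2V D.Ω} {J : Xh D.Ω 𝒯 →ₗ[ℝ] L2S D.Ω}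
    (hAG : ∀ z w v, diffusion D (tσ D.α k 1) z w v = A.form (‖G z‖ ^ 2) (G w) (G v))
    (hJ : ∀ u v : Xh D.Ω 𝒯, l2 D.Ω u v = inner ℝ (J u) (J v)) (U : ℕ → Xh D.Ω 𝒯)
    (l : Xh D.Ω 𝒯 →ₗ[ℝ] ℝ) (hl : ∀ v : Xh D.Ω 𝒯, l v = (1 - D.α / 2) * k
      * D.B (tσ D.α k 1) 0 (U 0) v + l2 D.Ω (D.f (tσ D.α k 1)) v) :
    (∀ v, firstResidual D k U v = 0) ↔
      FirstEq A J G (firstCoeff D.α k) (U 0) l (uHat D.α 1 U) := by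
  have hσ : 1 - D.α / 2 ≠ 0 := by linarith [hD.α_lt_one]
  have h1 : uHat D.α 1 U - U 0 = (1 - D.α / 2) • (U 1 - U 0) := by
    rw [uHat, Nat.sub_self, smul_sub, sub_smul, sub_smul, one_smul, one_smul]
    abel
  have h4 : discreteCaputo D.α k 1 U
      = (k ^ (-D.α) / Real.Gamma (2 - D.α) * cCoef D.α 1 0) • (U 1 - U 0) := by
    rw [discreteCaputo, Finset.Icc_self, Finset.sum_singleton, Nat.sub_self, smul_smul]
  have h5 : ∀ v, firstCoeff D.α k * inner ℝ (J (uHat D.α 1 U - U 0)) (J v)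
      = l2 D.Ω (discreteCaputo D.α k 1 U : Xh D.Ω 𝒯) v := fun v => by
    rw [hJ, h1, h4, J.map_smul, J.map_smul, real_inner_smul_left, real_inner_smul_left,
      firstCoeff, ← mul_assoc, div_mul_cancel₀ _ hσ]
  refine forall_congr' fun v => ?_
  rw [firstResidual, sub_eq_zero, ← hl, hAG, h5]

theorem exists_initial (hd : 1 ≤ d) (hD : D.Standing) (h1 : D.H1) (h2 : D.H2 m₀ L)
    (hne : D.Ω.Nonempty) (h𝒯 : IsTriangulation D.Ω γ κ h 𝒯) :
    ∃! w : Xh D.Ω 𝒯, IsInitial D w := by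
  have hL := lipschitz_const_nonneg hD h2 hne
  obtain ⟨Mb, hMb0, hMb⟩ := exists_M_bound hD h2 hne
  have h0T : (0 : ℝ) ∈ Icc 0 D.T := ⟨le_rfl, hD.T_pos.le⟩
  have hg := h1.memH10.2.1
  have := Xh.finiteDimensional h𝒯
  set A := dataForm hD h2 hL hMb hMb0 h0T
  set G := gradLp hD.bounded h𝒯
  set s := ‖hg.toLp D.Du₀‖ ^ 2
  -- The projection has no mass term: `c = 0`, and coercivity comes from the gradient and the
  -- Poincaré inequality.
  obtain ⟨w, hw, huniq⟩ := existsUnique_of_coercive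
    (ellForm A (valLp hD.bounded) G 0 s)
    (fun v hv => ellForm_pos A (valLp hD.bounded) G h2.m₀_pos
      (gradLp_injective hd hD.isOpen hD.bounded h𝒯) le_rfl (sq_nonneg _) hv)
    ((A.form s (hg.toLp D.Du₀)).comp G)
  have hiff : ∀ w : Xh D.Ω 𝒯, IsInitial D w ↔ ∀ v, ellForm A (valLp hD.bounded) G 0 s w v
      = ((A.form s (hg.toLp D.Du₀)).comp G) v := fun w => by
    rw [isInitial_iff hD h2 hL hMb hMb0 h𝒯 hg h0T]
    refine forall_congr' fun v => ?_
    rw [ellForm_apply, map_sub, LinearMap.sub_apply, LinearMap.comp_apply, sub_eq_zero]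
    simp only [zero_mul, zero_add]
    exact eq_comm
  exact ⟨w, (hiff w).2 hw, fun w' hw' => huniq w' ((hiff w').1 hw')⟩

end Scheme

/-! ### Assembly: the time step threshold, existence, and uniqueness by induction in time. -/

section Main

variable {d : ℕ} {D : Data d} {𝒯 : Geometry.SimplicialComplex ℝ (E d)} {k : ℝ}
  {γ κ h m₀ L : ℝ} {N : ℕ}

theorem tendsto_firstCoeff {α : ℝ} (h0 : 0 < α) (h1 : α < 1) :
    Tendsto (firstCoeff α) (𝓝[>] 0) atTop := by
  have hΓ := Real.Gamma_pos_of_pos (s := 2 - α) (by linarith)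
  have hc := cCoef_zero_pos h0 h1 1
  have hσ : 0 < 1 - α / 2 := by linarith
  have h2 : Tendsto (fun k : ℝ => k ^ (-α)) (𝓝[>] 0) atTop :=
    tendsto_rpow_neg_nhdsGT_zero (by linarith)
  exact ((h2.atTop_div_const hΓ).atTop_mul_const hc).atTop_div_const hσ

theorem firstCoeff_nonneg (hD : D.Standing) (hk : 0 < k) : 0 ≤ firstCoeff D.α k := by
  have hσ : 0 < 1 - D.α / 2 := by linarith [hD.α_lt_one]
  exact div_nonneg (mul_pos (caputo_factor_pos hD hk)
    (cCoef_zero_pos hD.α_pos hD.α_lt_one 1)).le hσ.le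

theorem step_pos (hD : D.Standing) (hN : 1 ≤ N) (hk : k = D.T / N) : 0 < k := by
  have := hD.T_pos
  have : (0 : ℝ) < N := by exact_mod_cast hN
  rw [hk]
  positivity

/-- The right-hand side of the first time step, as a functional on `X_h`. -/
theorem exists_first_functional (hd : 1 ≤ d) (hD : D.Standing) (h1 : D.H1) (h3 : D.H3) :
    ∃ B : ℝ, 0 ≤ B ∧ ∀ t ∈ Icc 0 D.T, ∀ k, 0 ≤ k →
      ∀ (γ κ h : ℝ) (𝒯 : Geometry.SimplicialComplex ℝ (E d)) (h𝒯 : IsTriangulation D.Ω γ κ h 𝒯)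
        (u : Xh D.Ω 𝒯), ∃ l : Xh D.Ω 𝒯 →ₗ[ℝ] ℝ,
        (∀ v : Xh D.Ω 𝒯, l v = (1 - D.α / 2) * k * D.B t 0 u v + l2 D.Ω (D.f t) v) ∧
        ∀ v, |l v| ≤ k * (B * ‖gradLp hD.bounded h𝒯 u‖) * ‖gradLp hD.bounded h𝒯 v‖
          + D.fNorm * ‖valLp hD.bounded v‖ := by
  obtain ⟨C, hC0, hC⟩ := exists_B_linear hD h3
  obtain ⟨ρ, hρ0, hρ⟩ := hD.bounded.exists_pos_norm_le
  -- Poincaré's inequality, applied to both arguments of the memory form, leaves only gradient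
  -- norms.
  refine ⟨C * (1 + 2 * ρ) ^ 2, by positivity, fun t ht k hk γ κ h 𝒯 h𝒯 u => ?_⟩
  obtain ⟨l, hl, hl'⟩ := hC t ht 0 ⟨le_rfl, hD.T_pos.le⟩ γ κ h 𝒯 h𝒯 u
  obtain ⟨lf, hlf, hlf'⟩ := exists_source_functional (𝒯 := 𝒯) hD.bounded (D.f t)
  have hσ0 : 0 ≤ 1 - D.α / 2 := by linarith [hD.α_lt_one]
  have hσ1 : 1 - D.α / 2 ≤ 1 := by linarith [hD.α_pos]
  refine ⟨((1 - D.α / 2) * k) • l + lf, fun v => ?_, fun v => ?_⟩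
  · rw [LinearMap.add_apply, LinearMap.smul_apply, hl, hlf, smul_eq_mul]
  · have hu := norm_valLp_le hd hD.isOpen hD.bounded hρ0.le hρ h𝒯 u
    have hv := norm_valLp_le hd hD.isOpen hD.bounded hρ0.le hρ h𝒯 v
    have hlv := hl' v
    have hfv := hlf' v
    have hft := h1.f_le t ht
    have hgu := norm_nonneg (gradLp hD.bounded h𝒯 u)
    have hgv := norm_nonneg (gradLp hD.bounded h𝒯 v)
    have hv0 := norm_nonneg (valLp hD.bounded v)
    rw [LinearMap.add_apply, LinearMap.smul_apply, smul_eq_mul]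
    generalize ‖gradLp hD.bounded h𝒯 u‖ = gu at *
    generalize ‖gradLp hD.bounded h𝒯 v‖ = gv at *
    generalize ‖valLp hD.bounded u‖ = xu at *
    generalize ‖valLp hD.bounded v‖ = xv at *
    calc |(1 - D.α / 2) * k * l v + lf v|
        ≤ |(1 - D.α / 2) * k * l v| + |lf v| := abs_add_le _ _
      _ = (1 - D.α / 2) * k * |l v| + |lf v| := by
          rw [abs_mul, abs_of_nonneg (mul_nonneg hσ0 hk)]
      _ ≤ 1 * k * (C * (gu + 2 * ρ * gu) * (gv + 2 * ρ * gv)) + D.fNorm * xv := by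
          gcongr
          · refine hlv.trans ?_
            gcongr
          · exact hfv.trans (by gcongr)
      _ = k * (C * (1 + 2 * ρ) ^ 2 * gu) * gv + D.fNorm * xv := by ring

theorem exists_first_step (hd : 1 ≤ d) (hD : D.Standing) (h1 : D.H1) (h2 : D.H2 m₀ L) (h3 : D.H3)
    (hne : D.Ω.Nonempty) (h𝒯 : IsTriangulation D.Ω γ κ h 𝒯) (hN : 1 ≤ N) (hk : k = D.T / N)
    (U : ℕ → Xh D.Ω 𝒯) :
    ∃ w : Xh D.Ω 𝒯, ∀ v, firstResidual D k (Function.update U 1 w) v = 0 := by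
  have hL := lipschitz_const_nonneg hD h2 hne
  obtain ⟨Mb, hMb0, hMb⟩ := exists_M_bound hD h2 hne
  have hk0 := step_pos hD hN hk
  have ht := tσ_mem_Icc hD hk le_rfl hN
  have hfin := Xh.finiteDimensional h𝒯
  obtain ⟨B, hB0, hB⟩ := exists_first_functional hd hD h1 h3
  obtain ⟨l, hl, hl'⟩ := hB _ ht k hk0.le γ κ h 𝒯 h𝒯 (U 0)
  obtain ⟨ρ, hρ0, hρ⟩ := hD.bounded.exists_pos_norm_le
  have hc := firstCoeff_nonneg hD hk0
  have hf0 : 0 ≤ D.fNorm := ENNReal.toReal_nonneg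
  have hPoinc := norm_valLp_le hd hD.isOpen hD.bounded hρ0.le hρ h𝒯
  have hAG := diffusion_eq hD h2 hL hMb hMb0 h𝒯 ht
  have hGi := gradLp_injective hd hD.isOpen hD.bounded h𝒯
  have hJ : ∀ u v : Xh D.Ω 𝒯, l2 D.Ω u v = inner ℝ (valLp hD.bounded u) (valLp hD.bounded v) :=
    fun u v => (inner_valLp hD.bounded u v).symm
  generalize gradLp hD.bounded h𝒯 = G at *
  generalize dataForm hD h2 hL hMb hMb0 ht = A at *
  generalize (valLp hD.bounded : Xh D.Ω 𝒯 →ₗ[ℝ] L2S D.Ω) = J at *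
  have hσ : 1 - D.α / 2 ≠ 0 := by linarith [hD.α_lt_one]
  obtain ⟨û, hû⟩ := exists_firstEq (A := A) (J := J) h2.m₀_pos hL hGi hc (U 0) l
    (D := k * (B * ‖G (U 0)‖) + (D.fNorm + firstCoeff D.α k * ‖J (U 0)‖) * (2 * ρ))
    (by positivity) fun v => by
      have h4 := hPoinc v
      calc |l v + firstCoeff D.α k * inner ℝ (J (U 0)) (J v)|
          ≤ |l v| + |firstCoeff D.α k * inner ℝ (J (U 0)) (J v)| := abs_add_le _ _
        _ = |l v| + firstCoeff D.α k * |inner ℝ (J (U 0)) (J v)| := by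
            rw [abs_mul, abs_of_nonneg hc]
        _ ≤ (k * (B * ‖G (U 0)‖) * ‖G v‖ + D.fNorm * ‖J v‖)
              + firstCoeff D.α k * (‖J (U 0)‖ * ‖J v‖) := by
            gcongr
            · exact hl' v
            · exact abs_real_inner_le_norm _ _
        _ = k * (B * ‖G (U 0)‖) * ‖G v‖ + (D.fNorm + firstCoeff D.α k * ‖J (U 0)‖) * ‖J v‖ := by
            ring
        _ ≤ k * (B * ‖G (U 0)‖) * ‖G v‖
              + (D.fNorm + firstCoeff D.α k * ‖J (U 0)‖) * (2 * ρ * ‖G v‖) := by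
            gcongr
        _ = _ := by ring
  -- The value `u¹` is recovered from `û = (1-σ)u¹ + σu⁰`.
  refine ⟨(1 - D.α / 2)⁻¹ • (û - (D.α / 2) • U 0), ?_⟩
  have h5 : Function.update U 1 ((1 - D.α / 2)⁻¹ • (û - (D.α / 2) • U 0)) 0 = U 0 :=
    Function.update_of_ne (by omega) _ _
  rw [firstResidual_eq_zero_iff hD hAG hJ _ l (by rw [h5]; exact hl), h5,
    uHat_update _ le_rfl, smul_inv_smul₀ hσ, Nat.sub_self, sub_add_cancel]
  exact hû

/-- For small time steps the first two values of a solution are unique. -/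
theorem exists_threshold (hd : 1 ≤ d) (hD : D.Standing) (h1 : D.H1) (h2 : D.H2 m₀ L) (h3 : D.H3)
    (hne : D.Ω.Nonempty) (hγ : 0 < γ) (hκ : 0 ≤ κ) :
    ∃ k₀ : ℝ, 0 < k₀ ∧ ∀ (h : ℝ) (𝒯 : Geometry.SimplicialComplex ℝ (E d)), 0 < h →
      IsTriangulation D.Ω γ κ h 𝒯 → ∀ (N : ℕ) (k : ℝ), 1 ≤ N → k = D.T / N → k ≤ 1 → k < k₀ →
      ∀ U V : ℕ → Xh D.Ω 𝒯, IsInitial D (U 0) → U 0 = V 0 → (∀ v, firstResidual D k U v = 0) →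
        (∀ v, firstResidual D k V v = 0) → U 1 = V 1 := by
  have hL := lipschitz_const_nonneg hD h2 hne
  obtain ⟨Mb, hMb0, hMb⟩ := exists_M_bound hD h2 hne
  obtain ⟨B, hB0, hB⟩ := exists_first_functional hd hD h1 h3
  obtain ⟨c₀, k₁, hk₁, -, hthr⟩ := exists_firstEq_threshold hd hD h1 h2 hL hMb hMb0 hγ hκ hB0
  obtain ⟨k₂, hk₂, hck⟩ := mem_nhdsGT_iff_exists_Ioo_subset.1
    ((tendsto_firstCoeff hD.α_pos hD.α_lt_one).eventually_ge_atTop c₀)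
  refine ⟨min k₁ k₂, lt_min hk₁ hk₂,
    fun h 𝒯 hh h𝒯 N k hN hk hk1 hkk U V hU hUV hfU hfV => ?_⟩
  have hk0 := step_pos hD hN hk
  have ht := tσ_mem_Icc hD hk le_rfl hN
  obtain ⟨l, hl, hl'⟩ := hB _ ht k hk0.le γ κ h 𝒯 h𝒯 (U 0)
  have hAG := diffusion_eq hD h2 hL hMb hMb0 h𝒯 ht
  have hJ : ∀ u v : Xh D.Ω 𝒯, l2 D.Ω u v = inner ℝ (valLp hD.bounded u) (valLp hD.bounded v) :=
    fun u v => (inner_valLp hD.bounded u v).symm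
  have e1 := (firstResidual_eq_zero_iff hD hAG hJ U l hl).1 hfU
  have e2 := (firstResidual_eq_zero_iff hD hAG hJ V l (by rw [← hUV]; exact hl)).1 hfV
  rw [← hUV] at e2
  have e3 : uHat D.α 1 U = uHat D.α 1 V := hthr h 𝒯 hh h𝒯 _ ht k _ hk0.le hk1
    (hkk.trans_le (min_le_left _ _)) (hck ⟨hk0, hkk.trans_le (min_le_right _ _)⟩) (U 0) hU l hl'
    _ _ e1 e2
  have hσ : 1 - D.α / 2 ≠ 0 := by linarith [hD.α_lt_one]
  rw [uHat, uHat, Nat.sub_self, hUV] at e3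
  exact smul_right_injective _ hσ (add_right_cancel e3)

theorem subsingleton_Xh_of_eq_empty (hΩ : D.Ω = ∅) : Subsingleton (Xh D.Ω 𝒯) :=
  ⟨fun u v => Subtype.ext <| funext fun x => by
    rw [u.2.2.2.1 x (by simp [hΩ]), v.2.2.2.1 x (by simp [hΩ])]⟩

theorem stepResidual_of_eq_empty (hΩ : D.Ω = ∅) (n : ℕ) (U : ℕ → Xh D.Ω 𝒯) (v : Xh D.Ω 𝒯) :
    stepResidual D k n U v = 0 := by
  simp [stepResidual, l2, diffusion, l2w, Data.B, hΩ]

theorem firstResidual_of_eq_empty (hΩ : D.Ω = ∅) (U : ℕ → Xh D.Ω 𝒯) (v : Xh D.Ω 𝒯) :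
    firstResidual D k U v = 0 := by
  simp [firstResidual, l2, diffusion, l2w, Data.B, hΩ]

theorem isInitial_of_eq_empty (hΩ : D.Ω = ∅) (w : Xh D.Ω 𝒯) : IsInitial D w := fun v => by
  simp [l2w, hΩ]

theorem step_wellPosed (hd : 1 ≤ d) (hD : D.Standing) (h2 : D.H2 m₀ L) (h3 : D.H3)
    (h𝒯 : IsTriangulation D.Ω γ κ h 𝒯) (hN : 1 ≤ N) (hk : k = D.T / N) {n : ℕ} (hn : 2 ≤ n)
    (hnN : n ≤ N) (U : ℕ → Xh D.Ω 𝒯) :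
    IsLinearPosDef D k n U ∧
      ∃! w : Xh D.Ω 𝒯, ∀ v, stepResidual D k n (Function.update U n w) v = 0 := by
  have hfin := Xh.finiteDimensional h𝒯
  obtain ⟨a, l, hsymm, hpos, hres⟩ : ∃ (a : Xh D.Ω 𝒯 →ₗ[ℝ] Xh D.Ω 𝒯 →ₗ[ℝ] ℝ)
      (l : Xh D.Ω 𝒯 →ₗ[ℝ] ℝ), (∀ u v, a u v = a v u) ∧ (∀ v, v ≠ 0 → 0 < a v v) ∧
        ∀ w v, stepResidual D k n (Function.update U n w) v = a w v - l v := by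
    rcases D.Ω.eq_empty_or_nonempty with hΩ | hne
    · have := subsingleton_Xh_of_eq_empty (𝒯 := 𝒯) hΩ
      exact ⟨0, 0, fun _ _ => rfl, fun v hv => absurd (Subsingleton.elim v 0) hv,
        fun w v => by simp [stepResidual_of_eq_empty hΩ]⟩
    · exact exists_step_form hd hD h2 h3 hne h𝒯 hN hk hn hnN U
  refine ⟨isLinearPosDef_of_form hsymm hpos hres, ?_⟩
  simp only [hres, sub_eq_zero]
  exact existsUnique_of_coercive a hpos l

theorem exists_solution (hd : 1 ≤ d) (hD : D.Standing) (h1 : D.H1) (h2 : D.H2 m₀ L) (h3 : D.H3)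
    (h𝒯 : IsTriangulation D.Ω γ κ h 𝒯) (hN : 1 ≤ N) (hk : k = D.T / N) :
    ∃ U : ℕ → Xh D.Ω 𝒯, IsSolution D k N U := by
  obtain ⟨U₁, hU₀, hU₁⟩ : ∃ U : ℕ → Xh D.Ω 𝒯, IsInitial D (U 0) ∧
      ∀ v, firstResidual D k U v = 0 := by
    rcases D.Ω.eq_empty_or_nonempty with hΩ | hne
    · exact ⟨0, isInitial_of_eq_empty hΩ _, firstResidual_of_eq_empty hΩ _⟩
    · obtain ⟨w₀, hw₀, -⟩ := exists_initial hd hD h1 h2 hne h𝒯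
      obtain ⟨w₁, hw₁⟩ := exists_first_step hd hD h1 h2 h3 hne h𝒯 hN hk fun _ => w₀
      exact ⟨_, by rwa [Function.update_of_ne (by omega)], hw₁⟩
  -- Induction on the last solved step. Changing the value at `m + 1` leaves the earlier equations
  -- intact, because each residual depends on values up to its own index only.
  have key : ∀ m : ℕ, ∃ U : ℕ → Xh D.Ω 𝒯, IsInitial D (U 0) ∧
      (∀ v, firstResidual D k U v = 0) ∧
      ∀ n, 2 ≤ n → n ≤ N → n ≤ m → ∀ v, stepResidual D k n U v = 0 := by
    intro m
    induction m with
    | zero => exact ⟨U₁, hU₀, hU₁, fun n hn _ hm => by omega⟩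
    | succ m ih =>
      obtain ⟨U, h0, hf, hs⟩ := ih
      by_cases hm : 2 ≤ m + 1 ∧ m + 1 ≤ N
      · obtain ⟨w, hw, -⟩ := (step_wellPosed hd hD h2 h3 h𝒯 hN hk hm.1 hm.2 U).2
        have hlt : ∀ j ≤ m, Function.update U (m + 1) w j = U j := fun j hj =>
          Function.update_of_ne (by omega) _ _
        refine ⟨Function.update U (m + 1) w, by rwa [hlt 0 (by omega)], fun v => ?_,
          fun n hn hnN hnm v => ?_⟩
        · rw [firstResidual_congr fun j hj => hlt j (by omega), hf]
        · rcases Nat.lt_or_ge m n with hmn | hmn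
          · obtain rfl : n = m + 1 := by omega
            exact hw v
          · rw [stepResidual_congr fun j hj => hlt j (by omega), hs n hn hnN hmn]
      · exact ⟨U, h0, hf, fun n hn hnN hnm => hs n hn hnN (by omega)⟩
  obtain ⟨U, h0, hf, hs⟩ := key N
  exact ⟨U, h0, hf, fun n hn hnN => hs n hn hnN hnN⟩

theorem IsSolution.eq_of_le (hd : 1 ≤ d) (hD : D.Standing) (h2 : D.H2 m₀ L) (h3 : D.H3)
    (h𝒯 : IsTriangulation D.Ω γ κ h 𝒯) (hN : 1 ≤ N) (hk : k = D.T / N) {U V : ℕ → Xh D.Ω 𝒯}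
    (hU : IsSolution D k N U) (hV : IsSolution D k N V) (e0 : U 0 = V 0) (e1 : U 1 = V 1) :
    ∀ n ≤ N, U n = V n := by
  intro n
  induction n using Nat.strong_induction_on with
  | _ n ih =>
    intro hnN
    rcases Nat.lt_or_ge n 2 with hn | hn
    · interval_cases n
      exacts [e0, e1]
    -- By the induction hypothesis both histories coincide, so `U n` and `V n` solve the same linear
    -- system, with the history taken from `U`.
    refine (step_wellPosed hd hD h2 h3 h𝒯 hN hk hn hnN U).2.unique (fun v => ?_) (fun v => ?_)
    · rw [Function.update_eq_self]
      exact hU.step n hn hnN v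
    · rw [stepResidual_congr (U' := V) fun j hj => ?_]
      · exact hV.step n hn hnN v
      · rcases hj.eq_or_lt with rfl | hj
        · rw [Function.update_self]
        · rw [Function.update_of_ne hj.ne, ih j hj (by omega)]

end Main

end KirchhoffFEM

end

theorem mainTheorem7 {d : ℕ} (hd : 1 ≤ d) (D : KirchhoffFEM.Data d) (hD : D.Standing)
    (h1 : D.H1) (m₀ L : ℝ) (h2 : D.H2 m₀ L) (h3 : D.H3)
    (γ κ : ℝ) (hγ : 0 < γ) (hκ : 0 ≤ κ) :
    ∃ k₀ : ℝ, 0 < k₀ ∧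
      ∀ (h : ℝ) (𝒯 : Geometry.SimplicialComplex ℝ (EuclideanSpace ℝ (Fin d))),
        0 < h → KirchhoffFEM.IsTriangulation D.Ω γ κ h 𝒯 →
      ∀ (N : ℕ) (k : ℝ), 1 ≤ N → k = D.T / N → k ≤ 1 →
        (∀ n : ℕ, 2 ≤ n → n ≤ N → ∀ U : ℕ → KirchhoffFEM.Xh D.Ω 𝒯,
          KirchhoffFEM.IsLinearPosDef D k n U ∧
          ∃! w : KirchhoffFEM.Xh D.Ω 𝒯,
            ∀ v, KirchhoffFEM.stepResidual D k n (Function.update U n w) v = 0) ∧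
        (∃ U : ℕ → KirchhoffFEM.Xh D.Ω 𝒯, KirchhoffFEM.IsSolution D k N U) ∧
        (k < k₀ → ∀ U V : ℕ → KirchhoffFEM.Xh D.Ω 𝒯,
          KirchhoffFEM.IsSolution D k N U → KirchhoffFEM.IsSolution D k N V →
          ∀ n ≤ N, U n = V n) := by
  open KirchhoffFEM in
  obtain ⟨k₀, hk₀, huniq⟩ : ∃ k₀ : ℝ, 0 < k₀ ∧
      ∀ (h : ℝ) (𝒯 : Geometry.SimplicialComplex ℝ (E d)), 0 < h → IsTriangulation D.Ω γ κ h 𝒯 →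
      ∀ (N : ℕ) (k : ℝ), 1 ≤ N → k = D.T / N → k ≤ 1 → k < k₀ → ∀ U V : ℕ → Xh D.Ω 𝒯,
        IsSolution D k N U → IsSolution D k N V → U 0 = V 0 ∧ U 1 = V 1 := by
    rcases D.Ω.eq_empty_or_nonempty with hΩ | hne
    · refine ⟨1, one_pos, fun h 𝒯 _ _ N k _ _ _ _ U V _ _ => ?_⟩
      have := subsingleton_Xh_of_eq_empty (𝒯 := 𝒯) hΩ
      exact ⟨Subsingleton.elim _ _, Subsingleton.elim _ _⟩
    · obtain ⟨k₀, hk₀, hthr⟩ := exists_threshold hd hD h1 h2 h3 hne hγ hκ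
      refine ⟨k₀, hk₀, fun h 𝒯 hh h𝒯 N k hN hk hk1 hkk U V hU hV => ?_⟩
      have e0 := (exists_initial hd hD h1 h2 hne h𝒯).unique hU.initial hV.initial
      exact ⟨e0, hthr h 𝒯 hh h𝒯 N k hN hk hk1 hkk U V hU.initial e0 hU.first hV.first⟩
  refine ⟨k₀, hk₀, fun h 𝒯 hh h𝒯 N k hN hk hk1 =>
    ⟨fun n hn hnN U => KirchhoffFEM.step_wellPosed hd hD h2 h3 h𝒯 hN hk hn hnN U,
      KirchhoffFEM.exists_solution hd hD h1 h2 h3 h𝒯 hN hk, fun hkk U V hU hV => ?_⟩⟩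
  obtain ⟨e0, e1⟩ := huniq h 𝒯 hh h𝒯 N k hN hk hk1 hkk U V hU hV
  exact hU.eq_of_le hd hD h2 h3 h𝒯 hN hk hV e0 e1
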